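/- **Setting.** *Hypersequents.* A hypersequent $U$ is a finite directed graph with vertex set $V$, edge set $E$ and partial source and target maps $s,t:E\rightharpoonup V$ (edges may be dangling), acyclic as an undirected graph, with edges labeled by positive MALL formulae (MALL without propositional variables; positive means head connective $0,1,\otimes$ or $\oplus$). A subset of $E+V$ is open when it contains all edges adjacent to each of its vertices. A morphism $U\to U'$ is a continuous map sending vertices to vertices, together with, for each edge $e$ sent to an edge $e'$ (a *persistent* edge; the others are *collapsed*), a path from the root of the label of $e'$ to a subformula equal to the label of $e$ (then the direction of $e$ is preserved) or to its De Morgan dual (then it is reversed). An *embedding* ($\hookrightarrow$) is a morphism which is an open embedding, sends edges to edges, and has only empty paths. $U$ is *atomic* if it is empty, a single edge, or a single vertex with edges that are all adjacent to it. *Moves.* The basic moves $U\to V$ (isomorphisms outside the part described) are: *cut*: a vertex $v$ of $V$ is split in $U$ into $v_1,v_2$ joined by a new edge, collapsed to $v$, the edges of $v$ being distributed among $v_1,v_2$; *tensor*: an edge $e_0$ labeled $A\otimes B$ is replaced by edges $e_1,e_2$ for $A$ and $B$, its source being split into two vertices, one adjacent to $e_1$ and one to $e_2$, among which its other edges are distributed,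 and its target becoming adjacent to both $e_1$ and $e_2$; *plus* (two moves): an edge labeled $A\oplus B$ is replaced by one for $A$, or by one for $B$; *one*: an edge labeled $1$ is removed together with its source, which must have no other edge. A *move* is a non-isomorphism which is a pullback of a basic move along an embedding; it is a *cut move* if that basic move is a cut. A move is *active* if it is a cut move or if the edge broken by it has a source in its codomain, and *passive* otherwise. A *generalized move* is a move or an embedding (disjoint union). A *play* on $U$ is a path of generalized moves ending at $U$; it is *cut free* if it has no cut move, and a *thread* if every move in it has an atomic codomain. *Strategies.* A strategy on $U$ is a (possibly empty) set $P$ of threads on $U$ which is (S1) prefix-closed; (S2) such that $t\in P$ implies $tf\in P$ for every embedding $f$ and for every passive move $f$ with atomic codomain; (S3) stable under isomorphism: if $m,m'$ are both moves or both embeddings, $i,j$ are isomorphisms and $m=i\,m'\,j$, then $t\,m\,t'\in P$ iff $t\,i\,m'\,j\,t'\in P$; (S4) for composable embeddings $h,h'$, $t\,h\,h'\,t'\in P$ iff $t\,(h\circ h')\,t'\in P$. Let $\mathsf S(U)$ be the set of strategies on $U$ and $\mathsf{CF}(U)$ the set of those all of whose plays are cut free. For an embedding $h:V\hookrightarrow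 U$, restriction is $h^*P=\{t' \mid h\,t'\in P\}$. Embeddings carry the topology in which a sieve covers if it is nonempty and jointly surjective on points. *Cut elimination.* A *cut only topological play* is a morphism which is a composite of cut moves, up to isomorphism. The relation "$p:X\to U$ descends along $c:U\to V$ as $q:Y\to V$" ($c$ a cut only topological play) is generated by piling up, starting from the empty plays and $c$, commuting squares whose horizontal sides are cut only topological plays $c',c$, with $c'$ above $c$, and whose vertical sides are: a move on the left and a non-cut move on the right; or embeddings on both sides; or a move on the left and nothing on the right. Given a play $r:W\to U$, an edge of $W$ is *doomed* if $c\circ r$ collapses it. A *$c$-cable* is a play $p$ on $U$ such that for each prefix $r:W\to U$ of $p$ every doomed edge of $W$ has two ends, and moreover, if $r$ is followed in $p$ by a move, $W$ is connected and its edges are doomed exactly when they have two ends. The *threads of* a play $p:Y\to U$ are the threads $t:X\to U$ that can be related to $p$ by an embedding $X\hookrightarrow Y$ obtained from $\mathrm{id}_U$ by piling up steps in which an embedding $j:X'\hookrightarrow Y'$ is replaced by an embedding $i:X\hookrightarrow Y$ as follows: (a) $t$ makes a move $m':X\to X'$ and $p$ a move $m:Y\to Y'$, with $m'$ the pullback of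 $m$ along $j$, and $i$ the upper side of the pullback square; (b) $X=X'$ and $p$ makes a move $m:Y\to Y'$ whose pullback along $j$ is $\mathrm{id}_X$, with upper side $i$; (c) $X=X'$ and $p$ makes an embedding $k:Y\hookrightarrow Y'$ with $k\,i=j$; (d) $Y=Y'$ and $t$ makes an embedding $h:X\hookrightarrow X'$, with $i=j\,h$. For a set $P$ of threads on $U$, $\mathrm{cutelim}_U(P)$ is the closure, under replacing $t\,h\,h'\,t'$ by $t\,(h\circ h')\,t'$ ($h,h'$ embeddings), of the set of plays that descend along $\mathrm{id}_U$ from the $\mathrm{id}_U$-cables all of whose threads are in $P$. **Statement.** $\mathsf S$ and $\mathsf{CF}$, with restriction, are sheaves on the category of hypersequents and embeddings, and the functions $P\mapsto \mathrm{cutelim}_U(P)$ define a morphism of sheaves $\mathsf S\to\mathsf{CF}$. That is, if $P$ is a strategy on $U$ then $\mathrm{cutelim}_U(P)$ is a cut free strategy on $U$, and for every embedding $h:V\hookrightarrow U$ we have $h^*(\mathrm{cutelim}_U(P))=\mathrm{cutelim}_V(h^*P)$. -/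

import Mathlib

open CategoryTheory

namespace MALLGame

/-! ### Formulae and occurrences -/

/-- Formulae of multiplicative additive linear logic without propositional variables. -/
inductive Formula : Type
  | zero : Formula
  | one : Formula
  | tensor : Formula → Formula → Formula
  | plus : Formula → Formula → Formula
  | top : Formula
  | bot : Formula
  | par : Formula → Formula → Formula
  | wth : Formula → Formula → Formula

namespace Formula

/-- The positive formulae are those whose head connective is `0`, `1`, `⊗` or `⊕`. -/
def IsPos : Formula → Prop
  | zero => True
  | one => True
  | tensor _ _ => True
  | plus _ _ => True
  | top => False
  | bot => False
  | par _ _ => False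
  | wth _ _ => False

/-- De Morgan duality. -/
def dual : Formula → Formula
  | zero => top
  | one => bot
  | tensor A B => par A.dual B.dual
  | plus A B => wth A.dual B.dual
  | top => zero
  | bot => one
  | par A B => tensor A.dual B.dual
  | wth A B => plus A.dual B.dual

/-- `A.sub p` is the subformula of `A` reached by the path `p` from the root (`false` is the left
premise of a binary connective and `true` the right one), if `p` is a path in `A`. -/
def sub : Formula → List Bool → Option Formula
  | A, [] => some A
  | tensor A _, false :: p => A.sub p
  | tensor _ B, true :: p => B.sub p
  | plus A _, false :: p => A.sub p
  | plus _ B, true :: p => B.sub p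
  | par A _, false :: p => A.sub p
  | par _ B, true :: p => B.sub p
  | wth A _, false :: p => A.sub p
  | wth _ B, true :: p => B.sub p
  | zero, _ :: _ => none
  | one, _ :: _ => none
  | top, _ :: _ => none
  | bot, _ :: _ => none

theorem dual_dual (A : Formula) : A.dual.dual = A := by
  induction A <;> simp_all [dual]

theorem not_isPos_dual {A : Formula} (h : A.IsPos) : ¬ A.dual.IsPos := by
  cases A <;> simp_all [dual, IsPos]

@[simp] theorem sub_nil (A : Formula) : A.sub [] = some A := by
  cases A <;> rfl

theorem sub_dual (A : Formula) (p : List Bool) : A.dual.sub p = (A.sub p).map dual := by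
  induction A generalizing p <;> rcases p with _ | ⟨b, p⟩ <;> (try cases b) <;>
    simp_all [dual, sub]

theorem sub_append (A : Formula) (q p : List Bool) :
    A.sub (q ++ p) = (A.sub q).bind (fun B => B.sub p) := by
  induction A generalizing q <;> rcases q with _ | ⟨b, q⟩ <;> (try cases b) <;>
    simp_all [sub]

end Formula

/-! ### Hypersequents -/

/-- A partial directed graph: edges may lack a source or a target. -/
structure PartialGraph where
  E : Type
  V : Type
  s : E → Option V
  t : E → Option V

namespace PartialGraph

/-- The edge `e` is adjacent to the vertex `v`. -/
def Adj (G : PartialGraph) (e : G.E) (v : G.V) : Prop := G.s e = some v ∨ G.t e = some v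

/-- The undirected bipartite graph of incidences between edges and vertices. -/
def incidence (G : PartialGraph) : SimpleGraph (G.E ⊕ G.V) :=
  SimpleGraph.fromRel fun x y => ∃ e v, x = Sum.inl e ∧ y = Sum.inr v ∧ G.Adj e v

end PartialGraph

/-- A labeled hypersequent: a finite partial directed graph, acyclic as an undirected graph (there
are no loops, and no cycles in the incidence graph), with edges labeled by positive formulae. -/
structure Hypersequent extends PartialGraph where
  finE : Finite E
  finV : Finite V
  noLoop : ∀ e v, s e = some v → t e ≠ some v
  acyclic : toPartialGraph.incidence.IsAcyclic
  label : E → Formula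
  label_pos : ∀ e, (label e).IsPos

namespace Hypersequent

/-- The underlying set of points of a hypersequent. -/
def Pt (U : Hypersequent) : Type := U.E ⊕ U.V

/-- A set of points is open when it contains all the edges adjacent to each of its vertices. -/
instance (U : Hypersequent) : TopologicalSpace U.Pt where
  IsOpen S := ∀ (v : U.V) (e : U.E), U.Adj e v → (Sum.inr v : U.E ⊕ U.V) ∈ S →
    (Sum.inl e : U.E ⊕ U.V) ∈ S
  isOpen_univ := fun _ _ _ _ => Set.mem_univ _
  isOpen_inter := fun _ _ hS hT v e h hv => ⟨hS v e h hv.1, hT v e h hv.2⟩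
  isOpen_sUnion := fun _ hS v e h ⟨A, hA, hv⟩ => ⟨A, hA, hS A hA v e h hv⟩

theorem isOpen_iff (U : Hypersequent) (S : Set U.Pt) :
    IsOpen S ↔ ∀ (v : U.V) (e : U.E), U.Adj e v → (Sum.inr v : U.E ⊕ U.V) ∈ S →
      (Sum.inl e : U.E ⊕ U.V) ∈ S := Iff.rfl

/-- The map on points given by a map on vertices and a map on edges; an edge goes either to an edge,
with an occurrence, or to a vertex. -/
def pointMap {U V : Hypersequent} (vert : U.V → V.V) (edge : U.E → (V.E × List Bool) ⊕ V.V) :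
    U.Pt → V.Pt
  | Sum.inl e => match edge e with
    | Sum.inl (e', _) => Sum.inl e'
    | Sum.inr v => Sum.inr v
  | Sum.inr v => Sum.inr (vert v)

/-- A morphism of hypersequents: a continuous function sending vertices to vertices, with, for each
edge `e` sent to an edge `e'` (a persistent edge), an occurrence `p` of the label of `e` in that of
`e'`, up to duality.  If the subformula reached is the label of `e` itself (a positive occurrence)
then the direction of `e` is preserved; if it is its dual (a negative occurrence) then it is
reversed.  We have `edge e = inl (e', p)` if `e` is persistent and `edge e = inr v` if `e` is
collapsed to `v`. -/
@[ext]
structure Hom (U V : Hypersequent) where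
  vert : U.V → V.V
  edge : U.E → (V.E × List Bool) ⊕ V.V
  cont : Continuous (pointMap vert edge)
  occ : ∀ e e' p, edge e = Sum.inl (e', p) →
    ((V.label e').sub p = some (U.label e) ∧
      (∀ v, U.s e = some v → V.s e' = some (vert v)) ∧
      (∀ v, U.t e = some v → V.t e' = some (vert v))) ∨
    ((V.label e').sub p = some (U.label e).dual ∧
      (∀ v, U.s e = some v → V.t e' = some (vert v)) ∧
      (∀ v, U.t e = some v → V.s e' = some (vert v)))

/-- The underlying continuous function of a morphism. -/
def Hom.toFun {U V : Hypersequent} (f : Hom U V) : U.Pt → V.Pt := pointMap f.vert f.edge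

/-- The identity morphism. -/
def Hom.id (U : Hypersequent) : Hom U U where
  vert := fun v => v
  edge := fun e => Sum.inl (e, [])
  cont := by
    have : pointMap (U := U) (V := U) (fun v => v) (fun e => Sum.inl (e, [])) = fun x => x := by
      funext x; rcases x with e | v <;> rfl
    rw [this]; exact continuous_id
  occ := by
    intro e e' p h
    simp only [Sum.inl.injEq, Prod.mk.injEq] at h
    obtain ⟨rfl, rfl⟩ := h
    left; simp

/-- The action on edges of a composite: occurrences are concatenated. -/
def compEdge {U V W : Hypersequent} (f : Hom U V) (g : Hom V W) (e : U.E) :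
    (W.E × List Bool) ⊕ W.V :=
  match f.edge e with
  | Sum.inl (e', p) => match g.edge e' with
    | Sum.inl (e'', q) => Sum.inl (e'', q ++ p)
    | Sum.inr v => Sum.inr v
  | Sum.inr v => Sum.inr (g.vert v)

theorem pointMap_comp {U V W : Hypersequent} (f : Hom U V) (g : Hom V W) :
    pointMap (fun v => g.vert (f.vert v)) (compEdge f g) = g.toFun ∘ f.toFun := by
  funext x
  rcases x with e | v
  · simp only [pointMap, compEdge, Hom.toFun, Function.comp]
    rcases f.edge e with ⟨e', p⟩ | v
    · dsimp only
      rcases g.edge e' with ⟨e'', q⟩ | v <;> rfl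
    · rfl
  · rfl

/-- Composition of morphisms (in diagrammatic order). -/
def Hom.comp {U V W : Hypersequent} (f : Hom U V) (g : Hom V W) : Hom U W where
  vert := fun v => g.vert (f.vert v)
  edge := compEdge f g
  cont := by rw [pointMap_comp]; exact g.cont.comp f.cont
  occ := by
    intro e e'' r h
    unfold compEdge at h
    rcases hf : f.edge e with ⟨e', p⟩ | v
    · rw [hf] at h
      dsimp only at h
      rcases hg : g.edge e' with ⟨e3, q⟩ | v
      · rw [hg] at h
        simp only [Sum.inl.injEq, Prod.mk.injEq] at h
        obtain ⟨rfl, rfl⟩ := h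
        rcases f.occ _ _ _ hf with ⟨h1, h2, h3⟩ | ⟨h1, h2, h3⟩ <;>
        rcases g.occ _ _ _ hg with ⟨k1, k2, k3⟩ | ⟨k1, k2, k3⟩
        · left
          refine ⟨by rw [Formula.sub_append, k1]; exact h1, fun v hv => k2 _ (h2 v hv),
            fun v hv => k3 _ (h3 v hv)⟩
        · right
          refine ⟨by rw [Formula.sub_append, k1]; simp [Formula.sub_dual, h1],
            fun v hv => k2 _ (h2 v hv), fun v hv => k3 _ (h3 v hv)⟩
        · right
          refine ⟨by rw [Formula.sub_append, k1]; exact h1, fun v hv => k3 _ (h2 v hv),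
            fun v hv => k2 _ (h3 v hv)⟩
        · left
          refine ⟨by rw [Formula.sub_append, k1]; simp [Formula.sub_dual, h1, Formula.dual_dual],
            fun v hv => k3 _ (h2 v hv), fun v hv => k2 _ (h3 v hv)⟩
      · rw [hg] at h; simp at h
    · rw [hf] at h; simp at h

/-- The category of hypersequents. -/
instance : Category Hypersequent where
  Hom := Hom
  id := Hom.id
  comp := Hom.comp
  id_comp := by
    intro U V f
    ext e
    · rfl
    · simp only [Hom.comp, Hom.id, compEdge]
      rcases f.edge e with ⟨e', p⟩ | v <;> simp
  comp_id := by
    intro U V f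
    ext e
    · rfl
    · simp only [Hom.comp, Hom.id, compEdge]
      rcases f.edge e with ⟨e', p⟩ | v <;> simp
  assoc := by
    intro U V W X f g h
    ext e
    · rfl
    · simp only [Hom.comp, compEdge]
      rcases f.edge e with ⟨e', p⟩ | v
      · dsimp only
        rcases g.edge e' with ⟨e2, q⟩ | v
        · dsimp only
          rcases h.edge e2 with ⟨e3, r⟩ | v <;> simp
        · rfl
      · rfl

theorem comp_vert {U V W : Hypersequent} (f : U ⟶ V) (g : V ⟶ W) (v : U.V) :
    (f ≫ g).vert v = g.vert (f.vert v) := rfl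

theorem comp_edge {U V W : Hypersequent} (f : U ⟶ V) (g : V ⟶ W) :
    (f ≫ g).edge = compEdge f g := rfl

theorem comp_toFun {U V W : Hypersequent} (f : U ⟶ V) (g : V ⟶ W) :
    (f ≫ g).toFun = g.toFun ∘ f.toFun := pointMap_comp f g

theorem id_toFun (U : Hypersequent) : (𝟙 U : U ⟶ U).toFun = _root_.id := by
  funext x; rcases x with e | v <;> rfl

/-- The edge has both a source and a target. -/
def TwoEnded (U : Hypersequent) (e : U.E) : Prop := (U.s e).isSome ∧ (U.t e).isSome

/-- A hypersequent is atomic when it is empty, or a single edge, or a sequent, i.e., a single vertex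
with edges that are all adjacent to it. -/
def IsAtomic (U : Hypersequent) : Prop :=
  (IsEmpty U.E ∧ IsEmpty U.V) ∨
  (IsEmpty U.V ∧ ∃ e : U.E, ∀ e', e' = e) ∨
  (∃ v : U.V, (∀ v', v' = v) ∧ ∀ e, U.Adj e v)

end Hypersequent

open Hypersequent

/-! ### Embeddings and moves -/

/-- Embeddings: open embeddings that send each edge to an edge, with the identity occurrence. -/
def IsEmb : MorphismProperty Hypersequent := fun U V f =>
  Topology.IsOpenEmbedding (Hom.toFun f) ∧ ∀ e : U.E, ∃ e' : V.E, f.edge e = Sum.inl (e', [])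

instance : IsEmb.IsMultiplicative where
  id_mem U := ⟨by rw [id_toFun]; exact Topology.IsOpenEmbedding.id, fun e => ⟨e, rfl⟩⟩
  comp_mem {U V W} f g hf hg := by
    refine ⟨by rw [comp_toFun]; exact hg.1.comp hf.1, fun e => ?_⟩
    obtain ⟨e', he'⟩ := hf.2 e
    obtain ⟨e'', he''⟩ := hg.2 e'
    exact ⟨e'', by rw [comp_edge, compEdge, he']; dsimp only; rw [he'']; simp⟩

/-- `m` is an isomorphism outside the shown part: it restricts to a bijection, with identity
occurrences, from the edges outside `D` to the edges outside `D'`, and to a bijection onto the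
vertices outside `A'`; and each persistent edge has as many ends as its image. -/
structure IsoOutside {U V : Hypersequent} (m : U ⟶ V) (D : Set U.E) (D' : Set V.E)
    (A' : Set V.V) : Prop where
  edge_map : ∀ e, e ∉ D → ∃ e', e' ∉ D' ∧ m.edge e = Sum.inl (e', [])
  edge_lift : ∀ e', e' ∉ D' → ∃! e, e ∉ D ∧ m.edge e = Sum.inl (e', [])
  vert_lift : ∀ y, y ∉ A' → ∃! x, m.vert x = y
  ends_lift : ∀ e e' p y, m.edge e = Sum.inl (e', p) → V.Adj e' y →
    ∃ x, U.Adj e x ∧ m.vert x = y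

/-- The basic cut move: the vertex `v` is split into `v₁` and `v₂`, joined by a new edge `c` from
`v₁` to `v₂`, and the edges of `v` are distributed among `v₁` and `v₂`. -/
def IsBasicCut : MorphismProperty Hypersequent := fun U V m =>
  ∃ (c : U.E) (v₁ v₂ : U.V) (v : V.V),
    U.s c = some v₁ ∧ U.t c = some v₂ ∧ m.edge c = Sum.inr v ∧
    (∀ x, m.vert x = v ↔ x = v₁ ∨ x = v₂) ∧
    IsoOutside m {c} ∅ {v}

/-- The basic tensor move: an edge `e₀` labeled `A ⊗ B` is replaced by two edges `e₁` and `e₂`, for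
`A` and `B`.  The source `v` of `e₀` is split into `v₁` and `v₂`, adjacent to `e₁` and `e₂`
respectively, among which the other edges of `v` are distributed; the target of `e₀` becomes
adjacent to both `e₁` and `e₂`.  The edge `e₀` may lack ends: adding the missing ends shows that
such an `m` is a restriction of one in which `e₀` has two ends. -/
def IsBasicTensor : MorphismProperty Hypersequent := fun U V m =>
  ∃ (e₁ e₂ : U.E) (e₀ : V.E) (A B : Formula),
    V.label e₀ = Formula.tensor A B ∧
    m.edge e₁ = Sum.inl (e₀, [false]) ∧ m.edge e₂ = Sum.inl (e₀, [true]) ∧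
    (∀ v, V.s e₀ = some v → ∃ v₁ v₂, v₁ ≠ v₂ ∧ U.Adj e₁ v₁ ∧ U.Adj e₂ v₂ ∧
      ∀ x, m.vert x = v ↔ x = v₁ ∨ x = v₂) ∧
    IsoOutside m {e₁, e₂} {e₀} {v | V.s e₀ = some v}

/-- The two basic plus moves: an edge labeled `A ⊕ B` is replaced by an edge for `A`, or for `B`. -/
def IsBasicPlus : MorphismProperty Hypersequent := fun U V m =>
  ∃ (e₁ : U.E) (e₀ : V.E) (A B : Formula) (b : Bool),
    V.label e₀ = Formula.plus A B ∧ m.edge e₁ = Sum.inl (e₀, [b]) ∧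
    IsoOutside m {e₁} {e₀} ∅

/-- The basic unit move: an edge `e₀` labeled `1` is removed, together with its source, to which no
other edge is adjacent. -/
def IsBasicOne : MorphismProperty Hypersequent := fun U V m =>
  ∃ e₀ : V.E, V.label e₀ = Formula.one ∧
    (∀ v, V.s e₀ = some v → (∀ x : U.V, m.vert x ≠ v) ∧ ∀ e, V.Adj e v → e = e₀) ∧
    IsoOutside m ∅ {e₀} {v | V.s e₀ = some v}

/-- The basic moves. -/
def IsBasicMove : MorphismProperty Hypersequent := fun _ _ m =>
  IsBasicCut m ∨ IsBasicTensor m ∨ IsBasicPlus m ∨ IsBasicOne m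

/-- The morphisms that are not isomorphisms, and are restrictions (pullbacks) of morphisms in `B`
along embeddings. -/
def properRestrictions (B : MorphismProperty Hypersequent) : MorphismProperty Hypersequent :=
  fun U V m => ¬ IsIso m ∧ ∃ (U' V' : Hypersequent) (m' : U' ⟶ V') (i : U ⟶ U') (j : V ⟶ V'),
    B m' ∧ IsEmb i ∧ IsEmb j ∧ IsPullback i m m' j

/-- (Proper) moves. -/
def IsMove : MorphismProperty Hypersequent := properRestrictions IsBasicMove

/-- Cut moves. -/
def IsCutMove : MorphismProperty Hypersequent := properRestrictions IsBasicCut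

/-- The vertex `v` is active in the move `m`: either `m` is a cut and `v` is the cut sequent, i.e.,
the vertex to which an edge is collapsed, or `m` is not a cut and `v` is the source of the broken
edge, i.e., of an edge which is not the image of an edge with identity occurrence. -/
def IsActiveVertex {U V : Hypersequent} (m : U ⟶ V) (v : V.V) : Prop :=
  (IsCutMove m ∧ ∃ e : U.E, m.edge e = Sum.inr v) ∨
  (¬ IsCutMove m ∧ ∃ e₀ : V.E, (∀ e : U.E, m.edge e ≠ Sum.inl (e₀, [])) ∧ V.s e₀ = some v)

/-- Passive moves are those without active vertex. -/
def IsPassiveMove {U V : Hypersequent} (m : U ⟶ V) : Prop :=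
  IsMove m ∧ ∀ v, ¬ IsActiveVertex m v

/-- Generalized moves: the disjoint union of moves and embeddings. -/
inductive GMove (W V : Hypersequent) : Type
  | move (m : W ⟶ V) (hm : IsMove m) : GMove W V
  | emb (h : W ⟶ V) (hh : IsEmb h) : GMove W V

/-- The underlying morphism of a generalized move. -/
def GMove.hom {W V : Hypersequent} : GMove W V → (W ⟶ V)
  | move m _ => m
  | emb h _ => h

/-- Two generalized moves are of the same kind: both moves, or both embeddings. -/
def GMove.SameKind {W V W' V' : Hypersequent} : GMove W V → GMove W' V' → Prop
  | move _ _, move _ _ => True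
  | emb _ _, emb _ _ => True
  | _, _ => False

/-- A generalized move is mandatory when it is an embedding or a passive move to an atomic
hypersequent. -/
def GMove.IsMandatory {W V : Hypersequent} : GMove W V → Prop
  | move m _ => V.IsAtomic ∧ IsPassiveMove m
  | emb _ _ => True

/-! ### Plays and strategies -/

/-- Plays on `U`: paths to `U` in the graph of generalized moves. -/
inductive Play (U : Hypersequent) : Hypersequent → Type 1
  | nil : Play U U
  | snoc {V W : Hypersequent} : Play U V → GMove W V → Play U W

namespace Play

/-- Composition of plays. -/
def append {U V : Hypersequent} (t : Play U V) : ∀ {W : Hypersequent}, Play V W → Play U W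
  | _, nil => t
  | _, snoc t' f => snoc (append t t') f

/-- The morphism underlying a play. -/
def geom {U : Hypersequent} : ∀ {X : Hypersequent}, Play U X → (X ⟶ U)
  | _, nil => 𝟙 U
  | _, snoc t f => f.hom ≫ geom t

/-- A thread is a play in which every move has an atomic codomain. -/
def IsThread {U : Hypersequent} : ∀ {X : Hypersequent}, Play U X → Prop
  | _, nil => True
  | _, snoc (V := V) t (GMove.move _ _) => IsThread t ∧ V.IsAtomic
  | _, snoc t (GMove.emb _ _) => IsThread t

/-- A cut free play is one without cut moves. -/
def IsCutFree {U : Hypersequent} : ∀ {X : Hypersequent}, Play U X → Prop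
  | _, nil => True
  | _, snoc t (GMove.move m _) => IsCutFree t ∧ ¬ IsCutMove m
  | _, snoc t (GMove.emb _ _) => IsCutFree t

theorem append_assoc {U V W X : Hypersequent} (p : Play U V) (q : Play V W) (r : Play W X) :
    (p.append q).append r = p.append (q.append r) := by
  induction r with
  | nil => rfl
  | snoc r f ih => simp only [append, ih]

theorem nil_append {U V : Hypersequent} (p : Play U V) : (nil : Play U U).append p = p := by
  induction p with
  | nil => rfl
  | snoc r f ih => simp only [append, ih]

theorem isThread_append {U V : Hypersequent} (p : Play U V) {W : Hypersequent} (q : Play V W) :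
    (p.append q).IsThread ↔ p.IsThread ∧ q.IsThread := by
  induction q with
  | nil => simp [append, IsThread]
  | snoc r f ih => cases f <;> simp [append, IsThread, ih, and_assoc]

theorem isCutFree_append {U V : Hypersequent} (p : Play U V) {W : Hypersequent} (q : Play V W) :
    (p.append q).IsCutFree ↔ p.IsCutFree ∧ q.IsCutFree := by
  induction q with
  | nil => simp [append, IsCutFree]
  | snoc r f ih => cases f <;> simp [append, IsCutFree, ih, and_assoc]

end Play

/-- Sets of plays on `U`. -/
abbrev PlaySet (U : Hypersequent) : Type 1 := ∀ X : Hypersequent, Set (Play U X)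

/-- The axioms for a set of plays on `U` to be a strategy. -/
structure IsStrategy {U : Hypersequent} (P : PlaySet U) : Prop where
  isThread : ∀ {X} (p : Play U X), p ∈ P X → p.IsThread
  /-- prefix-closed -/
  prefix_closed : ∀ {V X} (t : Play U V) (t' : Play V X), t.append t' ∈ P X → t ∈ P V
  /-- stable under extension by mandatory generalized moves -/
  mandatory : ∀ {V W} (t : Play U V) (f : GMove W V), f.IsMandatory → t ∈ P V → t.snoc f ∈ P W
  /-- stable under isomorphism -/
  iso : ∀ {X Y X' Y' Z} (t : Play U Y) (m : GMove X Y) (m' : GMove X' Y') (j : X ⟶ X')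
    (i : Y' ⟶ Y) (hj : IsEmb j) (hi : IsEmb i) (t' : Play X Z),
    t.IsThread → t'.IsThread → IsIso j → IsIso i → m.SameKind m' →
    m.hom = j ≫ m'.hom ≫ i →
    ((t.snoc m).append t' ∈ P Z ↔
      (((t.snoc (GMove.emb i hi)).snoc m').snoc (GMove.emb j hj)).append t' ∈ P Z)
  /-- stable under composition and decomposition of embeddings -/
  comp : ∀ {X Y Z W} (t : Play U Y) (h : Z ⟶ Y) (h' : X ⟶ Z) (hh : IsEmb h) (hh' : IsEmb h')
    (t' : Play X W), t.IsThread → t'.IsThread →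
    (((t.snoc (GMove.emb h hh)).snoc (GMove.emb h' hh')).append t' ∈ P W ↔
      (t.snoc (GMove.emb (h' ≫ h) (IsEmb.comp_mem _ _ hh' hh))).append t' ∈ P W)

/-- The restriction of a set of plays on `U` along a play `t` to `U`. -/
def PlaySet.restrict {U V : Hypersequent} (P : PlaySet U) (t : Play U V) : PlaySet V :=
  fun X => {t' : Play V X | t.append t' ∈ P X}

theorem IsStrategy.restrict {U V : Hypersequent} {P : PlaySet U} (hP : IsStrategy P)
    (t : Play U V) (ht : t.IsThread) : IsStrategy (P.restrict t) where
  isThread p hp := ((Play.isThread_append t p).1 (hP.isThread _ hp)).2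
  prefix_closed u u' h := hP.prefix_closed (t.append u) u' (by
    rw [Play.append_assoc]; exact h)
  mandatory u f hf hu := hP.mandatory (t.append u) f hf hu
  iso u m m' j i hj hi u' hu hu' hji hii hk hm := by
    have := hP.iso (t.append u) m m' j i hj hi u'
      ((Play.isThread_append _ _).2 ⟨ht, hu⟩) hu' hji hii hk hm
    simp only [PlaySet.restrict, Set.mem_ofPred_eq, ← Play.append_assoc]
    exact this
  comp u h h' hh hh' u' hu hu' := by
    have := hP.comp (t.append u) h h' hh hh' u' ((Play.isThread_append _ _).2 ⟨ht, hu⟩) hu'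
    simp only [PlaySet.restrict, Set.mem_ofPred_eq, ← Play.append_assoc]
    exact this

/-- The one-step play given by an embedding. -/
def embPlay {V U : Hypersequent} (h : V ⟶ U) (hh : IsEmb h) : Play U V :=
  Play.nil.snoc (GMove.emb h hh)

theorem IsStrategy.snoc_iso {U : Hypersequent} {P : PlaySet U} (hP : IsStrategy P)
    {X Y X' Z : Hypersequent} (t : Play U Y) (m : GMove X Y) (m' : GMove X' Y) (j : X ⟶ X')
    (hj : IsEmb j) (t' : Play X Z) (ht : t.IsThread) (ht' : t'.IsThread) (hji : IsIso j)
    (hk : m.SameKind m') (hm : m.hom = j ≫ m'.hom) :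
    (t.snoc m).append t' ∈ P Z ↔ ((t.snoc m').snoc (GMove.emb j hj)).append t' ∈ P Z := by
  have hid : ∀ W, IsEmb (𝟙 W) := IsEmb.id_mem
  have hj' : ((Play.nil.snoc (GMove.emb j hj)).append t').IsThread :=
    (Play.isThread_append _ _).2 ⟨trivial, ht'⟩
  have hkk : m'.SameKind m' := by cases m' <;> trivial
  have e1 := hP.iso t m m' j (𝟙 Y) hj (hid Y) t' ht ht' hji inferInstance hk (by simp [hm])
  have e2 := hP.iso t m' m' (𝟙 X') (𝟙 Y) (hid _) (hid _)
    ((Play.nil.snoc (GMove.emb j hj)).append t') ht hj' inferInstance inferInstance hkk (by simp)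
  have e3 : (((t.snoc (GMove.emb (𝟙 Y) (hid Y))).snoc m').snoc
      (GMove.emb j hj)).append t' ∈ P Z ↔
      ((((t.snoc (GMove.emb (𝟙 Y) (hid Y))).snoc m').snoc
        (GMove.emb (𝟙 X') (hid X'))).snoc (GMove.emb j hj)).append t' ∈ P Z := by
    by_cases hth : (t.snoc m').IsThread
    · have e4 := hP.comp ((t.snoc (GMove.emb (𝟙 Y) (hid Y))).snoc m') (𝟙 X') j (hid _) hj t'
        (by cases m' <;> exact hth) ht'
      rw [e4]
      simp only [Category.comp_id]
    · constructor <;> intro h <;> exfalso <;> apply hth <;>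
        have h' := hP.isThread _ h <;> rw [Play.isThread_append] at h' <;>
        (cases m' <;> exact h'.1)
  rw [e1, e3]
  simp only [← Play.append_assoc] at e2
  exact e2.symm

theorem IsStrategy.id_append {U : Hypersequent} {P : PlaySet U} (hP : IsStrategy P)
    {X : Hypersequent} (p : Play U X) :
    (embPlay (𝟙 U) (IsEmb.id_mem U)).append p ∈ P X ↔ p ∈ P X := by
  have hid : ∀ W, IsEmb (𝟙 W) := IsEmb.id_mem
  by_cases hp : p.IsThread
  swap
  · constructor
    · intro h; exact absurd ((Play.isThread_append _ _).1 (hP.isThread _ h)).2 hp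
    · intro h; exact absurd (hP.isThread _ h) hp
  have key : ∀ {X : Hypersequent} (p : Play U X),
      (∃ (Y : Hypersequent) (f : GMove Y U) (q : Play Y X), p = (Play.nil.snoc f).append q) ∨
        ∃ h : U = X, h ▸ (Play.nil : Play U U) = p := by
    intro X p
    induction p with
    | nil => exact Or.inr ⟨rfl, rfl⟩
    | snoc r f ih =>
      left
      rcases ih with ⟨Y, g, q, rfl⟩ | ⟨h, h'⟩
      · exact ⟨Y, g, q.snoc f, rfl⟩
      · subst h; subst h'; exact ⟨_, f, Play.nil, rfl⟩
  rcases key p with ⟨Y, f, q, rfl⟩ | ⟨h, h'⟩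
  · have hq : q.IsThread := ((Play.isThread_append _ _).1 hp).2
    have hk : f.SameKind f := by cases f <;> trivial
    have e1 := hP.iso Play.nil f f (𝟙 Y) (𝟙 U) (hid _) (hid _) q trivial hq inferInstance
      inferInstance hk (by simp)
    have e2 := hP.snoc_iso (embPlay (𝟙 U) (hid U)) f f (𝟙 Y) (hid _) q trivial hq inferInstance
      hk (by simp)
    rw [e1, ← Play.append_assoc]
    exact e2
  · subst h; subst h'
    exact ⟨fun h => hP.prefix_closed Play.nil (embPlay (𝟙 U) (hid U)) h,
      fun h => hP.mandatory Play.nil (GMove.emb (𝟙 U) (hid U)) trivial h⟩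

/-- Strategies on `U`. -/
structure Strategy (U : Hypersequent) where
  plays : PlaySet U
  isStrategy : IsStrategy plays

@[ext]
theorem Strategy.ext {U : Hypersequent} {P Q : Strategy U} (h : P.plays = Q.plays) : P = Q := by
  cases P; cases Q; cases h; rfl

/-- A strategy is cut free when all its plays are. -/
def Strategy.IsCutFree {U : Hypersequent} (P : Strategy U) : Prop :=
  ∀ (X : Hypersequent) (p : Play U X), p ∈ P.plays X → p.IsCutFree

/-- The restriction of a strategy along an embedding. -/
def Strategy.restrict {U V : Hypersequent} (P : Strategy U) (h : V ⟶ U) (hh : IsEmb h) :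
    Strategy V :=
  ⟨P.plays.restrict (embPlay h hh), P.isStrategy.restrict _ trivial⟩

theorem Strategy.IsCutFree.restrict {U V : Hypersequent} {P : Strategy U} (hP : P.IsCutFree)
    (h : V ⟶ U) (hh : IsEmb h) : (P.restrict h hh).IsCutFree :=
  fun X p hp => ((Play.isCutFree_append _ _).1 (hP X _ hp)).2

theorem Strategy.restrict_id {U : Hypersequent} (P : Strategy U) :
    P.restrict (𝟙 U) (IsEmb.id_mem U) = P := by
  ext X p
  exact P.isStrategy.id_append p

theorem Strategy.restrict_comp {U V W : Hypersequent} (P : Strategy U) (h : V ⟶ U) (h' : W ⟶ V)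
    (hh : IsEmb h) (hh' : IsEmb h') :
    P.restrict (h' ≫ h) (IsEmb.comp_mem _ _ hh' hh) = (P.restrict h hh).restrict h' hh' := by
  ext X p
  have hth : ∀ (t : Play U W), t.append p ∈ P.plays X → p.IsThread := fun t ht =>
    ((Play.isThread_append _ _).1 (P.isStrategy.isThread _ ht)).2
  have e1 : (embPlay h hh).append ((embPlay h' hh').append p) =
      ((Play.nil.snoc (GMove.emb h hh)).snoc (GMove.emb h' hh')).append p := by
    rw [← Play.append_assoc]; rfl
  change (embPlay (h' ≫ h) _).append p ∈ P.plays X ↔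
    (embPlay h hh).append ((embPlay h' hh').append p) ∈ P.plays X
  rw [e1]
  constructor
  · intro hp
    exact (P.isStrategy.comp Play.nil h h' hh hh' p trivial (hth _ hp)).2 hp
  · intro hp
    exact (P.isStrategy.comp Play.nil h h' hh hh' p trivial (hth _ hp)).1 hp

/-! ### The site of hypersequents and embeddings, and the presheaves of strategies -/

/-- The category of hypersequents and embeddings. -/
abbrev EmbCat : Type 1 := WideSubcategory IsEmb

/-- The presheaf of strategies. -/
def stratPresheaf : EmbCatᵒᵖ ⥤ Type 1 where
  obj U := Strategy U.unop.obj
  map h := TypeCat.ofHom fun P => P.restrict h.unop.hom h.unop.property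
  map_id U := by
    apply ConcreteCategory.hom_ext
    intro P
    exact P.restrict_id
  map_comp f g := by
    apply ConcreteCategory.hom_ext
    intro P
    exact P.restrict_comp f.unop.hom g.unop.hom f.unop.property g.unop.property

/-- The presheaf of cut free strategies. -/
def cutFreePresheaf : EmbCatᵒᵖ ⥤ Type 1 where
  obj U := {P : Strategy U.unop.obj // P.IsCutFree}
  map h := TypeCat.ofHom fun P =>
    ⟨P.1.restrict h.unop.hom h.unop.property, P.2.restrict h.unop.hom h.unop.property⟩
  map_id U := by
    apply ConcreteCategory.hom_ext
    intro P
    exact Subtype.ext P.1.restrict_id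
  map_comp f g := by
    apply ConcreteCategory.hom_ext
    intro P
    exact Subtype.ext (P.1.restrict_comp f.unop.hom g.unop.hom f.unop.property g.unop.property)

theorem adj_iff_specializes (U : Hypersequent) (e : U.E) (v : U.V) :
    U.Adj e v ↔ (show U.Pt from Sum.inl e) ⤳ (show U.Pt from Sum.inr v) := by
  rw [specializes_iff_forall_open]
  constructor
  · intro h S hS hv
    exact (U.isOpen_iff S).1 hS v e h hv
  · intro h
    have h1 : IsOpen ({x : U.Pt | x = Sum.inr v ∨ ∃ e', x = Sum.inl e' ∧ U.Adj e' v} :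
        Set U.Pt) := by
      rw [isOpen_iff]
      rintro v' e' ha (hv' | ⟨e'', h'', -⟩)
      · right
        refine ⟨e', rfl, ?_⟩
        cases Sum.inr_injective hv'
        exact ha
      · exact absurd h'' (by simp)
    rcases h _ h1 (Or.inl rfl) with h2 | ⟨e', h2, h3⟩
    · exact absurd h2 (by simp)
    · cases Sum.inl_injective h2
      exact h3

theorem IsEmb.adj_iff {U V : Hypersequent} {f : U ⟶ V} (hf : IsEmb f) {e : U.E} {e' : V.E}
    (he : f.edge e = Sum.inl (e', [])) (v : U.V) : U.Adj e v ↔ V.Adj e' (f.vert v) := by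
  rw [adj_iff_specializes, adj_iff_specializes, ← hf.1.isInducing.specializes_iff]
  have h1 : Hom.toFun f (Sum.inl e : U.E ⊕ U.V) = (Sum.inl e' : V.E ⊕ V.V) := by
    simp only [Hom.toFun, pointMap, he]
    rfl
  have h2 : Hom.toFun f (Sum.inr v : U.E ⊕ U.V) = (Sum.inr (f.vert v) : V.E ⊕ V.V) := rfl
  exact Iff.of_eq (congrArg₂ _ h1.symm.symm h2.symm.symm)

theorem IsEmb.edge_spec {U V : Hypersequent} {f : U ⟶ V} (hf : IsEmb f) {e : U.E} {e' : V.E}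
    (he : f.edge e = Sum.inl (e', [])) : V.label e' = U.label e ∧
      (∀ v, U.s e = some v ↔ V.s e' = some (f.vert v)) ∧
      (∀ v, U.t e = some v ↔ V.t e' = some (f.vert v)) := by
  rcases f.occ _ _ _ he with ⟨h1, h2, h3⟩ | ⟨h1, -, -⟩
  · refine ⟨by simpa using h1, fun v => ⟨h2 v, fun h => ?_⟩, fun v => ⟨h3 v, fun h => ?_⟩⟩
    · rcases (hf.adj_iff he v).2 (Or.inl h) with h' | h'
      · exact h'
      · exact absurd (h3 v h') (V.noLoop _ _ h)
    · rcases (hf.adj_iff he v).2 (Or.inr h) with h' | h'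
      · exact absurd h (V.noLoop _ _ (h2 v h'))
      · exact h'
  · have h4 : V.label e' = (U.label e).dual := by simpa using h1
    exact absurd (h4 ▸ V.label_pos e') (Formula.not_isPos_dual (U.label_pos e))

/-- Embeddings factor through embeddings with a larger image. -/
theorem IsEmb.exists_lift {A W U : Hypersequent} {a : A ⟶ U} {g : W ⟶ U} (ha : IsEmb a)
    (hg : IsEmb g) (h : Set.range (Hom.toFun a) ⊆ Set.range (Hom.toFun g)) :
    ∃ b : A ⟶ W, IsEmb b ∧ b ≫ g = a := by
  have hv : ∀ v : A.V, ∃ w : W.V, g.vert w = a.vert v := by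
    intro v
    obtain ⟨x, hx⟩ := h ⟨(Sum.inr v : A.E ⊕ A.V), rfl⟩
    rcases x with e | w
    · obtain ⟨e', he'⟩ := hg.2 e
      simp only [Hom.toFun, pointMap, he'] at hx
      exact absurd hx (by simp)
    · exact ⟨w, Sum.inr_injective hx⟩
  have he : ∀ e : A.E, ∃ e₁ : W.E, ∃ e₂ : U.E, a.edge e = Sum.inl (e₂, []) ∧
      g.edge e₁ = Sum.inl (e₂, []) := by
    intro e
    obtain ⟨e₂, he₂⟩ := ha.2 e
    obtain ⟨x, hx⟩ := h ⟨(Sum.inl e : A.E ⊕ A.V), rfl⟩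
    simp only [Hom.toFun, pointMap, he₂] at hx
    rcases x with e₁ | w
    · obtain ⟨e', he'⟩ := hg.2 e₁
      simp only [he'] at hx
      cases Sum.inl_injective hx
      exact ⟨e₁, _, he₂, he'⟩
    · exact absurd hx (by simp)
  choose bv hbv using hv
  choose be be' hbe hbe' using he
  have hcomp : Hom.toFun g ∘ pointMap (U := A) (V := W) bv (fun e => Sum.inl (be e, [])) =
      Hom.toFun a := by
    funext x
    rcases x with e | v
    · simp only [Function.comp, pointMap, Hom.toFun, hbe, hbe']
      rfl
    · simp only [Function.comp, pointMap, Hom.toFun, hbv]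
      rfl
  have hcont : Continuous (pointMap (U := A) (V := W) bv (fun e => Sum.inl (be e, []))) := by
    rw [hg.1.isInducing.continuous_iff, hcomp]
    exact ha.1.continuous
  refine ⟨{ vert := bv, edge := fun e => Sum.inl (be e, []), cont := hcont, occ := ?_ }, ?_, ?_⟩
  · intro e e' p hp
    simp only [Sum.inl.injEq, Prod.mk.injEq] at hp
    obtain ⟨rfl, rfl⟩ := hp
    have h1 := ha.edge_spec (hbe e)
    have h2 := hg.edge_spec (hbe' e)
    left
    refine ⟨?_, fun v hv => ?_, fun v hv => ?_⟩
    · rw [← h2.1, h1.1]; simp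
    · rw [h2.2.1, hbv]; exact (h1.2.1 v).1 hv
    · rw [h2.2.2, hbv]; exact (h1.2.2 v).1 hv
  · refine ⟨?_, fun e => ⟨be e, rfl⟩⟩
    refine Topology.IsOpenEmbedding.of_comp _ hg.1 ?_
    change Topology.IsOpenEmbedding (Hom.toFun g ∘ pointMap _ _)
    rw [hcomp]
    exact ha.1
  · apply Hom.ext
    · funext v; exact hbv v
    · funext e
      simp only [comp_edge, compEdge, hbe', hbe, List.append_nil]

open Classical in
/-- The sub-hypersequent given by a set of points. -/
noncomputable def subHypersequent (U : Hypersequent) (O : Set U.Pt) : Hypersequent where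
  E := {e : U.E // (show U.Pt from Sum.inl e) ∈ O}
  V := {v : U.V // (show U.Pt from Sum.inr v) ∈ O}
  s e := (U.s e.1).bind fun v =>
    if h : (show U.Pt from Sum.inr v) ∈ O then some ⟨v, h⟩ else none
  t e := (U.t e.1).bind fun v =>
    if h : (show U.Pt from Sum.inr v) ∈ O then some ⟨v, h⟩ else none
  finE := by have := U.finE; infer_instance
  finV := by have := U.finV; infer_instance
  noLoop := by
    rintro ⟨e, he⟩ ⟨v, hv⟩ h1 h2
    simp only [Option.bind_eq_some_iff, Option.dite_none_right_eq_some, Option.some.injEq,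
      Subtype.mk.injEq] at h1 h2
    obtain ⟨_, h1, -, rfl⟩ := h1
    obtain ⟨_, h2, -, rfl⟩ := h2
    exact U.noLoop _ _ h1 h2
  acyclic := by
    refine SimpleGraph.IsAcyclic.comap (G' := U.incidence)
      ⟨Sum.map Subtype.val Subtype.val, ?_⟩
      (Sum.map_injective.2 ⟨Subtype.val_injective, Subtype.val_injective⟩) U.acyclic
    have key : ∀ (e : {e : U.E // (show U.Pt from Sum.inl e) ∈ O})
        (v : {v : U.V // (show U.Pt from Sum.inr v) ∈ O}),
        (PartialGraph.Adj ⟨{e : U.E // (show U.Pt from Sum.inl e) ∈ O},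
          {v : U.V // (show U.Pt from Sum.inr v) ∈ O},
          fun e => (U.s e.1).bind fun v =>
            if h : (show U.Pt from Sum.inr v) ∈ O then some ⟨v, h⟩ else none,
          fun e => (U.t e.1).bind fun v =>
            if h : (show U.Pt from Sum.inr v) ∈ O then some ⟨v, h⟩ else none⟩ e v) →
        U.Adj e.1 v.1 := by
      rintro ⟨e, he⟩ ⟨v, hv⟩ h
      simp only [PartialGraph.Adj, Option.bind_eq_some_iff, Option.dite_none_right_eq_some,
        Option.some.injEq, Subtype.mk.injEq] at h ⊢
      rcases h with ⟨_, h, -, rfl⟩ | ⟨_, h, -, rfl⟩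
      · exact Or.inl h
      · exact Or.inr h
    intro x y hxy
    simp only [PartialGraph.incidence, SimpleGraph.fromRel_adj] at hxy ⊢
    obtain ⟨hne, ⟨e, v, rfl, rfl, h⟩ | ⟨e, v, rfl, rfl, h⟩⟩ := hxy
    · exact ⟨by simp, Or.inl ⟨_, _, rfl, rfl, key e v h⟩⟩
    · exact ⟨by simp, Or.inr ⟨_, _, rfl, rfl, key e v h⟩⟩
  label e := U.label e.1
  label_pos e := U.label_pos e.1

theorem subHypersequent_s {U : Hypersequent} {O : Set U.Pt} (e : (subHypersequent U O).E)
    (v : (subHypersequent U O).V) :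
    (subHypersequent U O).s e = some v ↔ U.s e.1 = some v.1 := by
  rcases e with ⟨e, he⟩
  rcases v with ⟨v, hv⟩
  simp only [subHypersequent, Option.bind_eq_some_iff, Option.dite_none_right_eq_some,
    Option.some.injEq, Subtype.mk.injEq]
  exact ⟨by rintro ⟨_, h, -, rfl⟩; exact h, fun h => ⟨v, h, hv, rfl⟩⟩

theorem subHypersequent_t {U : Hypersequent} {O : Set U.Pt} (e : (subHypersequent U O).E)
    (v : (subHypersequent U O).V) :
    (subHypersequent U O).t e = some v ↔ U.t e.1 = some v.1 := by
  rcases e with ⟨e, he⟩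
  rcases v with ⟨v, hv⟩
  simp only [subHypersequent, Option.bind_eq_some_iff, Option.dite_none_right_eq_some,
    Option.some.injEq, Subtype.mk.injEq]
  exact ⟨by rintro ⟨_, h, -, rfl⟩; exact h, fun h => ⟨v, h, hv, rfl⟩⟩

/-- Each open set of points is the image of an embedding. -/
theorem exists_isEmb_range (U : Hypersequent) (O : Set U.Pt) (hO : IsOpen O) :
    ∃ (A : Hypersequent) (a : A ⟶ U), IsEmb a ∧ Set.range (Hom.toFun a) = O := by
  have hadj : ∀ (e : (subHypersequent U O).E) (v : (subHypersequent U O).V),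
      (subHypersequent U O).Adj e v ↔ U.Adj e.1 v.1 := fun e v =>
    or_congr (subHypersequent_s e v) (subHypersequent_t e v)
  have hc : Continuous (pointMap (U := subHypersequent U O) (V := U) Subtype.val
      (fun e => Sum.inl (e.1, []))) := by
    rw [continuous_def]
    intro S hS
    rw [isOpen_iff] at hS ⊢
    intro v e h hv
    exact hS _ _ ((hadj e v).1 h) hv
  refine ⟨subHypersequent U O,
    { vert := Subtype.val, edge := fun e => Sum.inl (e.1, []), cont := hc, occ := ?_ },
    ⟨?_, fun e => ⟨e.1, rfl⟩⟩, ?_⟩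
  · intro e e' p h
    simp only [Sum.inl.injEq, Prod.mk.injEq] at h
    obtain ⟨rfl, rfl⟩ := h
    left
    exact ⟨by rw [Formula.sub_nil]; rfl, fun v hv => (subHypersequent_s e v).1 hv,
      fun v hv => (subHypersequent_t e v).1 hv⟩
  · refine Topology.IsOpenEmbedding.of_continuous_injective_isOpenMap hc ?_ ?_
    · rintro (e | v) (e' | v') h
      · exact congrArg Sum.inl (Subtype.ext (Sum.inl_injective h))
      · exact absurd h (by simp [pointMap, Hom.toFun])
      · exact absurd h (by simp [pointMap, Hom.toFun])
      · exact congrArg Sum.inr (Subtype.ext (Sum.inr_injective h))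
    · intro S hS
      rw [isOpen_iff] at hS ⊢
      rintro v e h ⟨x, hx, hxv⟩
      rcases x with e' | v'
      · exact absurd hxv (by simp [pointMap, Hom.toFun])
      · cases Sum.inr_injective hxv
        have heO := (U.isOpen_iff O).1 hO v'.1 e h v'.2
        exact ⟨Sum.inl ⟨e, heO⟩, hS v' ⟨e, heO⟩ ((hadj _ _).2 h) hx, rfl⟩
  · ext x
    constructor
    · rintro ⟨e | v, rfl⟩
      · exact e.2
      · exact v.2
    · intro hx
      rcases x with e | v
      · exact ⟨Sum.inl ⟨e, hx⟩, rfl⟩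
      · exact ⟨Sum.inr ⟨v, hx⟩, rfl⟩

/-- The Grothendieck topology on hypersequents and embeddings: a sieve covers `U` when it is
nonempty and jointly surjective on points.  (The nonemptiness is automatic unless `U` is empty.) -/
def embTopology : GrothendieckTopology EmbCat where
  sieves U := {R | (∃ (V : EmbCat) (f : V ⟶ U), R f) ∧
    ∀ x : U.obj.Pt, ∃ (V : EmbCat) (f : V ⟶ U), R f ∧ x ∈ Set.range (Hom.toFun f.hom)}
  top_mem' U := ⟨⟨U, 𝟙 U, trivial⟩, fun x => ⟨U, 𝟙 U, trivial, x, congrFun (id_toFun U.obj) x⟩⟩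
  pullback_stable' := by
    rintro U V R f ⟨⟨W₀, g₀, h₀⟩, hR⟩
    have key : ∀ (W : EmbCat) (g : W ⟶ U), R g → ∀ O : Set U.obj.Pt, IsOpen O →
        O ⊆ Set.range (Hom.toFun f.hom) → O ⊆ Set.range (Hom.toFun g.hom) →
        ∃ (A : EmbCat) (b : A ⟶ V), R.pullback f b ∧
          Set.range (Hom.toFun (b ≫ f).hom) = O := by
      intro W g hg O hO h1 h2
      obtain ⟨A, a, ha, rfl⟩ := exists_isEmb_range U.obj O hO
      obtain ⟨b, hb, hbf⟩ := ha.exists_lift f.property h1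
      obtain ⟨d, hd, hdg⟩ := ha.exists_lift g.property h2
      refine ⟨⟨A⟩, ⟨b, hb⟩, ?_, ?_⟩
      · have : (⟨b, hb⟩ : (⟨A⟩ : EmbCat) ⟶ V) ≫ f = (⟨d, hd⟩ : (⟨A⟩ : EmbCat) ⟶ W) ≫ g := by
          apply WideSubcategory.hom_ext
          change b ≫ f.hom = d ≫ g.hom
          rw [hbf, hdg]
        change R (_ ≫ f)
        rw [this]
        exact R.downward_closed hg _
      · change Set.range (Hom.toFun (b ≫ f.hom)) = _
        rw [hbf]
    refine ⟨?_, fun y => ?_⟩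
    · obtain ⟨A, b, hb, -⟩ := key W₀ g₀ h₀ ∅ isOpen_empty (Set.empty_subset _)
        (Set.empty_subset _)
      exact ⟨A, b, hb⟩
    · obtain ⟨W, g, hg, hy⟩ := hR (Hom.toFun f.hom y)
      obtain ⟨A, b, hb, hr⟩ := key W g hg _
        (f.property.1.isOpen_range.inter g.property.1.isOpen_range) Set.inter_subset_left
        Set.inter_subset_right
      refine ⟨A, b, hb, ?_⟩
      have hy' : Hom.toFun f.hom y ∈ Set.range (Hom.toFun (b ≫ f).hom) := by
        rw [hr]; exact ⟨⟨y, rfl⟩, hy⟩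
      obtain ⟨z, hz⟩ := hy'
      refine ⟨z, f.property.1.injective ?_⟩
      rw [← hz]
      exact (congrFun (comp_toFun b.hom f.hom) z).symm
  transitive' := by
    rintro U S ⟨⟨V₀, f₀, h₀⟩, hS⟩ R hR
    refine ⟨?_, fun x => ?_⟩
    · obtain ⟨⟨W, g, hg⟩, -⟩ := hR h₀
      exact ⟨W, g ≫ f₀, hg⟩
    · obtain ⟨V, f, hf, y, rfl⟩ := hS x
      obtain ⟨-, h⟩ := hR hf
      obtain ⟨W, g, hg, z, rfl⟩ := h y
      exact ⟨W, g ≫ f, hg, z, congrFun (comp_toFun g.hom f.hom) z⟩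

/-! ### Cut elimination -/

/-- Cut only topological plays: the morphisms that admit a decomposition into cut moves, up to
isomorphism. -/
inductive IsCutOnly : ∀ {U V : Hypersequent}, (U ⟶ V) → Prop
  | iso {U V : Hypersequent} (f : U ⟶ V) (hf : IsIso f) : IsCutOnly f
  | cut {U V W : Hypersequent} (m : U ⟶ V) (c : V ⟶ W) (hm : IsCutMove m) (hc : IsCutOnly c) :
      IsCutOnly (m ≫ c)

/-- The descent relation between plays `p : X → U` and cut free plays `q : Y → V`, along a cut only
topological play `c : U → V`, with a cut only topological play `c' : X → Y` on top.  It is generated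
by piling up commuting squares (or triangles) of the following three forms, in which `c` and `c'`
are cut only topological plays: a move on the left and a non cut move on the right; embeddings on
both sides; a move on the left and the empty play on the right.  Since `c'` only collapses edges,
and embeddings and non cut moves send edges to edges, commutation of such a square means that
its upper and right-hand sides are the factorisation of the composite of the other two into a
collapsing of edges followed by a morphism that sends edges to edges. -/
inductive Descends {U V : Hypersequent} (c : U ⟶ V) :
    ∀ {X Y : Hypersequent}, Play U X → Play V Y → (X ⟶ Y) → Prop
  | nil (hc : IsCutOnly c) : Descends c Play.nil Play.nil c
  | move {X Y X' Y' : Hypersequent} {p : Play U X} {q : Play V Y} {d : X ⟶ Y}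
      (m : X' ⟶ X) (m' : Y' ⟶ Y) (d' : X' ⟶ Y') (hm : IsMove m) (hm' : IsMove m')
      (hcut : ¬ IsCutMove m') (hd' : IsCutOnly d') (w : d' ≫ m' = m ≫ d)
      (h : Descends c p q d) :
      Descends c (p.snoc (GMove.move m hm)) (q.snoc (GMove.move m' hm')) d'
  | emb {X Y X' Y' : Hypersequent} {p : Play U X} {q : Play V Y} {d : X ⟶ Y}
      (k : X' ⟶ X) (k' : Y' ⟶ Y) (d' : X' ⟶ Y') (hk : IsEmb k) (hk' : IsEmb k')
      (hd' : IsCutOnly d') (w : d' ≫ k' = k ≫ d) (h : Descends c p q d) :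
      Descends c (p.snoc (GMove.emb k hk)) (q.snoc (GMove.emb k' hk')) d'
  | moveId {X Y X' : Hypersequent} {p : Play U X} {q : Play V Y} {d : X ⟶ Y}
      (m : X' ⟶ X) (d' : X' ⟶ Y) (hm : IsMove m) (hd' : IsCutOnly d') (w : d' = m ≫ d)
      (h : Descends c p q d) :
      Descends c (p.snoc (GMove.move m hm)) q d'

/-- The set of plays descending from plays in `S` along `c`. -/
def descent {U V : Hypersequent} (c : U ⟶ V) (S : PlaySet U) : PlaySet V :=
  fun Y => {q : Play V Y | ∃ (X : Hypersequent) (p : Play U X) (c' : X ⟶ Y),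
    p ∈ S X ∧ Descends c p q c'}

/-- An edge of the domain of a play `r` is doomed when `c` after `r` collapses it to a vertex. -/
def IsDoomed {U V X : Hypersequent} (c : U ⟶ V) (r : Play U X) (e : X.E) : Prop :=
  ∃ v : V.V, (r.geom ≫ c).edge e = Sum.inr v

/-- A play is `c`-compatible when, at each stage, the doomed edges have two ends. -/
def IsCompatible {U V X : Hypersequent} (c : U ⟶ V) (p : Play U X) : Prop :=
  ∀ (W : Hypersequent) (r : Play U W) (q : Play W X), p = r.append q →
    ∀ e : W.E, IsDoomed c r e → W.TwoEnded e

/-- A play is `c`-atomic when its domain is connected (possibly empty) and its edges are doomed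
exactly when they have two ends. -/
def IsCAtomic {U V Y : Hypersequent} (c : U ⟶ V) (r : Play U Y) : Prop :=
  PreconnectedSpace Y.Pt ∧ ∀ e : Y.E, IsDoomed c r e ↔ Y.TwoEnded e

/-- A `c`-cable is a `c`-compatible play that is `c`-atomic before each move. -/
def IsCable {U V W : Hypersequent} (c : U ⟶ V) (p : Play U W) : Prop :=
  IsCompatible c p ∧
    ∀ (X Y : Hypersequent) (r : Play U Y) (m : X ⟶ Y) (hm : IsMove m) (q : Play X W),
      p = (r.snoc (GMove.move m hm)).append q → IsCAtomic c r

/-- `Sees t p i`: the play `t : X → U` sees a part of the play `p : Y → U`, with domains related by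
the embedding `i : X → Y`.  It is generated, starting from the identity of `U`, by the following
steps: both plays make a move, in a pullback square; `p` makes a move which the pullback along the
embedding turns into an identity; `p` makes an embedding; `t` makes an embedding. -/
inductive Sees {U : Hypersequent} :
    ∀ {X Y : Hypersequent}, Play U X → Play U Y → (X ⟶ Y) → Prop
  | nil : Sees Play.nil Play.nil (𝟙 U)
  | move {X Y X' Y' : Hypersequent} {t : Play U X} {p : Play U Y} {j : X ⟶ Y}
      (m' : X' ⟶ X) (m : Y' ⟶ Y) (i : X' ⟶ Y') (hm' : IsMove m') (hm : IsMove m) (hi : IsEmb i)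
      (hpb : IsPullback i m' m j) (h : Sees t p j) :
      Sees (t.snoc (GMove.move m' hm')) (p.snoc (GMove.move m hm)) i
  | moveRight {X Y Y' : Hypersequent} {t : Play U X} {p : Play U Y} {j : X ⟶ Y}
      (m : Y' ⟶ Y) (i : X ⟶ Y') (hm : IsMove m) (hi : IsEmb i)
      (hpb : IsPullback i (𝟙 X) m j) (h : Sees t p j) :
      Sees t (p.snoc (GMove.move m hm)) i
  | embRight {X Y Y' : Hypersequent} {t : Play U X} {p : Play U Y} {j : X ⟶ Y}
      (k : Y' ⟶ Y) (i : X ⟶ Y') (hk : IsEmb k) (hi : IsEmb i) (w : i ≫ k = j)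
      (h : Sees t p j) :
      Sees t (p.snoc (GMove.emb k hk)) i
  | embLeft {X Y X' : Hypersequent} {t : Play U X} {p : Play U Y} {j : X ⟶ Y}
      (k : X' ⟶ X) (hk : IsEmb k) (h : Sees t p j) :
      Sees (t.snoc (GMove.emb k hk)) p (k ≫ j)

/-- The set of threads of a play on `U`. -/
def threadsOf {U Y : Hypersequent} (p : Play U Y) : PlaySet U :=
  fun X => {t : Play U X | t.IsThread ∧ ∃ i : X ⟶ Y, Sees t p i}

/-- The `c`-cables of a set of threads `P`: those whose threads are all in `P`. -/
def cables {U V : Hypersequent} (c : U ⟶ V) (P : PlaySet U) : PlaySet U :=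
  fun Y => {p : Play U Y | IsCable c p ∧ ∀ X, threadsOf p X ⊆ P X}

/-- The closure of a set of plays under composition of embeddings: the plays reachable from it by
replacing consecutive embeddings by their composite. -/
inductive Closure {U : Hypersequent} (S : PlaySet U) : ∀ {X : Hypersequent}, Play U X → Prop
  | base {X : Hypersequent} (p : Play U X) (hp : p ∈ S X) : Closure S p
  | step {X Y Z W : Hypersequent} (t : Play U Y) (h : Z ⟶ Y) (h' : X ⟶ Z) (hh : IsEmb h)
      (hh' : IsEmb h') (t' : Play X W)
      (hc : Closure S (((t.snoc (GMove.emb h hh)).snoc (GMove.emb h' hh')).append t')) :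
      Closure S ((t.snoc (GMove.emb (h' ≫ h) (IsEmb.comp_mem _ _ hh' hh))).append t')

/-- Cut elimination of a set of threads along `c`: the closure, under composition of embeddings, of
the descent of its `c`-cables. -/
def cutElimAlong {U V : Hypersequent} (c : U ⟶ V) (P : PlaySet U) : PlaySet V :=
  fun Y => {q : Play V Y | Closure (descent c (cables c P)) q}

/-- Cut elimination on `U`, i.e., along the identity of `U`. -/
def cutElim (U : Hypersequent) (P : PlaySet U) : PlaySet U := cutElimAlong (𝟙 U) P

end MALLGame

namespace MALLGame

open Hypersequent

/-! ### Morphisms in combinatorial terms -/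

/-! Along the identity, the descent of cables becomes a simple inductive relation. The lower play
`q` makes no cut move, so its underlying morphism collapses no edge. The doomed edges at a stage of
the upper play are therefore the edges collapsed by the cut only morphism `d : X ⟶ Y` on top of the
stage. Such a `d` collapses only edges with two ends, is bijective from the other edges to those of
`Y`, and has fibres connected through collapsed edges. Hence compatibility is automatic, and the
condition put on a cable before each move says that `Y` is atomic (`IsCutOnly.isAtomic_iff`). This
gives the relation `Elim`, whose lower plays are visibly cut free threads, and the set `elimSet P`
of the `q` lying under some `p` whose threads are all in `P`.

To change the beginning of a play in `elimSet P`, one changes the cable above it, keeping the same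
top `d`, into a cable of which threads see no more than before (`SeesLe`, `elimSet_append_of`). The
obstacle is a move of the cable with no counterpart below, when it separates two steps that should
be merged. Such a move happens over an atomic `Y`, and an embedding into an atomic hypersequent is
an isomorphism or has a domain without vertices. In the first case the move is transported along the
isomorphism. In the second case the pullback of the move to the next stage is an identity, so that
the next embedding absorbs it (`absorb_move`). In particular `elimSet P` is already stable under
composition of embeddings, and the closure adds nothing.

The mandatory extensions come from lifts along `d`: an embedding lifts by pullback, and a passive
move lifts because the edge it breaks has no source, so that it leaves the vertices alone
(`IsCutOnly.exists_lift`). Prefix-closure holds because a thread of a prefix, once restricted to the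
empty hypersequent, sees the whole play. For naturality along `h`, cables on `V` are prefixed by
`h`; conversely, the moves that a cable makes before `h` with nothing below occur over an atomic
`U`, and are absorbed unless `h` is an isomorphism, in which case its inverse is used.

The sheaf property rests on the first move of a thread having an atomic codomain, while a covering
sieve contains all embeddings of atomic hypersequents. A thread with a move is thus read in a single
member of a compatible family. A thread made of embeddings only records that the strategy is
nonempty, and this passes from one member to another through the empty hypersequent, which embeds
everywhere. -/

theorem continuous_pointMap {U V : Hypersequent} {vert : U.V → V.V}
    {edge : U.E → (V.E × List Bool) ⊕ V.V}
    (h₁ : ∀ e e' p, edge e = Sum.inl (e', p) → ∀ v, U.Adj e v → V.Adj e' (vert v))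
    (h₂ : ∀ e w, edge e = Sum.inr w → ∀ v, U.Adj e v → w = vert v) :
    Continuous (pointMap vert edge) := by
  rw [continuous_def]
  intro S hS
  rw [isOpen_iff] at hS ⊢
  intro v e h hv
  change pointMap vert edge (Sum.inl e) ∈ S
  change pointMap vert edge (Sum.inr v) ∈ S at hv
  rcases he : edge e with ⟨e', p⟩ | w
  · simp only [pointMap, he] at hv ⊢
    exact hS _ _ (h₁ _ _ _ he _ h) hv
  · simp only [pointMap, he] at hv ⊢
    rw [h₂ _ _ he _ h]
    exact hv

theorem Hom.adj_map {U V : Hypersequent} (f : U ⟶ V) {e : U.E} {e' : V.E} {p : List Bool}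
    (he : f.edge e = Sum.inl (e', p)) {v : U.V} (h : U.Adj e v) : V.Adj e' (f.vert v) := by
  rcases f.occ _ _ _ he with ⟨-, h2, h3⟩ | ⟨-, h2, h3⟩ <;> rcases h with h | h
  · exact Or.inl (h2 v h)
  · exact Or.inr (h3 v h)
  · exact Or.inr (h2 v h)
  · exact Or.inl (h3 v h)

/-- An edge specializes to the vertices it touches, continuous maps preserve specialization, and
specialization between vertices is equality. -/
theorem Hom.vert_of_collapsed {U V : Hypersequent} (f : U ⟶ V) {e : U.E} {w : V.V}
    (he : f.edge e = Sum.inr w) {v : U.V} (h : U.Adj e v) : f.vert v = w := by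
  have h1 := ((adj_iff_specializes U e v).1 h).map f.cont
  rw [specializes_iff_forall_open] at h1
  have h2 : IsOpen ({x : V.Pt | x = Sum.inr (f.vert v) ∨ ∃ e', x = Sum.inl e'} : Set V.Pt) := by
    rw [isOpen_iff]
    intro v' e' _ _
    exact Or.inr ⟨e', rfl⟩
  have h3 := h1 _ h2 (Or.inl rfl)
  simp only [pointMap, he] at h3
  rcases h3 with h3 | ⟨e', h3⟩
  · exact (Sum.inr_injective h3).symm
  · exact absurd h3 (by simp)

theorem comp_edge_inl {U V W : Hypersequent} {f : U ⟶ V} {g : V ⟶ W} {e : U.E} {e' : V.E}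
    {e'' : W.E} {p q : List Bool} (hf : f.edge e = Sum.inl (e', p))
    (hg : g.edge e' = Sum.inl (e'', q)) : (f ≫ g).edge e = Sum.inl (e'', q ++ p) := by
  simp only [comp_edge, compEdge, hf, hg]

theorem comp_edge_inl_inr {U V W : Hypersequent} {f : U ⟶ V} {g : V ⟶ W} {e : U.E} {e' : V.E}
    {w : W.V} {p : List Bool} (hf : f.edge e = Sum.inl (e', p))
    (hg : g.edge e' = Sum.inr w) : (f ≫ g).edge e = Sum.inr w := by
  simp only [comp_edge, compEdge, hf, hg]

theorem comp_edge_inr {U V W : Hypersequent} {f : U ⟶ V} {g : V ⟶ W} {e : U.E}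
    {v : V.V} (hf : f.edge e = Sum.inr v) : (f ≫ g).edge e = Sum.inr (g.vert v) := by
  simp only [comp_edge, compEdge, hf]

theorem exists_of_comp_edge_inl {U V W : Hypersequent} {f : U ⟶ V} {g : V ⟶ W} {e : U.E}
    {e'' : W.E} {r : List Bool} (h : (f ≫ g).edge e = Sum.inl (e'', r)) :
    ∃ e' p q, f.edge e = Sum.inl (e', p) ∧ g.edge e' = Sum.inl (e'', q) ∧ r = q ++ p := by
  rcases hf : f.edge e with ⟨e', p⟩ | v
  · rcases hg : g.edge e' with ⟨e3, q⟩ | w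
    · rw [comp_edge_inl hf hg] at h
      cases h
      exact ⟨e', p, q, rfl, hg, rfl⟩
    · rw [comp_edge_inl_inr hf hg] at h
      cases h
  · rw [comp_edge_inr hf] at h
    cases h

theorem exists_of_comp_edge_nil {U V W : Hypersequent} {f : U ⟶ V} {g : V ⟶ W} {e : U.E}
    {e'' : W.E} (h : (f ≫ g).edge e = Sum.inl (e'', [])) :
    ∃ e', f.edge e = Sum.inl (e', []) ∧ g.edge e' = Sum.inl (e'', []) := by
  obtain ⟨e', p, q, h1, h2, h3⟩ := exists_of_comp_edge_inl h
  obtain ⟨rfl, rfl⟩ := List.append_eq_nil_iff.1 h3.symm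
  exact ⟨e', h1, h2⟩

theorem comp_vert_congr {U V V' W : Hypersequent} {f : U ⟶ V} {g : V ⟶ W} {f' : U ⟶ V'}
    {g' : V' ⟶ W} (h : f ≫ g = f' ≫ g') (v : U.V) : g.vert (f.vert v) = g'.vert (f'.vert v) := by
  rw [← comp_vert, ← comp_vert, h]

theorem toFun_inl {U V : Hypersequent} {f : U ⟶ V} {e : U.E} {e' : V.E} {p : List Bool}
    (h : f.edge e = Sum.inl (e', p)) : Hom.toFun f (Sum.inl e) = (Sum.inl e' : V.E ⊕ V.V) := by
  simp only [Hom.toFun, pointMap, h]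
  rfl

theorem toFun_inl_collapsed {U V : Hypersequent} {f : U ⟶ V} {e : U.E} {v : V.V}
    (h : f.edge e = Sum.inr v) : Hom.toFun f (Sum.inl e) = (Sum.inr v : V.E ⊕ V.V) := by
  simp only [Hom.toFun, pointMap, h]
  rfl

theorem toFun_inr {U V : Hypersequent} (f : U ⟶ V) (v : U.V) :
    Hom.toFun f (Sum.inr v) = (Sum.inr (f.vert v) : V.E ⊕ V.V) := rfl

theorem edge_of_toFun_eq_inl {U V : Hypersequent} {f : U ⟶ V} {x : U.Pt} {e' : V.E}
    (h : Hom.toFun f x = (Sum.inl e' : V.E ⊕ V.V)) :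
    ∃ e p, x = (Sum.inl e : U.E ⊕ U.V) ∧ f.edge e = Sum.inl (e', p) := by
  rcases x with e | v
  · rcases he : f.edge e with ⟨e₁, p⟩ | w
    · rw [toFun_inl he] at h
      cases Sum.inl_injective h
      exact ⟨e, p, rfl, he⟩
    · rw [toFun_inl_collapsed he] at h
      cases h
  · rw [toFun_inr] at h
    cases h

/-! ### Embeddings in combinatorial terms -/

theorem IsEmb.edge_inj {U V : Hypersequent} {f : U ⟶ V} (hf : IsEmb f) {e₁ e₂ : U.E} {e' : V.E}
    {p q : List Bool} (h₁ : f.edge e₁ = Sum.inl (e', p)) (h₂ : f.edge e₂ = Sum.inl (e', q)) :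
    e₁ = e₂ :=
  Sum.inl_injective (hf.1.injective ((toFun_inl h₁).trans (toFun_inl h₂).symm))

theorem IsEmb.vert_inj {U V : Hypersequent} {f : U ⟶ V} (hf : IsEmb f) :
    Function.Injective f.vert := fun v w h =>
  Sum.inr_injective (hf.1.injective ((toFun_inr f v).trans
    ((congrArg Sum.inr h).trans (toFun_inr f w).symm)))

theorem IsEmb.edge_nil {U V : Hypersequent} {f : U ⟶ V} (hf : IsEmb f) {e : U.E} {e' : V.E}
    {p : List Bool} (h : f.edge e = Sum.inl (e', p)) : p = [] := by
  obtain ⟨e₁, he₁⟩ := hf.2 e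
  rw [he₁] at h
  cases h
  rfl

theorem IsEmb.edge_ne_inr {U V : Hypersequent} {f : U ⟶ V} (hf : IsEmb f) {e : U.E} {v : V.V} :
    f.edge e ≠ Sum.inr v := by
  obtain ⟨e₁, he₁⟩ := hf.2 e
  rw [he₁]
  simp

theorem IsEmb.exists_edge_of_adj {U V : Hypersequent} {f : U ⟶ V} (hf : IsEmb f) {v : U.V}
    {e' : V.E} (h : V.Adj e' (f.vert v)) : ∃ e, U.Adj e v ∧ f.edge e = Sum.inl (e', []) := by
  have h1 := (V.isOpen_iff _).1 hf.1.isOpen_range _ _ h ⟨(Sum.inr v : U.E ⊕ U.V), rfl⟩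
  obtain ⟨x, hx⟩ := h1
  obtain ⟨e, p, -, he⟩ := edge_of_toFun_eq_inl hx
  obtain rfl := hf.edge_nil he
  exact ⟨e, (hf.adj_iff he v).2 h, he⟩

/-- The last hypothesis expresses openness: the image contains all edges adjacent to its vertices,
and they come from edges adjacent to the given vertex. -/
theorem isEmb_of {U V : Hypersequent} {f : U ⟶ V}
    (h₁ : ∀ e : U.E, ∃ e' : V.E, f.edge e = Sum.inl (e', []))
    (h₂ : ∀ e₁ e₂ e', f.edge e₁ = Sum.inl (e', []) → f.edge e₂ = Sum.inl (e', []) → e₁ = e₂)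
    (h₃ : Function.Injective f.vert)
    (h₄ : ∀ v e', V.Adj e' (f.vert v) → ∃ e, U.Adj e v ∧ f.edge e = Sum.inl (e', [])) :
    IsEmb f := by
  refine ⟨Topology.IsOpenEmbedding.of_continuous_injective_isOpenMap f.cont ?_ ?_, h₁⟩
  · rintro (e | v) (e' | v') h
    · obtain ⟨e₁, he₁⟩ := h₁ e
      obtain ⟨e₂, he₂⟩ := h₁ e'
      rw [toFun_inl he₁, toFun_inl he₂] at h
      cases Sum.inl_injective h
      exact congrArg Sum.inl (h₂ _ _ _ he₁ he₂)
    · obtain ⟨e₁, he₁⟩ := h₁ e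
      rw [toFun_inl he₁, toFun_inr] at h
      cases h
    · obtain ⟨e₁, he₁⟩ := h₁ e'
      rw [toFun_inl he₁, toFun_inr] at h
      cases h
    · rw [toFun_inr, toFun_inr] at h
      exact congrArg Sum.inr (h₃ (Sum.inr_injective h))
  · intro S hS
    rw [isOpen_iff] at hS ⊢
    rintro w e' h ⟨x, hx, hxw⟩
    rcases x with e | v
    · obtain ⟨e₁, he₁⟩ := h₁ e
      rw [toFun_inl he₁] at hxw
      cases hxw
    · rw [toFun_inr] at hxw
      cases Sum.inr_injective hxw
      obtain ⟨e, hev, he⟩ := h₄ v e' h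
      exact ⟨Sum.inl e, hS v e hev hx, toFun_inl he⟩

theorem IsEmb.inl_mem_range {U V : Hypersequent} {f : U ⟶ V} (hf : IsEmb f) {e' : V.E} :
    (Sum.inl e' : V.E ⊕ V.V) ∈ Set.range (Hom.toFun f) ↔ ∃ e, f.edge e = Sum.inl (e', []) := by
  constructor
  · rintro ⟨x, hx⟩
    obtain ⟨e, p, -, he⟩ := edge_of_toFun_eq_inl hx
    obtain rfl := hf.edge_nil he
    exact ⟨e, he⟩
  · rintro ⟨e, he⟩
    exact ⟨Sum.inl e, toFun_inl he⟩

theorem IsEmb.inr_mem_range {U V : Hypersequent} {f : U ⟶ V} (hf : IsEmb f) {v' : V.V} :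
    (Sum.inr v' : V.E ⊕ V.V) ∈ Set.range (Hom.toFun f) ↔ ∃ v, f.vert v = v' := by
  constructor
  · rintro ⟨e | v, hx⟩
    · obtain ⟨e', he'⟩ := hf.2 e
      rw [toFun_inl he'] at hx
      cases hx
    · exact ⟨v, Sum.inr_injective hx⟩
  · rintro ⟨v, rfl⟩
    exact ⟨Sum.inr v, rfl⟩

/-- Morphisms factor through embeddings with a larger image. -/
theorem IsEmb.exists_factor {A W U : Hypersequent} {g : W ⟶ U} (hg : IsEmb g) (a : A ⟶ U)
    (h : ∀ x, Hom.toFun a x ∈ Set.range (Hom.toFun g)) : ∃ b : A ⟶ W, b ≫ g = a := by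
  have hv : ∀ v : A.V, ∃ w : W.V, g.vert w = a.vert v := fun v =>
    hg.inr_mem_range.1 (h (Sum.inr v))
  have he : ∀ e : A.E, ∃ y : (W.E × List Bool) ⊕ W.V,
      (∀ e₁ p, y = Sum.inl (e₁, p) → ∃ e₂, g.edge e₁ = Sum.inl (e₂, []) ∧
        a.edge e = Sum.inl (e₂, p)) ∧
      (∀ w, y = Sum.inr w → a.edge e = Sum.inr (g.vert w)) := by
    intro e
    have h1 := h (Sum.inl e)
    rcases hae : a.edge e with ⟨e₂, p⟩ | w
    · rw [toFun_inl hae] at h1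
      obtain ⟨e₁, he₁⟩ := hg.inl_mem_range.1 h1
      refine ⟨Sum.inl (e₁, p), ?_, ?_⟩
      · intro e₃ q h3
        cases h3
        exact ⟨e₂, he₁, rfl⟩
      · intro w hw
        cases hw
    · rw [toFun_inl_collapsed hae] at h1
      obtain ⟨w', hw'⟩ := hg.inr_mem_range.1 h1
      refine ⟨Sum.inr w', ?_, ?_⟩
      · intro e₃ q h3
        cases h3
      · intro w₁ h3
        cases h3
        rw [hw']
  choose bv hbv using hv
  choose be hbe hbe' using he
  have hcont : Continuous (pointMap (U := A) (V := W) bv be) := by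
    apply continuous_pointMap
    · intro e e₁ p h1 v hv
      obtain ⟨e₂, h2, h3⟩ := hbe _ _ _ h1
      rw [hg.adj_iff h2, hbv]
      exact Hom.adj_map a h3 hv
    · intro e w h1 v hv
      apply hg.vert_inj
      rw [hbv]
      exact (Hom.vert_of_collapsed a (hbe' _ _ h1) hv).symm
  refine ⟨{ vert := bv, edge := be, cont := hcont, occ := ?_ }, ?_⟩
  · intro e e₁ p h1
    obtain ⟨e₂, h2, h3⟩ := hbe _ _ _ h1
    have h4 := hg.edge_spec h2
    rcases a.occ _ _ _ h3 with ⟨k1, k2, k3⟩ | ⟨k1, k2, k3⟩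
    · refine Or.inl ⟨by rw [← h4.1]; exact k1, fun v hv => ?_, fun v hv => ?_⟩
      · rw [h4.2.1, hbv]; exact k2 v hv
      · rw [h4.2.2, hbv]; exact k3 v hv
    · refine Or.inr ⟨by rw [← h4.1]; exact k1, fun v hv => ?_, fun v hv => ?_⟩
      · rw [h4.2.2, hbv]; exact k2 v hv
      · rw [h4.2.1, hbv]; exact k3 v hv
  · apply Hom.ext
    · funext v; exact hbv v
    · funext e
      rcases h1 : be e with ⟨e₁, p⟩ | w
      · obtain ⟨e₂, h2, h3⟩ := hbe _ _ _ h1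
        exact (comp_edge_inl (f := ⟨bv, be, hcont, _⟩) (g := g) h1 h2).trans h3.symm
      · exact (comp_edge_inr (f := ⟨bv, be, hcont, _⟩) (g := g) h1).trans (hbe' _ _ h1).symm

theorem IsEmb.mono {W U : Hypersequent} {g : W ⟶ U} (hg : IsEmb g) : Mono g := by
  refine ⟨fun {A} a b hab => ?_⟩
  apply Hom.ext
  · funext v
    exact hg.vert_inj (comp_vert_congr hab v)
  · funext e
    rcases ha : a.edge e with ⟨e₁, p⟩ | v
    · obtain ⟨e₂, he₂⟩ := hg.2 e₁
      have h1 := comp_edge_inl ha he₂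
      rw [hab] at h1
      obtain ⟨e₃, p', q, h2, h3, h4⟩ := exists_of_comp_edge_inl h1
      obtain rfl := hg.edge_nil h3
      obtain rfl := hg.edge_inj he₂ h3
      simp only [List.nil_append] at h4
      rw [h2, h4]
    · have h1 := comp_edge_inr (g := g) ha
      rw [hab] at h1
      rcases hb : b.edge e with ⟨e₁, p⟩ | w
      · obtain ⟨e₂, he₂⟩ := hg.2 e₁
        rw [comp_edge_inl hb he₂] at h1
        cases h1
      · rw [comp_edge_inr hb] at h1
        rw [hg.vert_inj (Sum.inr_injective h1)]

theorem IsEmb.of_comp {A B C : Hypersequent} {f : A ⟶ B} {g : B ⟶ C} (hg : IsEmb g)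
    (h : IsEmb (f ≫ g)) : IsEmb f := by
  refine ⟨Topology.IsOpenEmbedding.of_comp _ hg.1 ?_, fun e => ?_⟩
  · rw [← comp_toFun]; exact h.1
  · obtain ⟨e'', he⟩ := h.2 e
    obtain ⟨e', he', -⟩ := exists_of_comp_edge_nil he
    exact ⟨e', he'⟩

theorem IsEmb.of_isIso {U V : Hypersequent} (f : U ⟶ V) [IsIso f] : IsEmb f := by
  have h1 : Hom.toFun (inv f) ∘ Hom.toFun f = id := by
    rw [← comp_toFun, IsIso.hom_inv_id, id_toFun]
  have h2 : Hom.toFun f ∘ Hom.toFun (inv f) = id := by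
    rw [← comp_toFun, IsIso.inv_hom_id, id_toFun]
  let φ : U.Pt ≃ₜ V.Pt :=
    { toFun := Hom.toFun f
      invFun := Hom.toFun (inv f)
      left_inv := congrFun h1
      right_inv := congrFun h2
      continuous_toFun := f.cont
      continuous_invFun := Hom.cont (inv f) }
  refine ⟨φ.isOpenEmbedding, fun e => ?_⟩
  have h3 : (f ≫ inv f).edge e = Sum.inl (e, []) := by rw [IsIso.hom_inv_id]; rfl
  obtain ⟨e', he', -⟩ := exists_of_comp_edge_nil h3
  exact ⟨e', he'⟩

/-- The identity of `V` factors through `f`, which gives a section; as `f` is mono, the section is a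
two-sided inverse. -/
theorem IsEmb.isIso_of_surjective {U V : Hypersequent} {f : U ⟶ V} (hf : IsEmb f)
    (h : ∀ y, y ∈ Set.range (Hom.toFun f)) : IsIso f := by
  obtain ⟨g, hg⟩ := hf.exists_factor (𝟙 V) (fun x => h _)
  have := hf.mono
  exact ⟨g, by rw [← cancel_mono f, Category.assoc, hg]; simp, hg⟩

theorem surjective_of_isIso {U V : Hypersequent} (f : U ⟶ V) [IsIso f] (y : V.Pt) :
    y ∈ Set.range (Hom.toFun f) :=
  ⟨Hom.toFun (inv f) y, by
    rw [← Function.comp_apply (f := Hom.toFun f), ← comp_toFun, IsIso.inv_hom_id, id_toFun]; rfl⟩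

theorem IsEmb.isIso_of {U V : Hypersequent} {f : U ⟶ V} (hf : IsEmb f)
    (he : ∀ e', ∃ e p, f.edge e = Sum.inl (e', p)) (hv : ∀ v', ∃ v, f.vert v = v') : IsIso f := by
  apply hf.isIso_of_surjective
  rintro (e | v)
  · obtain ⟨e', p, he'⟩ := he e
    exact ⟨Sum.inl e', toFun_inl he'⟩
  · exact hf.inr_mem_range.2 (hv v)

/-! ### Pullbacks along embeddings -/

/-- Embeddings behave like inclusions of open sets: the pullback is the preimage of the range of
`j`, and a morphism lands in it as soon as its points do. -/
theorem IsEmb.isPullback_of {X' Y' X Y : Hypersequent} {i : X' ⟶ Y'} {m' : X' ⟶ X} {m : Y' ⟶ Y}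
    {j : X ⟶ Y} (hj : IsEmb j) (hi : IsEmb i) (w : i ≫ m = m' ≫ j)
    (h : ∀ y, Hom.toFun m y ∈ Set.range (Hom.toFun j) → y ∈ Set.range (Hom.toFun i)) :
    IsPullback i m' m j := by
  have := hi.mono
  have := hj.mono
  have key : ∀ s : Limits.PullbackCone m j, ∃ b : s.pt ⟶ X', b ≫ i = s.fst := by
    intro s
    refine hi.exists_factor s.fst (fun x => h _ ⟨Hom.toFun s.snd x, ?_⟩)
    have h1 := congrArg Hom.toFun s.condition
    have h2 := (comp_toFun s.fst m).symm.trans (h1.trans (comp_toFun s.snd j))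
    exact (congrFun h2 x).symm
  refine ⟨⟨w⟩, ⟨Limits.PullbackCone.IsLimit.mk _ (fun s => (key s).choose)
    (fun s => (key s).choose_spec) (fun s => ?_) (fun s f h1 h2 => ?_)⟩⟩
  · rw [← cancel_mono j, Category.assoc, ← w, ← Category.assoc, (key s).choose_spec, s.condition]
  · rw [← cancel_mono i, h1, (key s).choose_spec]

theorem IsEmb.exists_pullback {Y' X Y : Hypersequent} (m : Y' ⟶ Y) {j : X ⟶ Y} (hj : IsEmb j) :
    ∃ (X' : Hypersequent) (i : X' ⟶ Y') (m' : X' ⟶ X), IsEmb i ∧ IsPullback i m' m j ∧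
      ∀ y, y ∈ Set.range (Hom.toFun i) ↔ Hom.toFun m y ∈ Set.range (Hom.toFun j) := by
  obtain ⟨X', i, hi, hr⟩ := exists_isEmb_range Y' (Hom.toFun m ⁻¹' Set.range (Hom.toFun j))
    (hj.1.isOpen_range.preimage m.cont)
  obtain ⟨m', hm'⟩ := hj.exists_factor (i ≫ m) (by
    intro x
    rw [comp_toFun]
    have h1 : Hom.toFun i x ∈ Set.range (Hom.toFun i) := ⟨x, rfl⟩
    rw [hr] at h1
    exact h1)
  refine ⟨X', i, m', hi, hj.isPullback_of hi hm'.symm ?_, ?_⟩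
  · intro y hy
    rw [hr]
    exact hy
  · intro y
    rw [hr]
    exact Iff.rfl

/-- Both properties hold for the pullback built on the preimage of the range of `j`, and any other
pullback is isomorphic to that one. -/
theorem IsEmb.pullback_range {X' Y' X Y : Hypersequent} {i : X' ⟶ Y'} {m' : X' ⟶ X} {m : Y' ⟶ Y}
    {j : X ⟶ Y} (hj : IsEmb j) (h : IsPullback i m' m j) :
    IsEmb i ∧ ∀ y, Hom.toFun m y ∈ Set.range (Hom.toFun j) → y ∈ Set.range (Hom.toFun i) := by
  obtain ⟨X₁, i₁, m₁, hi₁, h₁, hr⟩ := hj.exists_pullback m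
  have hiso := h.isoIsPullback_hom_fst _ _ h₁
  have hei : IsEmb i := by
    rw [← hiso]
    exact IsEmb.comp_mem _ _ (IsEmb.of_isIso _) hi₁
  refine ⟨hei, fun y hy => ?_⟩
  obtain ⟨x, rfl⟩ := (hr y).2 hy
  obtain ⟨z, rfl⟩ := surjective_of_isIso (h.isoIsPullback _ _ h₁).hom x
  refine ⟨z, ?_⟩
  exact (congrFun ((congrArg Hom.toFun hiso).symm.trans (comp_toFun _ _)) z)

theorem pullback_exists_edge {X' Y' X Y : Hypersequent} {i : X' ⟶ Y'} {m' : X' ⟶ X} {m : Y' ⟶ Y}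
    {j : X ⟶ Y} (h : IsPullback i m' m j) (hj : IsEmb j) {e : Y'.E} {f : Y.E} {g : X.E}
    {p : List Bool} (hm : m.edge e = Sum.inl (f, p)) (hg : j.edge g = Sum.inl (f, [])) :
    ∃ d, i.edge d = Sum.inl (e, []) ∧ m'.edge d = Sum.inl (g, p) := by
  obtain ⟨hi, hr⟩ := hj.pullback_range h
  obtain ⟨d, hd⟩ := hi.inl_mem_range.1 (hr (Sum.inl e) ⟨Sum.inl g, (toFun_inl hg).trans
    (toFun_inl hm).symm⟩)
  refine ⟨d, hd, ?_⟩
  have h1 := comp_edge_inl hd hm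
  rw [h.w] at h1
  obtain ⟨e', p', q, h2, h3, h4⟩ := exists_of_comp_edge_inl h1
  obtain rfl := hj.edge_nil h3
  obtain rfl := hj.edge_inj h3 hg
  rw [h2]
  simpa using h4.symm

theorem pullback_exists_collapsed {X' Y' X Y : Hypersequent} {i : X' ⟶ Y'} {m' : X' ⟶ X}
    {m : Y' ⟶ Y} {j : X ⟶ Y} (h : IsPullback i m' m j) (hj : IsEmb j) {e : Y'.E} {x : X.V}
    (hm : m.edge e = Sum.inr (j.vert x)) :
    ∃ d, i.edge d = Sum.inl (e, []) ∧ m'.edge d = Sum.inr x := by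
  obtain ⟨hi, hr⟩ := hj.pullback_range h
  obtain ⟨d, hd⟩ := hi.inl_mem_range.1 (hr (Sum.inl e) ⟨Sum.inr x, (toFun_inl_collapsed hm).symm⟩)
  refine ⟨d, hd, ?_⟩
  have h1 := comp_edge_inl_inr hd hm
  rw [h.w] at h1
  rcases h2 : m'.edge d with ⟨e', p⟩ | y
  · obtain ⟨e₂, h3⟩ := hj.2 e'
    rw [comp_edge_inl h2 h3] at h1
    cases h1
  · rw [comp_edge_inr h2] at h1
    rw [hj.vert_inj (Sum.inr_injective h1)]

theorem pullback_exists_vert {X' Y' X Y : Hypersequent} {i : X' ⟶ Y'} {m' : X' ⟶ X}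
    {m : Y' ⟶ Y} {j : X ⟶ Y} (h : IsPullback i m' m j) (hj : IsEmb j) {y : Y'.V} {x : X.V}
    (hm : m.vert y = j.vert x) : ∃ z, i.vert z = y ∧ m'.vert z = x := by
  obtain ⟨hi, hr⟩ := hj.pullback_range h
  obtain ⟨z, hz⟩ := hi.inr_mem_range.1 (hr (Sum.inr y) ⟨Sum.inr x, congrArg Sum.inr hm.symm⟩)
  refine ⟨z, hz, hj.vert_inj ?_⟩
  rw [← hm, ← hz]
  exact (comp_vert_congr h.w z).symm

/-- In a pullback square along an embedding, the image of an edge comes from upstairs. -/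
theorem pullback_edge_image {X' Y' X Y : Hypersequent} {i : X' ⟶ Y'} {m' : X' ⟶ X}
    {m : Y' ⟶ Y} {j : X ⟶ Y} (h : IsPullback i m' m j) (hj : IsEmb j) {d : X'.E} {g : X.E}
    {p : List Bool} (hd : m'.edge d = Sum.inl (g, p)) :
    ∃ e f, i.edge d = Sum.inl (e, []) ∧ j.edge g = Sum.inl (f, []) ∧
      m.edge e = Sum.inl (f, p) := by
  obtain ⟨f, hf⟩ := hj.2 g
  obtain ⟨e, he⟩ := (hj.pullback_range h).1.2 d
  have h1 := comp_edge_inl hd hf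
  rw [← h.w] at h1
  obtain ⟨e', p', q, h2, h3, h4⟩ := exists_of_comp_edge_inl h1
  rw [he] at h2
  cases h2
  simp only [List.nil_append, List.append_nil] at h4
  subst h4
  exact ⟨e, f, he, hf, h3⟩

theorem pullback_collapsed_image {X' Y' X Y : Hypersequent} {i : X' ⟶ Y'} {m' : X' ⟶ X}
    {m : Y' ⟶ Y} {j : X ⟶ Y} (h : IsPullback i m' m j) (hj : IsEmb j) {d : X'.E} {x : X.V}
    (hd : m'.edge d = Sum.inr x) :
    ∃ e, i.edge d = Sum.inl (e, []) ∧ m.edge e = Sum.inr (j.vert x) := by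
  obtain ⟨e, he⟩ := (hj.pullback_range h).1.2 d
  have h1 := comp_edge_inr (g := j) hd
  rw [← h.w] at h1
  refine ⟨e, he, ?_⟩
  rcases h2 : m.edge e with ⟨f, p⟩ | y
  · rw [comp_edge_inl he h2] at h1
    cases h1
  · rw [comp_edge_inl_inr he h2] at h1
    exact h1

/-! ### The empty hypersequent -/

/-- The empty hypersequent embeds in a unique way into every hypersequent. It later carries threads
along any continuation of a play, and carries nonemptiness between the strategies of a compatible
family. -/
theorem exists_empty_emb (U : Hypersequent) :
    ∃ (A : Hypersequent) (a : A ⟶ U), IsEmb a ∧ IsEmpty A.E ∧ IsEmpty A.V := by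
  obtain ⟨A, a, ha, hr⟩ := exists_isEmb_range U ∅ isOpen_empty
  refine ⟨A, a, ha, ⟨fun e => ?_⟩, ⟨fun v => ?_⟩⟩
  · have : Hom.toFun a (Sum.inl e) ∈ Set.range (Hom.toFun a) := ⟨_, rfl⟩
    rw [hr] at this
    exact this
  · have : Hom.toFun a (Sum.inr v) ∈ Set.range (Hom.toFun a) := ⟨_, rfl⟩
    rw [hr] at this
    exact this

theorem hom_ext_of_isEmpty {A U : Hypersequent} (hE : IsEmpty A.E) (hV : IsEmpty A.V)
    (f g : A ⟶ U) : f = g := by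
  apply Hom.ext
  · funext v; exact hV.elim v
  · funext e; exact hE.elim e

theorem exists_emb_of_isEmpty {A : Hypersequent} (hE : IsEmpty A.E) (hV : IsEmpty A.V)
    (U : Hypersequent) : ∃ a : A ⟶ U, IsEmb a :=
  ⟨{ vert := fun v => hV.elim v, edge := fun e => hE.elim e
     cont := continuous_pointMap (fun e => hE.elim e) (fun e => hE.elim e)
     occ := fun e => hE.elim e },
    isEmb_of (fun e => hE.elim e) (fun e => hE.elim e) (fun v => hV.elim v) (fun v => hV.elim v)⟩

/-! ### Moves are basic moves -/

/-- The set of edges sent to `D` by an embedding. -/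
def edgePreimage {U V : Hypersequent} (f : U ⟶ V) (D : Set V.E) : Set U.E :=
  {e | ∃ e' ∈ D, f.edge e = Sum.inl (e', [])}

theorem mem_edgePreimage {U V : Hypersequent} {f : U ⟶ V} {D : Set V.E} {e : U.E} {e' : V.E}
    {p : List Bool} (h : f.edge e = Sum.inl (e', p)) (hf : IsEmb f) :
    e ∈ edgePreimage f D ↔ e' ∈ D := by
  obtain rfl := hf.edge_nil h
  constructor
  · rintro ⟨e₁, h1, h2⟩
    rw [h] at h2
    cases h2
    exact h1
  · exact fun h1 => ⟨e', h1, h⟩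

/-- Each clause speaks of fibres of `m'`, and the fibres of a pullback along an embedding are those
of `m'` over the image of `j`. -/
theorem IsoOutside.restrict {U' V' U V : Hypersequent} {i : U ⟶ U'} {m : U ⟶ V} {m' : U' ⟶ V'}
    {j : V ⟶ V'} {D : Set U'.E} {D' : Set V'.E} {A : Set V'.V} (h : IsoOutside m' D D' A)
    (hpb : IsPullback i m m' j) (hj : IsEmb j) :
    IsoOutside m (edgePreimage i D) (edgePreimage j D') (j.vert ⁻¹' A) where
  edge_map e he := by
    obtain ⟨f, hf⟩ := (hj.pullback_range hpb).1.2 e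
    rw [mem_edgePreimage hf (hj.pullback_range hpb).1] at he
    obtain ⟨f', h1, h2⟩ := h.edge_map f he
    have h3 := comp_edge_inl hf h2
    rw [hpb.w, List.nil_append] at h3
    obtain ⟨e', h4, h5⟩ := exists_of_comp_edge_nil h3
    exact ⟨e', (mem_edgePreimage h5 hj).not.2 h1, h4⟩
  edge_lift e' he' := by
    obtain ⟨f', hf'⟩ := hj.2 e'
    rw [mem_edgePreimage hf' hj] at he'
    obtain ⟨f, ⟨h1, h2⟩, h3⟩ := h.edge_lift f' he'
    obtain ⟨e, h4, h5⟩ := pullback_exists_edge hpb hj h2 hf'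
    have hi := (hj.pullback_range hpb).1
    refine ⟨e, ⟨(mem_edgePreimage h4 hi).not.2 h1, h5⟩, ?_⟩
    rintro d ⟨h6, h7⟩
    obtain ⟨g, g', h8, h9, h10⟩ := pullback_edge_image hpb hj h7
    rw [hf'] at h9
    cases h9
    rw [mem_edgePreimage h8 hi] at h6
    obtain rfl := h3 g ⟨h6, h10⟩
    exact hi.edge_inj h8 h4
  vert_lift y hy := by
    obtain ⟨x', h1, h2⟩ := h.vert_lift (j.vert y) hy
    obtain ⟨x, h3, h4⟩ := pullback_exists_vert hpb hj h1
    refine ⟨x, h4, fun z hz => (hj.pullback_range hpb).1.vert_inj ?_⟩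
    rw [h3]
    refine h2 _ ?_
    change m'.vert (i.vert z) = j.vert y
    rw [comp_vert_congr hpb.w, hz]
  ends_lift e e' p y he hy := by
    obtain ⟨f, f', h1, h2, h3⟩ := pullback_edge_image hpb hj he
    obtain ⟨x', h4, h5⟩ := h.ends_lift _ _ _ _ h3 (Hom.adj_map j h2 hy)
    obtain ⟨x, h6, h7⟩ := pullback_exists_vert hpb hj h5
    refine ⟨x, ?_, h7⟩
    rw [(hj.pullback_range hpb).1.adj_iff h1, h6]
    exact h4

theorem IsoOutside.isIso {U V : Hypersequent} {m : U ⟶ V} {D : Set U.E} {D' : Set V.E}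
    {A : Set V.V} (h : IsoOutside m D D' A) (hD : ∀ e, e ∉ D) (hD' : ∀ e, e ∉ D')
    (hA : ∀ x, x ∉ A) : IsIso m := by
  have hinj : ∀ e₁ e₂ e', m.edge e₁ = Sum.inl (e', []) → m.edge e₂ = Sum.inl (e', []) →
      e₁ = e₂ := by
    intro e₁ e₂ e' h1 h2
    exact (h.edge_lift e' (hD' _)).unique ⟨hD _, h1⟩ ⟨hD _, h2⟩
  have hemb : IsEmb m := by
    refine isEmb_of (fun e => ?_) hinj ?_ ?_
    · obtain ⟨e', -, he'⟩ := h.edge_map e (hD e)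
      exact ⟨e', he'⟩
    · intro x y hxy
      exact (h.vert_lift (m.vert y) (hA _)).unique hxy rfl
    · intro v e' hv
      obtain ⟨e, ⟨-, he⟩, -⟩ := h.edge_lift e' (hD' _)
      obtain ⟨x, hx, hxv⟩ := h.ends_lift _ _ _ _ he hv
      obtain rfl := (h.vert_lift (m.vert v) (hA _)).unique hxv rfl
      exact ⟨e, hx, he⟩
  refine hemb.isIso_of (fun e' => ?_) (fun v => ?_)
  · obtain ⟨e, ⟨-, he⟩, -⟩ := h.edge_lift e' (hD' _)
    exact ⟨e, [], he⟩
  · obtain ⟨x, hx, -⟩ := h.vert_lift v (hA _)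
    exact ⟨x, hx⟩

theorem edgePreimage_singleton {U V : Hypersequent} {f : U ⟶ V} {e : U.E} {e' : V.E}
    {p : List Bool} (h : f.edge e = Sum.inl (e', p)) (hf : IsEmb f) :
    edgePreimage f {e'} = {e} := by
  ext d
  obtain ⟨d', hd'⟩ := hf.2 d
  rw [mem_edgePreimage hd' hf, Set.mem_singleton_iff, Set.mem_singleton_iff]
  constructor
  · rintro rfl; exact hf.edge_inj hd' h
  · rintro rfl
    rw [h] at hd'
    cases hd'
    rfl

theorem edgePreimage_pair {U V : Hypersequent} {f : U ⟶ V} {e₁ e₂ : U.E} {e₁' e₂' : V.E}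
    {p q : List Bool} (h₁ : f.edge e₁ = Sum.inl (e₁', p)) (h₂ : f.edge e₂ = Sum.inl (e₂', q))
    (hf : IsEmb f) : edgePreimage f {e₁', e₂'} = {e₁, e₂} := by
  have h3 := edgePreimage_singleton h₁ hf
  have h4 := edgePreimage_singleton h₂ hf
  ext d
  have h5 : d ∈ edgePreimage f {e₁'} ↔ d ∈ ({e₁} : Set _) := by rw [h3]
  have h6 : d ∈ edgePreimage f {e₂'} ↔ d ∈ ({e₂} : Set _) := by rw [h4]
  obtain ⟨d', hd'⟩ := hf.2 d
  rw [mem_edgePreimage hd' hf] at h5 h6 ⊢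
  simp only [Set.mem_singleton_iff, Set.mem_insert_iff] at h5 h6 ⊢
  rw [h5, h6]

/-- If the image of `j` contains the cut vertex, the whole described part is pulled back and the cut
remains basic. Otherwise nothing of this part is left. The other three basic moves follow the same
dichotomy, with the broken edge in the role of the cut vertex. -/
theorem IsBasicCut.restrict {U' V' U V : Hypersequent} {i : U ⟶ U'} {m : U ⟶ V} {m' : U' ⟶ V'}
    {j : V ⟶ V'} (h : IsBasicCut m') (hpb : IsPullback i m m' j) (hj : IsEmb j) :
    IsBasicCut m ∨ IsIso m := by
  obtain ⟨c, v₁, v₂, v, h1, h2, h3, h4, h5⟩ := h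
  have hi := (hj.pullback_range hpb).1
  have h6 := h5.restrict hpb hj
  by_cases hv : ∃ w, j.vert w = v
  · left
    obtain ⟨w, rfl⟩ := hv
    obtain ⟨d, hd, hd'⟩ := pullback_exists_collapsed hpb hj h3
    obtain ⟨w₁, hw₁, hw₁'⟩ := pullback_exists_vert hpb hj ((h4 v₁).2 (Or.inl rfl))
    obtain ⟨w₂, hw₂, hw₂'⟩ := pullback_exists_vert hpb hj ((h4 v₂).2 (Or.inr rfl))
    refine ⟨d, w₁, w₂, w, ?_, ?_, hd', ?_, ?_⟩
    · rw [(hi.edge_spec hd).2.1, hw₁, h1]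
    · rw [(hi.edge_spec hd).2.2, hw₂, h2]
    · intro x
      rw [← hj.vert_inj.eq_iff, ← comp_vert_congr hpb.w, h4, ← hw₁, ← hw₂, hi.vert_inj.eq_iff,
        hi.vert_inj.eq_iff]
    · rw [edgePreimage_singleton hd hi] at h6
      have e1 : edgePreimage j (∅ : Set V'.E) = ∅ := by
        ext; simp [edgePreimage]
      have e2 : j.vert ⁻¹' {j.vert w} = {w} := by
        ext x; simp [hj.vert_inj.eq_iff]
      rwa [e1, e2] at h6
  · right
    refine h6.isIso ?_ ?_ ?_
    · rintro e ⟨e', rfl, he⟩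
      have h7 := comp_edge_inl_inr he h3
      rw [hpb.w] at h7
      rcases h8 : m.edge e with ⟨f, p⟩ | y
      · obtain ⟨g, hg⟩ := hj.2 f
        rw [comp_edge_inl h8 hg] at h7
        cases h7
      · rw [comp_edge_inr h8] at h7
        exact hv ⟨y, Sum.inr_injective h7⟩
    · rintro e ⟨e', h7, -⟩
      exact h7
    · rintro x hx
      exact hv ⟨x, hx⟩

theorem source_preimage {V V' : Hypersequent} {j : V ⟶ V'} (hj : IsEmb j) {e : V.E} {e' : V'.E}
    (he : j.edge e = Sum.inl (e', [])) :
    j.vert ⁻¹' {v | V'.s e' = some v} = {v | V.s e = some v} := by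
  ext x
  exact ((hj.edge_spec he).2.1 x).symm

/-- The range of `j` is open: were the source of `e'` in it, `e'` would be in it too. -/
theorem source_preimage_of_forall {V V' : Hypersequent} {j : V ⟶ V'} (hj : IsEmb j)
    {e' : V'.E} (he : ∀ e, j.edge e ≠ Sum.inl (e', [])) (x : V.V) :
    x ∉ j.vert ⁻¹' {v | V'.s e' = some v} := by
  intro hx
  obtain ⟨e, -, h1⟩ := hj.exists_edge_of_adj (Or.inl hx)
  exact he e h1

theorem IsBasicTensor.restrict {U' V' U V : Hypersequent} {i : U ⟶ U'} {m : U ⟶ V}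
    {m' : U' ⟶ V'} {j : V ⟶ V'} (h : IsBasicTensor m') (hpb : IsPullback i m m' j)
    (hj : IsEmb j) : IsBasicTensor m ∨ IsIso m := by
  obtain ⟨e₁, e₂, e₀, A, B, h1, h2, h3, h4, h5⟩ := h
  have hi := (hj.pullback_range hpb).1
  have h6 := h5.restrict hpb hj
  by_cases he : ∃ d₀, j.edge d₀ = Sum.inl (e₀, [])
  · left
    obtain ⟨d₀, hd₀⟩ := he
    obtain ⟨d₁, hd₁, hd₁'⟩ := pullback_exists_edge hpb hj h2 hd₀
    obtain ⟨d₂, hd₂, hd₂'⟩ := pullback_exists_edge hpb hj h3 hd₀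
    refine ⟨d₁, d₂, d₀, A, B, ?_, hd₁', hd₂', ?_, ?_⟩
    · rw [← (hj.edge_spec hd₀).1, h1]
    · intro v hv
      rw [(hj.edge_spec hd₀).2.1] at hv
      obtain ⟨v₁, v₂, h7, h8, h9, h10⟩ := h4 _ hv
      obtain ⟨w₁, hw₁, hw₁'⟩ := pullback_exists_vert hpb hj ((h10 v₁).2 (Or.inl rfl))
      obtain ⟨w₂, hw₂, hw₂'⟩ := pullback_exists_vert hpb hj ((h10 v₂).2 (Or.inr rfl))
      refine ⟨w₁, w₂, ?_, ?_, ?_, ?_⟩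
      · rintro rfl
        exact h7 (hw₁.symm.trans hw₂)
      · rw [hi.adj_iff hd₁, hw₁]; exact h8
      · rw [hi.adj_iff hd₂, hw₂]; exact h9
      · intro x
        rw [← hj.vert_inj.eq_iff, ← comp_vert_congr hpb.w, h10, ← hw₁, ← hw₂,
          hi.vert_inj.eq_iff, hi.vert_inj.eq_iff]
    · rwa [edgePreimage_pair hd₁ hd₂ hi, edgePreimage_singleton hd₀ hj,
        source_preimage hj hd₀] at h6
  · right
    push Not at he
    refine h6.isIso ?_ ?_ (source_preimage_of_forall hj he)
    · rintro e ⟨e', h7, h8⟩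
      have h9 : ∃ p, m'.edge e' = Sum.inl (e₀, p) := by
        rcases h7 with rfl | rfl
        · exact ⟨_, h2⟩
        · exact ⟨_, h3⟩
      obtain ⟨p, h9⟩ := h9
      have h10 := comp_edge_inl h8 h9
      rw [hpb.w] at h10
      obtain ⟨e'', q, r, -, h11, -⟩ := exists_of_comp_edge_inl h10
      obtain rfl := hj.edge_nil h11
      exact he _ h11
    · rintro e ⟨e', rfl, h7⟩
      exact he _ h7

theorem IsBasicPlus.restrict {U' V' U V : Hypersequent} {i : U ⟶ U'} {m : U ⟶ V}
    {m' : U' ⟶ V'} {j : V ⟶ V'} (h : IsBasicPlus m') (hpb : IsPullback i m m' j)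
    (hj : IsEmb j) : IsBasicPlus m ∨ IsIso m := by
  obtain ⟨e₁, e₀, A, B, b, h1, h2, h5⟩ := h
  have hi := (hj.pullback_range hpb).1
  have h6 := h5.restrict hpb hj
  have e2 : j.vert ⁻¹' (∅ : Set V'.V) = ∅ := rfl
  by_cases he : ∃ d₀, j.edge d₀ = Sum.inl (e₀, [])
  · left
    obtain ⟨d₀, hd₀⟩ := he
    obtain ⟨d₁, hd₁, hd₁'⟩ := pullback_exists_edge hpb hj h2 hd₀
    refine ⟨d₁, d₀, A, B, b, ?_, hd₁', ?_⟩
    · rw [← (hj.edge_spec hd₀).1, h1]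
    · rwa [edgePreimage_singleton hd₁ hi, edgePreimage_singleton hd₀ hj, e2] at h6
  · right
    push Not at he
    refine h6.isIso ?_ ?_ (fun x hx => hx)
    · rintro e ⟨e', rfl, h8⟩
      have h10 := comp_edge_inl h8 h2
      rw [hpb.w] at h10
      obtain ⟨e'', q, r, -, h11, -⟩ := exists_of_comp_edge_inl h10
      obtain rfl := hj.edge_nil h11
      exact he _ h11
    · rintro e ⟨e', rfl, h7⟩
      exact he _ h7

theorem IsBasicOne.restrict {U' V' U V : Hypersequent} {i : U ⟶ U'} {m : U ⟶ V}
    {m' : U' ⟶ V'} {j : V ⟶ V'} (h : IsBasicOne m') (hpb : IsPullback i m m' j)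
    (hj : IsEmb j) : IsBasicOne m ∨ IsIso m := by
  obtain ⟨e₀, h1, h2, h5⟩ := h
  have h6 := h5.restrict hpb hj
  have e1 : edgePreimage i (∅ : Set U'.E) = ∅ := by
    ext; simp [edgePreimage]
  by_cases he : ∃ d₀, j.edge d₀ = Sum.inl (e₀, [])
  · left
    obtain ⟨d₀, hd₀⟩ := he
    refine ⟨d₀, ?_, ?_, ?_⟩
    · rw [← (hj.edge_spec hd₀).1, h1]
    · intro v hv
      rw [(hj.edge_spec hd₀).2.1] at hv
      refine ⟨fun x hx => (h2 _ hv).1 (i.vert x) ?_, fun e hev => ?_⟩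
      · rw [comp_vert_congr hpb.w, hx]
      · obtain ⟨e', he'⟩ := hj.2 e
        obtain rfl := (h2 _ hv).2 e' (Hom.adj_map j he' hev)
        exact hj.edge_inj he' hd₀
    · rwa [e1, edgePreimage_singleton hd₀ hj, source_preimage hj hd₀] at h6
  · right
    push Not at he
    refine h6.isIso ?_ ?_ (source_preimage_of_forall hj he)
    · rw [e1]; exact fun e h => h
    · rintro e ⟨e', rfl, h7⟩
      exact he _ h7

theorem edge_of_isIso {U V : Hypersequent} (m : U ⟶ V) [IsIso m] (e' : V.E) :
    ∃ e, m.edge e = Sum.inl (e', []) :=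
  (IsEmb.of_isIso m).inl_mem_range.1 (surjective_of_isIso m _)

theorem isPullback_id_id {U V : Hypersequent} (m : U ⟶ V) : IsPullback (𝟙 U) m m (𝟙 V) :=
  IsPullback.of_horiz_isIso ⟨by simp⟩

theorem properRestrictions_of {B : MorphismProperty Hypersequent} {U V : Hypersequent} {m : U ⟶ V}
    (h : B m) (hm : ¬ IsIso m) : properRestrictions B m :=
  ⟨hm, U, V, m, 𝟙 U, 𝟙 V, h, IsEmb.id_mem _, IsEmb.id_mem _, isPullback_id_id m⟩

/-- A basic cut collapses an edge, so it is never an isomorphism. -/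
theorem isCutMove_iff {U V : Hypersequent} {m : U ⟶ V} : IsCutMove m ↔ IsBasicCut m := by
  constructor
  · rintro ⟨h1, U', V', m', i, j, h2, hi, hj, h3⟩
    exact (h2.restrict h3 hj).resolve_right h1
  · intro h
    refine properRestrictions_of h fun hiso => ?_
    obtain ⟨c, v₁, v₂, v, -, -, h3, -⟩ := h
    exact (IsEmb.of_isIso m).edge_ne_inr h3

/-- Basic moves are stable under restriction up to isomorphisms, so that moves can be handled
through the explicit description of basic moves. -/
theorem isBasicMove_of_isMove {U V : Hypersequent} {m : U ⟶ V} (h : IsMove m) :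
    IsBasicMove m := by
  obtain ⟨h1, U', V', m', i, j, h2, hi, hj, h3⟩ := h
  rcases h2 with h2 | h2 | h2 | h2
  · exact Or.inl ((h2.restrict h3 hj).resolve_right h1)
  · exact Or.inr (Or.inl ((h2.restrict h3 hj).resolve_right h1))
  · exact Or.inr (Or.inr (Or.inl ((h2.restrict h3 hj).resolve_right h1)))
  · exact Or.inr (Or.inr (Or.inr ((h2.restrict h3 hj).resolve_right h1)))

/-- The moves that are not cut moves send edges to edges. -/
theorem IsMove.edge_ne_inr {U V : Hypersequent} {m : U ⟶ V} (h : IsMove m) (hc : ¬ IsCutMove m)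
    (e : U.E) (v : V.V) : m.edge e ≠ Sum.inr v := by
  have aux : ∀ {D : Set U.E} {D' : Set V.E} {A : Set V.V}, IsoOutside m D D' A →
      e ∉ D → m.edge e ≠ Sum.inr v := by
    intro D D' A h1 h2 h3
    obtain ⟨e', -, h4⟩ := h1.edge_map e h2
    rw [h3] at h4
    cases h4
  rcases isBasicMove_of_isMove h with h1 | h1 | h1 | h1
  · exact absurd (isCutMove_iff.2 h1) hc
  · obtain ⟨e₁, e₂, e₀, A, B, -, h2, h3, -, h5⟩ := h1
    by_cases he : e ∈ ({e₁, e₂} : Set U.E)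
    · rcases he with rfl | rfl
      · rw [h2]; simp
      · rw [h3]; simp
    · exact aux h5 he
  · obtain ⟨e₁, e₀, A, B, b, -, h2, h3⟩ := h1
    by_cases he : e ∈ ({e₁} : Set U.E)
    · rcases he with rfl
      rw [h2]; simp
    · exact aux h3 he
  · obtain ⟨e₀, -, -, h2⟩ := h1
    exact aux h2 id

theorem properRestrictions.iso_comp {B : MorphismProperty Hypersequent} {W U V : Hypersequent}
    {m : U ⟶ V} (h : properRestrictions B m) (f : W ⟶ U) [IsIso f] :
    properRestrictions B (f ≫ m) := by
  obtain ⟨h1, U', V', m', i, j, h2, hi, hj, h3⟩ := h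
  refine ⟨fun _ => h1 (IsIso.of_isIso_comp_left f m), U', V', m', f ≫ i, j, h2,
    IsEmb.comp_mem _ _ (IsEmb.of_isIso f) hi, hj, ?_⟩
  have h4 : IsPullback f (f ≫ m) m (𝟙 V) := IsPullback.of_horiz_isIso ⟨by simp⟩
  simpa using h4.paste_horiz h3

theorem properRestrictions.comp_iso {B : MorphismProperty Hypersequent} {W U V : Hypersequent}
    {m : U ⟶ V} (h : properRestrictions B m) (f : V ⟶ W) [IsIso f] :
    properRestrictions B (m ≫ f) := by
  obtain ⟨h1, U', V', m', i, j, h2, hi, hj, h3⟩ := h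
  refine ⟨fun _ => h1 (IsIso.of_isIso_comp_right m f), U', V', m', i, inv f ≫ j, h2, hi,
    IsEmb.comp_mem _ _ (IsEmb.of_isIso _) hj, ?_⟩
  have h4 : IsPullback (𝟙 U) (m ≫ f) m (inv f) := IsPullback.of_horiz_isIso ⟨by simp⟩
  simpa using h4.paste_horiz h3

/-- The pullback of a move along an embedding is a move or an isomorphism. -/
theorem properRestrictions.restrict {B : MorphismProperty Hypersequent}
    {U' V' U V : Hypersequent} {i : U ⟶ U'} {m : U ⟶ V}
    {m' : U' ⟶ V'} {j : V ⟶ V'} (h : properRestrictions B m') (hpb : IsPullback i m m' j)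
    (hj : IsEmb j) : properRestrictions B m ∨ IsIso m := by
  by_cases hm : IsIso m
  · exact Or.inr hm
  · left
    obtain ⟨h1, U₁, V₁, m₁, i₁, j₁, h2, hi₁, hj₁, h3⟩ := h
    exact ⟨hm, U₁, V₁, m₁, i ≫ i₁, j ≫ j₁, h2, IsEmb.comp_mem _ _ (hj.pullback_range hpb).1 hi₁,
      IsEmb.comp_mem _ _ hj hj₁, hpb.paste_horiz h3⟩

/-! ### Cut only topological plays -/

theorem IsCutOnly.iso_comp {W U V : Hypersequent} {c : U ⟶ V} (h : IsCutOnly c) (f : W ⟶ U)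
    [IsIso f] : IsCutOnly (f ≫ c) := by
  cases h with
  | iso f' hf' => exact IsCutOnly.iso _ inferInstance
  | cut m c hm hc =>
    rw [← Category.assoc]
    exact IsCutOnly.cut _ _ (hm.iso_comp f) hc

theorem IsCutOnly.comp_iso {W U V : Hypersequent} {c : U ⟶ V} (h : IsCutOnly c) (f : V ⟶ W)
    [IsIso f] : IsCutOnly (c ≫ f) := by
  induction h with
  | iso f' hf' => exact IsCutOnly.iso _ inferInstance
  | cut m c hm hc ih =>
    rw [Category.assoc]
    exact IsCutOnly.cut _ _ hm (ih f)

/-- Pulling back one factor at a time turns each cut move into a cut move or an isomorphism, and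
isomorphisms are harmless. -/
theorem IsCutOnly.restrict {U' V' : Hypersequent} {c' : U' ⟶ V'} (h : IsCutOnly c') :
    ∀ {U V : Hypersequent} {i : U ⟶ U'} {c : U ⟶ V} {j : V ⟶ V'}, IsPullback i c c' j →
      IsEmb j → IsCutOnly c := by
  induction h with
  | iso f hf =>
    intro U V i c j hpb hj
    exact IsCutOnly.iso _ (hpb.isIso_snd_of_isIso)
  | cut m d hm hd ih =>
    intro U V i c j hpb hj
    obtain ⟨Y, k, d₁, hk, hpd, -⟩ := hj.exists_pullback d
    obtain ⟨m₁, h1, h2⟩ : ∃ m₁ : U ⟶ Y, m₁ ≫ d₁ = c ∧ IsPullback i m₁ m k := by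
      refine ⟨hpd.lift (i ≫ m) c (by rw [Category.assoc]; exact hpb.w), by simp, ?_⟩
      exact IsPullback.of_bot' hpb hpd
    subst h1
    rcases hm.restrict h2 hk with h3 | h3
    · exact IsCutOnly.cut _ _ h3 (ih hpd hj)
    · exact (ih hpd hj).iso_comp m₁

theorem IsCutMove.edge_lift {U V : Hypersequent} {m : U ⟶ V} (h : IsCutMove m) (e' : V.E) :
    ∃ e, m.edge e = Sum.inl (e', []) ∧ ∀ d p, m.edge d = Sum.inl (e', p) → d = e ∧ p = [] := by
  obtain ⟨c, v₁, v₂, v, h1, h2, h3, h4, h5⟩ := isCutMove_iff.1 h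
  obtain ⟨e, ⟨h6, h7⟩, h8⟩ := h5.edge_lift e' id
  refine ⟨e, h7, fun d p hd => ?_⟩
  have hdc : d ∉ ({c} : Set U.E) := by
    rintro rfl
    rw [h3] at hd
    cases hd
  obtain ⟨f, -, hf⟩ := h5.edge_map d hdc
  rw [hd] at hf
  cases hf
  exact ⟨h8 d ⟨hdc, hd⟩, rfl⟩

theorem IsCutMove.ends_lift {U V : Hypersequent} {m : U ⟶ V} (h : IsCutMove m) {e : U.E} {e' : V.E}
    {p : List Bool} (he : m.edge e = Sum.inl (e', p)) {y : V.V} (hy : V.Adj e' y) :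
    ∃ x, U.Adj e x ∧ m.vert x = y := by
  obtain ⟨c, v₁, v₂, v, h1, h2, h3, h4, h5⟩ := isCutMove_iff.1 h
  exact h5.ends_lift _ _ _ _ he hy

theorem IsCutMove.vert_surj {U V : Hypersequent} {m : U ⟶ V} (h : IsCutMove m) (y : V.V) :
    ∃ x, m.vert x = y := by
  obtain ⟨c, v₁, v₂, v, h1, h2, h3, h4, h5⟩ := isCutMove_iff.1 h
  by_cases hy : y = v
  · exact ⟨v₁, ((h4 _).2 (Or.inl rfl)).trans hy.symm⟩
  · exact (h5.vert_lift y hy).exists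

theorem IsCutMove.twoEnded {U V : Hypersequent} {m : U ⟶ V} (h : IsCutMove m) {e : U.E} {w : V.V}
    (he : m.edge e = Sum.inr w) : U.TwoEnded e := by
  obtain ⟨c, v₁, v₂, v, h1, h2, h3, h4, h5⟩ := isCutMove_iff.1 h
  have hc : e ∈ ({c} : Set U.E) := by
    by_contra hc
    obtain ⟨f, -, hf⟩ := h5.edge_map e hc
    rw [he] at hf
    cases hf
  cases hc
  exact ⟨by rw [h1]; rfl, by rw [h2]; rfl⟩

/-- A set of vertices is stable along the edges collapsed by `m`. -/
def CollapseStable {U V : Hypersequent} (m : U ⟶ V) (S : Set U.V) : Prop :=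
  ∀ e w, m.edge e = Sum.inr w → ∀ x y, U.Adj e x → U.Adj e y → x ∈ S → y ∈ S

/-- The only fibre with more than one vertex consists of the two ends of the collapsed edge. -/
theorem IsCutMove.saturated {U V : Hypersequent} {m : U ⟶ V} (h : IsCutMove m) {S : Set U.V}
    (hS : CollapseStable m S) {x y : U.V} (hx : x ∈ S) (hxy : m.vert x = m.vert y) : y ∈ S := by
  obtain ⟨c, v₁, v₂, v, h1, h2, h3, h4, h5⟩ := isCutMove_iff.1 h
  by_cases hy : m.vert y = v
  · rw [hy] at hxy
    have a1 : U.Adj c v₁ := Or.inl h1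
    have a2 : U.Adj c v₂ := Or.inr h2
    rcases (h4 x).1 hxy with rfl | rfl <;> rcases (h4 y).1 hy with rfl | rfl
    · exact hx
    · exact hS _ _ h3 _ _ a1 a2 hx
    · exact hS _ _ h3 _ _ a2 a1 hx
    · exact hx
  · obtain rfl := (h5.vert_lift _ hy).unique hxy rfl
    exact hx

theorem IsCutOnly.edge_lift {U V : Hypersequent} {d : U ⟶ V} (h : IsCutOnly d) :
    ∀ e' : V.E, ∃ e, d.edge e = Sum.inl (e', []) ∧
      ∀ f p, d.edge f = Sum.inl (e', p) → f = e ∧ p = [] := by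
  induction h with
  | iso f hf =>
    intro e'
    have := IsEmb.of_isIso f
    obtain ⟨e, he⟩ := edge_of_isIso f e'
    exact ⟨e, he, fun g p hg => ⟨this.edge_inj hg he, this.edge_nil hg⟩⟩
  | cut m c hm hc ih =>
    intro e'
    obtain ⟨e₁, h1, h2⟩ := ih e'
    obtain ⟨e, h3, h4⟩ := hm.edge_lift e₁
    refine ⟨e, comp_edge_inl h3 h1, fun f p hf => ?_⟩
    obtain ⟨g, q, r, h5, h6, h7⟩ := exists_of_comp_edge_inl hf
    obtain ⟨rfl, rfl⟩ := h2 _ _ h6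
    obtain ⟨rfl, rfl⟩ := h4 _ _ h5
    exact ⟨rfl, h7⟩

theorem IsCutOnly.edge_unique {U V : Hypersequent} {d : U ⟶ V} (h : IsCutOnly d) {e' : V.E}
    {e f : U.E} {p q : List Bool} (he : d.edge e = Sum.inl (e', p))
    (hf : d.edge f = Sum.inl (e', q)) : e = f := by
  obtain ⟨g, -, hg⟩ := h.edge_lift e'
  rw [(hg _ _ he).1, (hg _ _ hf).1]

theorem IsCutOnly.edge_nil {U V : Hypersequent} {d : U ⟶ V} (h : IsCutOnly d) {e' : V.E}
    {e : U.E} {p : List Bool} (he : d.edge e = Sum.inl (e', p)) : p = [] := by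
  obtain ⟨g, -, hg⟩ := h.edge_lift e'
  exact (hg _ _ he).2

theorem IsCutOnly.ends_lift {U V : Hypersequent} {d : U ⟶ V} (h : IsCutOnly d) :
    ∀ {e : U.E} {e' : V.E} {p : List Bool}, d.edge e = Sum.inl (e', p) → ∀ {y : V.V},
      V.Adj e' y → ∃ x, U.Adj e x ∧ d.vert x = y := by
  induction h with
  | iso f hf =>
    intro e e' p he y hy
    have h1 := IsEmb.of_isIso f
    obtain ⟨x, rfl⟩ := h1.inr_mem_range.1 (surjective_of_isIso f (Sum.inr y))
    obtain rfl := h1.edge_nil he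
    exact ⟨x, (h1.adj_iff he x).2 hy, rfl⟩
  | cut m c hm hc ih =>
    intro e e' p he y hy
    obtain ⟨g, q, r, h5, h6, h7⟩ := exists_of_comp_edge_inl he
    obtain ⟨z, hz, rfl⟩ := ih h6 hy
    obtain ⟨x, hx, rfl⟩ := hm.ends_lift h5 hz
    exact ⟨x, hx, rfl⟩

theorem IsCutOnly.vert_surj {U V : Hypersequent} {d : U ⟶ V} (h : IsCutOnly d) :
    ∀ y : V.V, ∃ x, d.vert x = y := by
  induction h with
  | iso f hf =>
    intro y
    exact (IsEmb.of_isIso f).inr_mem_range.1 (surjective_of_isIso f (Sum.inr y))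
  | cut m c hm hc ih =>
    intro y
    obtain ⟨z, rfl⟩ := ih y
    obtain ⟨x, rfl⟩ := hm.vert_surj z
    exact ⟨x, rfl⟩

/-- A cut edge has two ends by construction. If an edge is collapsed only by a later cut, the two
ends of its image lift, and the lifts differ because the image is not a loop. -/
theorem IsCutOnly.twoEnded {U V : Hypersequent} {d : U ⟶ V} (h : IsCutOnly d) :
    ∀ {e : U.E} {w : V.V}, d.edge e = Sum.inr w → U.TwoEnded e := by
  induction h with
  | iso f hf =>
    intro e w he
    exact absurd he (IsEmb.of_isIso f).edge_ne_inr
  | @cut U V W m c hm hc ih =>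
    intro e w he
    rcases h1 : m.edge e with ⟨e', p⟩ | v
    · rcases h2 : c.edge e' with ⟨e₂, q⟩ | v
      · rw [comp_edge_inl h1 h2] at he
        cases he
      · obtain ⟨h3, h4⟩ := ih h2
        obtain ⟨y₁, hy₁⟩ := Option.isSome_iff_exists.1 h3
        obtain ⟨y₂, hy₂⟩ := Option.isSome_iff_exists.1 h4
        obtain ⟨x₁, hx₁, rfl⟩ := hm.ends_lift h1 (Or.inl hy₁ : V.Adj _ _)
        obtain ⟨x₂, hx₂, rfl⟩ := hm.ends_lift h1 (Or.inr hy₂ : V.Adj _ _)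
        have hne : x₁ ≠ x₂ := by
          rintro rfl
          exact V.noLoop _ _ hy₁ hy₂
        rcases hx₁ with hx₁ | hx₁ <;> rcases hx₂ with hx₂ | hx₂
        · rw [hx₁] at hx₂; exact absurd (Option.some.inj hx₂) hne
        · exact ⟨by rw [hx₁]; rfl, by rw [hx₂]; rfl⟩
        · exact ⟨by rw [hx₂]; rfl, by rw [hx₁]; rfl⟩
        · rw [hx₁] at hx₂; exact absurd (Option.some.inj hx₂) hne
    · exact hm.twoEnded h1

theorem IsCutOnly.saturated {U V : Hypersequent} {d : U ⟶ V} (h : IsCutOnly d) :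
    ∀ {S : Set U.V}, CollapseStable d S → ∀ {x y : U.V}, x ∈ S → d.vert x = d.vert y →
      y ∈ S := by
  induction h with
  | iso f hf =>
    intro S hS x y hx hxy
    obtain rfl := (IsEmb.of_isIso f).vert_inj hxy
    exact hx
  | cut m c hm hc ih =>
    intro S hS x y hx hxy
    have hSm : CollapseStable m S := fun e w he => hS e _ (comp_edge_inr he)
    -- An edge collapsed by `c` lifts along `m`, with its ends, to an edge collapsed by the
    -- composite.
    have h1 : CollapseStable c (m.vert '' S) := by
      rintro e w he _ b hx' hb ⟨z, hz, rfl⟩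
      obtain ⟨e₁, h2, -⟩ := hm.edge_lift e
      obtain ⟨x₁, hx₁, hx₁'⟩ := hm.ends_lift h2 hx'
      obtain ⟨x₂, hx₂, rfl⟩ := hm.ends_lift h2 hb
      exact ⟨x₂, hS e₁ w (comp_edge_inl_inr h2 he) x₁ x₂ hx₁ hx₂
        (hm.saturated hSm hz hx₁'.symm), rfl⟩
    obtain ⟨z, hz, hzy⟩ := ih h1 ⟨x, hx, rfl⟩ hxy
    exact hm.saturated hSm hz hzy

/-- A cut only topological play that is the lower part of an embedding is an isomorphism. -/
theorem IsCutOnly.isIso_of_isEmb {U V : Hypersequent} {d : U ⟶ V} (h : IsCutOnly d)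
    (hd : IsEmb d) : IsIso d :=
  hd.isIso_of (fun e' => let ⟨e, he, _⟩ := h.edge_lift e'; ⟨e, [], he⟩) h.vert_surj

/-- In a square with embeddings as vertical sides and cut only topological plays as horizontal
sides, the image of the left side is saturated. -/
theorem IsCutOnly.range_of_square {X' X Y' Y : Hypersequent} {d' : X' ⟶ Y'} {d : X ⟶ Y}
    {k : X' ⟶ X} {k' : Y' ⟶ Y} (hd' : IsCutOnly d') (hd : IsCutOnly d) (hk : IsEmb k)
    (hk' : IsEmb k') (w : d' ≫ k' = k ≫ d) (x : X.Pt)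
    (hx : Hom.toFun d x ∈ Set.range (Hom.toFun k')) : x ∈ Set.range (Hom.toFun k) := by
  have hcol : ∀ {e : X'.E} {f : X.E} {y : Y.V}, k.edge e = Sum.inl (f, []) →
      d.edge f = Sum.inr y → ∃ y', d'.edge e = Sum.inr y' := by
    intro e f y h1 h2
    rcases h3 : d'.edge e with ⟨e', p⟩ | y'
    · obtain ⟨e'', h4⟩ := hk'.2 e'
      have h5 := comp_edge_inl h3 h4
      rw [w, comp_edge_inl_inr h1 h2] at h5
      cases h5
    · exact ⟨y', rfl⟩
  -- A collapsed edge touching the image of `k` comes from `X'`, where `d'` collapses it too. It has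
  -- two ends there, and these account for all its ends in `X`.
  have hst : CollapseStable d (Set.range k.vert) := by
    rintro e y he _ b hx' hb ⟨z, rfl⟩
    obtain ⟨e₁, hz, h1⟩ := hk.exists_edge_of_adj hx'
    obtain ⟨y', hy'⟩ := hcol h1 he
    obtain ⟨h3, h4⟩ := hd'.twoEnded hy'
    obtain ⟨a₁, ha₁⟩ := Option.isSome_iff_exists.1 h3
    obtain ⟨a₂, ha₂⟩ := Option.isSome_iff_exists.1 h4
    rcases hb with hb | hb
    · rw [((hk.edge_spec h1).2.1 a₁).1 ha₁] at hb
      exact ⟨a₁, Option.some.inj hb⟩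
    · rw [((hk.edge_spec h1).2.2 a₂).1 ha₂] at hb
      exact ⟨a₂, Option.some.inj hb⟩
  have hvert : ∀ (v : X.V) (y' : Y'.V), d.vert v = k'.vert y' → ∃ z, k.vert z = v := by
    intro v y' h1
    obtain ⟨z, rfl⟩ := hd'.vert_surj y'
    exact hd.saturated hst ⟨z, rfl⟩ ((comp_vert_congr w z).symm.trans h1.symm)
  rcases x with e | v
  · rcases h1 : d.edge e with ⟨e', p⟩ | y
    · rw [toFun_inl h1] at hx
      obtain ⟨f', hf'⟩ := hk'.inl_mem_range.1 hx
      obtain ⟨f, hf, -⟩ := hd'.edge_lift f'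
      have h2 := comp_edge_inl hf hf'
      rw [w] at h2
      obtain ⟨g, hg, hg'⟩ := exists_of_comp_edge_nil h2
      obtain rfl := hd.edge_unique hg' h1
      exact hk.inl_mem_range.2 ⟨f, hg⟩
    · rw [toFun_inl_collapsed h1] at hx
      obtain ⟨y', rfl⟩ := hk'.inr_mem_range.1 hx
      -- A collapsed edge is reached through its source: the source lies in the image of `k`, which
      -- is open.
      obtain ⟨a, ha⟩ := Option.isSome_iff_exists.1 (hd.twoEnded h1).1
      obtain ⟨z, rfl⟩ := hvert a y' (Hom.vert_of_collapsed d h1 (Or.inl ha))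
      obtain ⟨e₁, -, h3⟩ := hk.exists_edge_of_adj (Or.inl ha)
      exact hk.inl_mem_range.2 ⟨e₁, h3⟩
  · obtain ⟨y', hy'⟩ := hk'.inr_mem_range.1 hx
    exact hk.inr_mem_range.2 (hvert v y' hy'.symm)

theorem IsCutOnly.isIso_of_square {X' X Y' Y : Hypersequent} {d' : X' ⟶ Y'} {d : X ⟶ Y}
    {k : X' ⟶ X} {k' : Y' ⟶ Y} (hd' : IsCutOnly d') (hd : IsCutOnly d) (hk : IsEmb k)
    [IsIso k'] (w : d' ≫ k' = k ≫ d) : IsIso k :=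
  hk.isIso_of_surjective fun x =>
    hd'.range_of_square hd hk (IsEmb.of_isIso k') w x (surjective_of_isIso k' _)

/-! ### Atomic hypersequents -/

theorem isClosed_iff_adj {U : Hypersequent} {S : Set U.Pt} :
    IsClosed S ↔ ∀ (v : U.V) (e : U.E), U.Adj e v → (Sum.inl e : U.E ⊕ U.V) ∈ S →
      (Sum.inr v : U.E ⊕ U.V) ∈ S := by
  rw [← isOpen_compl_iff, isOpen_iff]
  constructor
  · intro h v e hev he
    by_contra hv
    exact h v e hev hv he
  · intro h v e hev hv he
    exact hv (h v e hev he)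

theorem isPreconnected_iff_clopen (U : Hypersequent) :
    PreconnectedSpace U.Pt ↔ ∀ S : Set U.Pt, (∀ (v : U.V) (e : U.E), U.Adj e v →
      ((Sum.inl e : U.E ⊕ U.V) ∈ S ↔ (Sum.inr v : U.E ⊕ U.V) ∈ S)) → S = ∅ ∨ S = Set.univ := by
  rw [preconnectedSpace_iff_clopen]
  refine forall_congr' fun S => ?_
  have h : IsClopen S ↔ ∀ (v : U.V) (e : U.E), U.Adj e v →
      ((Sum.inl e : U.E ⊕ U.V) ∈ S ↔ (Sum.inr v : U.E ⊕ U.V) ∈ S) := by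
    rw [IsClopen, isClosed_iff_adj, isOpen_iff]
    exact ⟨fun h v e hev => ⟨h.1 v e hev, h.2 v e hev⟩,
      fun h => ⟨fun v e hev => (h v e hev).1, fun v e hev => (h v e hev).2⟩⟩
  rw [h]

theorem twoEnded_of_adj {U : Hypersequent} {e : U.E} {x y : U.V} (hx : U.Adj e x) (hy : U.Adj e y)
    (h : x ≠ y) : U.TwoEnded e := by
  rcases hx with hx | hx <;> rcases hy with hy | hy
  · rw [hx] at hy; exact absurd (Option.some.inj hy) h
  · exact ⟨by rw [hx]; rfl, by rw [hy]; rfl⟩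
  · exact ⟨by rw [hy]; rfl, by rw [hx]; rfl⟩
  · rw [hx] at hy; exact absurd (Option.some.inj hy) h

theorem exists_adj_of_twoEnded {U : Hypersequent} {e : U.E} (h : U.TwoEnded e) :
    ∃ x y, U.Adj e x ∧ U.Adj e y ∧ x ≠ y := by
  obtain ⟨x, hx⟩ := Option.isSome_iff_exists.1 h.1
  obtain ⟨y, hy⟩ := Option.isSome_iff_exists.1 h.2
  refine ⟨x, y, Or.inl hx, Or.inr hy, ?_⟩
  rintro rfl
  exact U.noLoop _ _ hx hy

/-- Without two-ended edges, a vertex and its edges form a clopen set, and so does an edge alone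
when there are no vertices. In this form atomicity can be compared with the condition on cables. -/
theorem isAtomic_iff (U : Hypersequent) :
    U.IsAtomic ↔ PreconnectedSpace U.Pt ∧ ∀ e, ¬ U.TwoEnded e := by
  rw [isPreconnected_iff_clopen]
  constructor
  · rintro (⟨hE, hV⟩ | ⟨hV, e, he⟩ | ⟨v, hv, he⟩)
    · refine ⟨fun S _ => Or.inl ?_, fun e => hE.elim e⟩
      ext x
      rcases x with e | v
      · exact hE.elim e
      · exact hV.elim v
    · refine ⟨fun S _ => ?_, fun e' h => ?_⟩
      · by_cases h : (Sum.inl e : U.E ⊕ U.V) ∈ S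
        · right
          ext x
          rcases x with e' | v
          · rw [he e']; exact iff_of_true h trivial
          · exact hV.elim v
        · left
          ext x
          rcases x with e' | v
          · rw [he e']; exact iff_of_false h id
          · exact hV.elim v
      · obtain ⟨x, -⟩ := exists_adj_of_twoEnded h
        exact hV.elim x
    · refine ⟨fun S hS => ?_, fun e' h => ?_⟩
      · by_cases h : (Sum.inr v : U.E ⊕ U.V) ∈ S
        · right
          ext x
          rcases x with e' | w
          · exact iff_of_true ((hS v e' (he e')).2 h) trivial
          · rw [hv w]; exact iff_of_true h trivial
        · left
          ext x
          rcases x with e' | w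
          · exact iff_of_false ((hS v e' (he e')).not.2 h) id
          · rw [hv w]; exact iff_of_false h id
      · obtain ⟨x, y, -, -, hxy⟩ := exists_adj_of_twoEnded h
        exact hxy ((hv x).trans (hv y).symm)
  · rintro ⟨hc, h2⟩
    by_cases hV : IsEmpty U.V
    · by_cases hE : IsEmpty U.E
      · exact Or.inl ⟨hE, hV⟩
      · rw [not_isEmpty_iff] at hE
        obtain ⟨e⟩ := hE
        refine Or.inr (Or.inl ⟨hV, e, fun e' => ?_⟩)
        rcases hc {x | x = (Sum.inl e : U.E ⊕ U.V)} (fun v => hV.elim v) with h | h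
        · exact absurd (h ▸ (rfl : (Sum.inl e : U.E ⊕ U.V) = Sum.inl e) :
            (Sum.inl e : U.E ⊕ U.V) ∈ (∅ : Set U.Pt)) (fun h => h)
        · have h1 : (Sum.inl e' : U.E ⊕ U.V) ∈ (Set.univ : Set U.Pt) := trivial
          rw [← h] at h1
          exact Sum.inl_injective h1
    · rw [not_isEmpty_iff] at hV
      obtain ⟨v⟩ := hV
      -- The star of `v`, which is clopen because none of its edges has another end.
      let S : Set U.Pt := {x | x = (Sum.inr v : U.E ⊕ U.V) ∨
        ∃ e, x = (Sum.inl e : U.E ⊕ U.V) ∧ U.Adj e v}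
      have hS : S = Set.univ := by
        refine (hc S ?_).resolve_left ?_
        · intro w e hew
          constructor
          · rintro (h | ⟨e', h, h3⟩)
            · cases h
            · cases Sum.inl_injective h
              refine Or.inl (congrArg Sum.inr ?_)
              by_contra hwv
              exact h2 _ (twoEnded_of_adj hew h3 hwv)
          · rintro (h | ⟨e', h, h3⟩)
            · cases Sum.inr_injective h
              exact Or.inr ⟨e, rfl, hew⟩
            · cases h
        · intro h
          have h1 : (Sum.inr v : U.E ⊕ U.V) ∈ S := Or.inl rfl
          rw [h] at h1
          exact h1
      refine Or.inr (Or.inr ⟨v, fun w => ?_, fun e => ?_⟩)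
      · have h1 : (Sum.inr w : U.E ⊕ U.V) ∈ (Set.univ : Set U.Pt) := trivial
        rw [← hS] at h1
        rcases h1 with h1 | ⟨e', h1, -⟩
        · exact Sum.inr_injective h1
        · cases h1
      · have h1 : (Sum.inl e : U.E ⊕ U.V) ∈ (Set.univ : Set U.Pt) := trivial
        rw [← hS] at h1
        rcases h1 with h1 | ⟨e', h1, h3⟩
        · cases h1
        · cases Sum.inl_injective h1
          exact h3

theorem IsCutOnly.surjective {U V : Hypersequent} {d : U ⟶ V} (h : IsCutOnly d) (y : V.Pt) :
    ∃ x, Hom.toFun d x = y := by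
  rcases y with e | v
  · obtain ⟨e', he', -⟩ := h.edge_lift e
    exact ⟨Sum.inl e', toFun_inl he'⟩
  · obtain ⟨x, rfl⟩ := h.vert_surj v
    exact ⟨Sum.inr x, rfl⟩

/-- Images of connected spaces are connected. Conversely, fibres are connected, so a clopen set
upstairs is a union of fibres and its image is clopen. -/
theorem IsCutOnly.preconnected_iff {U V : Hypersequent} {d : U ⟶ V} (h : IsCutOnly d) :
    PreconnectedSpace U.Pt ↔ PreconnectedSpace V.Pt := by
  constructor
  · intro hU
    refine ⟨?_⟩
    have h1 : Hom.toFun d '' Set.univ = Set.univ := Set.image_univ_of_surjective h.surjective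
    rw [← h1]
    exact isPreconnected_univ.image _ d.cont.continuousOn
  · intro hV
    rw [isPreconnected_iff_clopen] at hV ⊢
    intro S hS
    have hst : CollapseStable d {v | (Sum.inr v : U.E ⊕ U.V) ∈ S} := by
      intro e w he x y hx hy hxS
      exact (hS y e hy).1 ((hS x e hx).2 hxS)
    -- A persistent edge is alone in its fibre, and a collapsed edge is on the same side of `S` as
    -- its source, which reduces saturation to vertices.
    have hsat : ∀ x y, x ∈ S → Hom.toFun d x = Hom.toFun d y → y ∈ S := by
      have hcol : ∀ (e : U.E) (w : V.V), d.edge e = Sum.inr w →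
          ∃ v, d.vert v = w ∧ ((Sum.inl e : U.E ⊕ U.V) ∈ S ↔ (Sum.inr v : U.E ⊕ U.V) ∈ S) := by
        intro e w he
        obtain ⟨v, hv⟩ := Option.isSome_iff_exists.1 (h.twoEnded he).1
        exact ⟨v, Hom.vert_of_collapsed d he (Or.inl hv), hS v e (Or.inl hv)⟩
      rintro (e | v) (e' | v') hx hxy
      · rcases h1 : d.edge e with ⟨f, p⟩ | w <;> rcases h2 : d.edge e' with ⟨f', q⟩ | w'
        · rw [toFun_inl h1, toFun_inl h2] at hxy
          cases Sum.inl_injective hxy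
          obtain rfl := h.edge_unique h1 h2
          exact hx
        · rw [toFun_inl h1, toFun_inl_collapsed h2] at hxy
          cases hxy
        · rw [toFun_inl_collapsed h1, toFun_inl h2] at hxy
          cases hxy
        · rw [toFun_inl_collapsed h1, toFun_inl_collapsed h2] at hxy
          obtain ⟨v, hv, h3⟩ := hcol _ _ h1
          obtain ⟨v', hv', h4⟩ := hcol _ _ h2
          exact h4.2 (h.saturated hst (h3.1 hx)
            (hv.trans ((Sum.inr_injective hxy).trans hv'.symm)))
      · rcases h1 : d.edge e with ⟨f, p⟩ | w
        · rw [toFun_inl h1, toFun_inr] at hxy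
          cases hxy
        · rw [toFun_inl_collapsed h1, toFun_inr] at hxy
          obtain ⟨v, hv, h3⟩ := hcol _ _ h1
          exact h.saturated hst (h3.1 hx) (hv.trans (Sum.inr_injective hxy))
      · rcases h1 : d.edge e' with ⟨f, p⟩ | w
        · rw [toFun_inl h1, toFun_inr] at hxy
          cases hxy
        · rw [toFun_inl_collapsed h1, toFun_inr] at hxy
          obtain ⟨v', hv, h3⟩ := hcol _ _ h1
          exact h3.2 (h.saturated hst hx ((Sum.inr_injective hxy).trans hv.symm))
      · exact h.saturated hst hx (Sum.inr_injective hxy)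
    rcases hV (Hom.toFun d '' S) (by
      intro v e hev
      obtain ⟨e₁, he₁, -⟩ := h.edge_lift e
      obtain ⟨v₁, hv₁, rfl⟩ := h.ends_lift he₁ hev
      constructor
      · rintro ⟨x, hx, hxe⟩
        have h2 := hsat x (Sum.inl e₁) hx (hxe.trans (toFun_inl he₁).symm)
        exact ⟨Sum.inr v₁, (hS _ _ hv₁).1 h2, rfl⟩
      · rintro ⟨x, hx, hxe⟩
        have h2 := hsat x (Sum.inr v₁) hx hxe
        exact ⟨Sum.inl e₁, (hS _ _ hv₁).2 h2, toFun_inl he₁⟩) with h1 | h1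
    · left
      exact Set.image_eq_empty.1 h1
    · right
      ext x
      have h2 : Hom.toFun d x ∈ Hom.toFun d '' S := by rw [h1]; trivial
      obtain ⟨y, hy, hyx⟩ := h2
      simpa using hsat _ _ hy hyx

theorem IsCutOnly.twoEnded_iff {U V : Hypersequent} {d : U ⟶ V} (h : IsCutOnly d)
    {e : U.E} {e' : V.E} {p : List Bool} (he : d.edge e = Sum.inl (e', p)) :
    U.TwoEnded e ↔ V.TwoEnded e' := by
  constructor
  · intro h2
    rcases d.occ _ _ _ he with ⟨-, h3, h4⟩ | ⟨-, h3, h4⟩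
    · obtain ⟨x, hx⟩ := Option.isSome_iff_exists.1 h2.1
      obtain ⟨y, hy⟩ := Option.isSome_iff_exists.1 h2.2
      exact ⟨by rw [h3 x hx]; rfl, by rw [h4 y hy]; rfl⟩
    · obtain ⟨x, hx⟩ := Option.isSome_iff_exists.1 h2.1
      obtain ⟨y, hy⟩ := Option.isSome_iff_exists.1 h2.2
      exact ⟨by rw [h4 y hy]; rfl, by rw [h3 x hx]; rfl⟩
  · intro h2
    obtain ⟨x, y, hx, hy, hxy⟩ := exists_adj_of_twoEnded h2
    obtain ⟨x', hx', rfl⟩ := h.ends_lift he hx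
    obtain ⟨y', hy', rfl⟩ := h.ends_lift he hy
    exact twoEnded_of_adj hx' hy' (fun h => hxy (congrArg _ h))

/-- The codomain of a cut only topological play is atomic when its domain is connected and the
collapsed edges are those with two ends. -/
theorem IsCutOnly.isAtomic_iff {U V : Hypersequent} {d : U ⟶ V} (h : IsCutOnly d) :
    V.IsAtomic ↔ PreconnectedSpace U.Pt ∧
      ∀ e, (∃ v, d.edge e = Sum.inr v) ↔ U.TwoEnded e := by
  rw [MALLGame.isAtomic_iff, h.preconnected_iff]
  refine and_congr_right fun _ => ?_
  constructor
  · intro h1 e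
    refine ⟨fun ⟨v, hv⟩ => h.twoEnded hv, fun h2 => ?_⟩
    rcases h3 : d.edge e with ⟨e', p⟩ | v
    · exact absurd ((h.twoEnded_iff h3).1 h2) (h1 e')
    · exact ⟨v, rfl⟩
  · intro h1 e' h2
    obtain ⟨e, he, -⟩ := h.edge_lift e'
    obtain ⟨v, hv⟩ := (h1 e).2 ((h.twoEnded_iff he).2 h2)
    rw [he] at hv
    cases hv

theorem IsEmb.surjective_of_isAtomic {U V : Hypersequent} {f : U ⟶ V} (hf : IsEmb f)
    (hV : V.IsAtomic) (v : U.V) : IsIso f := by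
  rcases hV with ⟨-, h⟩ | ⟨h, -⟩ | ⟨w, hw, he⟩
  · exact h.elim (f.vert v)
  · exact h.elim (f.vert v)
  · refine hf.isIso_of (fun e' => ?_) (fun w' => ⟨v, (hw _).trans (hw _).symm⟩)
    have h1 : V.Adj e' (f.vert v) := by rw [hw (f.vert v)]; exact he e'
    obtain ⟨e, -, h2⟩ := hf.exists_edge_of_adj h1
    exact ⟨e, [], h2⟩

/-- An open part of an atomic hypersequent that contains a vertex contains all its edges. This
dichotomy handles the moves that disappear in a descent. -/
theorem IsEmb.isIso_or_isEmpty {U V : Hypersequent} {f : U ⟶ V} (hf : IsEmb f)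
    (hV : V.IsAtomic) : IsIso f ∨ IsEmpty U.V := by
  by_cases h : IsEmpty U.V
  · exact Or.inr h
  · rw [not_isEmpty_iff] at h
    exact Or.inl (hf.surjective_of_isAtomic hV h.some)

theorem isAtomic_of_iso {U V : Hypersequent} (f : U ⟶ V) [IsIso f] (h : V.IsAtomic) :
    U.IsAtomic := by
  rw [isAtomic_iff] at h ⊢
  have hf : IsCutOnly f := IsCutOnly.iso f inferInstance
  refine ⟨hf.preconnected_iff.2 h.1, fun e he => ?_⟩
  obtain ⟨e', he'⟩ := (IsEmb.of_isIso f).2 e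
  exact h.2 e' ((hf.twoEnded_iff he').1 he)

/-! ### Passive moves -/

theorem IsCutMove.isActiveVertex {U V : Hypersequent} {m : U ⟶ V} (h : IsCutMove m) :
    ∃ v, IsActiveVertex m v := by
  obtain ⟨c, v₁, v₂, v, h1, h2, h3, h4, h5⟩ := isCutMove_iff.1 h
  exact ⟨v, Or.inl ⟨h, c, h3⟩⟩

theorem IsPassiveMove.not_isCutMove {U V : Hypersequent} {m : U ⟶ V} (h : IsPassiveMove m) :
    ¬ IsCutMove m := fun hc =>
  let ⟨v, hv⟩ := hc.isActiveVertex
  h.2 v hv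

/-- An active vertex of `m` would be sent by `j` to an active vertex of `m'`: an edge left unbroken
by `m'` pulls back to an unbroken edge, and sources are preserved by embeddings. -/
theorem IsPassiveMove.restrict {U' V' U V : Hypersequent} {i : U ⟶ U'} {m : U ⟶ V}
    {m' : U' ⟶ V'} {j : V ⟶ V'} (h : IsPassiveMove m') (hpb : IsPullback i m m' j)
    (hj : IsEmb j) (hm : IsMove m) : IsPassiveMove m := by
  have hc := h.not_isCutMove
  refine ⟨hm, fun v hv => ?_⟩
  rcases hv with ⟨-, e, he⟩ | ⟨-, e₀, h1, h2⟩
  · obtain ⟨e', -, he'⟩ := pullback_collapsed_image hpb hj he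
    exact h.1.edge_ne_inr hc _ _ he'
  · obtain ⟨e₁, he₁⟩ := hj.2 e₀
    refine h.2 (j.vert v) (Or.inr ⟨hc, e₁, fun e he => ?_, ((hj.edge_spec he₁).2.1 v).1 h2⟩)
    obtain ⟨d, -, hd⟩ := pullback_exists_edge hpb hj he he₁
    exact h1 d hd

theorem IsPassiveMove.source_eq_none {U V : Hypersequent} {m : U ⟶ V} (h : IsPassiveMove m)
    {e₀ : V.E} (he : ∀ e, m.edge e ≠ Sum.inl (e₀, [])) : V.s e₀ = none := by
  by_contra h1
  obtain ⟨v, hv⟩ := Option.ne_none_iff_exists'.1 h1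
  exact h.2 v (Or.inr ⟨h.not_isCutMove, e₀, he, hv⟩)

/-! ### Lifting passive moves along cut only topological plays -/

/-- A graph is acyclic when it has a homomorphism to an acyclic graph which is injective outside a
set of vertices of degree at most one. -/
theorem _root_.SimpleGraph.IsAcyclic.of_hom_injOn {α β : Type*} {G : SimpleGraph α}
    {H : SimpleGraph β} (hH : H.IsAcyclic) (φ : G →g H) (B : Set α) (hinj : Set.InjOn φ B)
    (hdeg : ∀ x, x ∉ B → (G.neighborSet x).Subsingleton) : G.IsAcyclic := by
  intro v c hc
  -- A vertex on a cycle has two distinct neighbours, so a cycle avoids the complement of `B`; on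
  -- `B` the homomorphism is injective and the cycle would give one in `H`.
  have hB : ∀ x ∈ c.support, x ∈ B := by
    intro x hx
    by_contra hxB
    have h1 := hc.ncard_neighborSet_toSubgraph_eq_two hx
    have h2 : (c.toSubgraph.neighborSet x).Subsingleton :=
      (hdeg x hxB).anti (c.toSubgraph.neighborSet_subset x)
    rw [Set.ncard_eq_two] at h1
    obtain ⟨a, b, hab, h3⟩ := h1
    rw [h3] at h2
    exact hab (h2 (Set.mem_insert _ _) (Set.mem_insert_of_mem _ rfl))
  have h1 : (c.induce B hB).IsCycle := by
    rw [← SimpleGraph.Walk.isCycle_map_iff_of_injective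
      (f := (SimpleGraph.Embedding.induce (G := G) B).toHom)
      (SimpleGraph.Embedding.induce (G := G) B).injective, SimpleGraph.Walk.map_induce]
    exact hc
  refine SimpleGraph.IsAcyclic.comap (φ.comp (SimpleGraph.Embedding.induce (G := G) B).toHom) ?_ hH _ h1
  intro x y hxy
  exact Subtype.ext (hinj x.2 y.2 hxy)

/-- The edges of `Y'` and an additional edge `c`, attached to the vertices of `X`. -/
def cutLiftGraph (X Y' : Hypersequent) (c : X.E) (K : Y'.E → Y'.V → Option X.V) :
    PartialGraph where
  E := Option Y'.E
  V := X.V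
  s e := match e with
    | none => X.s c
    | some e => (Y'.s e).bind (K e)
  t e := match e with
    | none => X.t c
    | some e => (Y'.t e).bind (K e)

/-- `cutLiftGraph` as a hypersequent. -/
def cutLift (X Y' : Hypersequent) (c : X.E) (K : Y'.E → Y'.V → Option X.V)
    (h₁ : ∀ e v w x, Y'.s e = some v → Y'.t e = some w → K e v = some x → K e w ≠ some x)
    (h₂ : (cutLiftGraph X Y' c K).incidence.IsAcyclic) : Hypersequent where
  toPartialGraph := cutLiftGraph X Y' c K
  finE := by
    have := Y'.finE
    exact inferInstanceAs (Finite (Option Y'.E))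
  finV := X.finV
  noLoop e v hs ht := by
    rcases e with _ | e
    · exact X.noLoop c v hs ht
    · obtain ⟨a, ha, ha'⟩ := Option.bind_eq_some_iff.1 hs
      obtain ⟨b, hb, hb'⟩ := Option.bind_eq_some_iff.1 ht
      exact h₁ e a b v ha hb ha' hb'
  acyclic := h₂
  label e := match e with
    | none => X.label c
    | some e => Y'.label e
  label_pos e := by
    rcases e with _ | e
    · exact X.label_pos c
    · exact Y'.label_pos e

/-- Moves that only break a source-free edge lift along cut moves. -/
theorem exists_lift_of_isBasicCut {X Y Y' : Hypersequent} {d : X ⟶ Y} {m' : Y' ⟶ Y}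
    (hd : IsBasicCut d) {D : Set Y'.E} {e₀ : Y.E} (hm : IsoOutside m' D {e₀} ∅)
    (hs : Y.s e₀ = none) (hD : ∀ e ∈ D, ∃ p, m'.edge e = Sum.inl (e₀, p)) :
    ∃ (X' : Hypersequent) (m : X' ⟶ X) (d' : X' ⟶ Y') (E : Y'.E → X'.E) (f₀ : X.E),
      IsBasicCut d' ∧ d' ≫ m' = m ≫ d ∧ d.edge f₀ = Sum.inl (e₀, []) ∧
      IsoOutside m (E '' D) {f₀} ∅ ∧
      ∀ e p, m'.edge e = Sum.inl (e₀, p) → m.edge (E e) = Sum.inl (f₀, p) := by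
  classical
  have hcm := isCutMove_iff.2 hd
  obtain ⟨c, v₁, v₂, v, hc₁, hc₂, hcv, hv, hio⟩ := hd
  have hnoDc : ∀ e, e ≠ c → ∃ e', d.edge e = Sum.inl (e', []) := fun e he => by
    obtain ⟨e', -, h⟩ := hio.edge_map e he
    exact ⟨e', h⟩
  -- `l f` is the unique edge of `X` over the edge `f` of `Y`; the other edge of `X` is the cut edge
  -- `c`.
  choose l hl hl' using hcm.edge_lift
  have himg : ∀ e, ∃ x : Y.E × List Bool, m'.edge e = Sum.inl x ∧ (e ∉ D → x.2 = [] ∧ x.1 ≠ e₀) := by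
    intro e
    by_cases he : e ∈ D
    · obtain ⟨p, hp⟩ := hD e he
      exact ⟨_, hp, fun h => absurd he h⟩
    · obtain ⟨e', h1, h2⟩ := hm.edge_map e he
      exact ⟨_, h2, fun _ => ⟨rfl, h1⟩⟩
  choose F hF hF' using himg
  -- As no vertex is excluded in `hm`, the move `m'` is bijective on vertices, with inverse `g`. The
  -- lift can thus have the same vertices as `X`.
  choose g hg hg' using fun y => hm.vert_lift y (fun h => h)
  have hgi : ∀ a b, m'.vert a = m'.vert b → a = b := fun a b h =>
    (hg' (m'.vert b) a h).trans (hg' (m'.vert b) b rfl).symm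
  have hlc : ∀ f, l f ≠ c := by
    intro f h
    have h1 := hl f
    rw [h, hcv] at h1
    cases h1
  have hli : ∀ f f', l f = l f' → f = f' := by
    intro f f' h
    have h1 := hl f
    rw [h, hl f'] at h1
    cases h1
    rfl
  have hlabel : ∀ f, X.label (l f) = Y.label f := by
    intro f
    rcases d.occ _ _ _ (hl f) with ⟨h1, -⟩ | ⟨h1, -⟩
    · rw [Formula.sub_nil] at h1
      exact (Option.some.inj h1).symm
    · rw [Formula.sub_nil] at h1
      exact absurd (Option.some.inj h1 ▸ Y.label_pos f) (Formula.not_isPos_dual (X.label_pos _))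
  have hst : ∀ f, (∀ x, X.s (l f) = some x → Y.s f = some (d.vert x)) ∧
      (∀ x, X.t (l f) = some x → Y.t f = some (d.vert x)) := by
    intro f
    rcases d.occ _ _ _ (hl f) with ⟨-, h1⟩ | ⟨h1, -⟩
    · exact h1
    · rw [Formula.sub_nil] at h1
      exact absurd (Option.some.inj h1 ▸ Y.label_pos f) (Formula.not_isPos_dual (X.label_pos _))
  -- The end of `e` at `a` must be reattached to one of the vertices of `X` over `m'.vert a`. The
  -- choice is dictated by the edge of `X` over the image of `e`, which has at most one end there
  -- since `Y` has no loops.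
  have hK : ∀ (e : Y'.E) (a : Y'.V), ∃ o : Option X.V, ∀ x, o = some x ↔
      X.Adj (l (F e).1) x ∧ d.vert x = m'.vert a := by
    intro e a
    by_cases h : ∃ x, X.Adj (l (F e).1) x ∧ d.vert x = m'.vert a
    · obtain ⟨x, hx, hxa⟩ := h
      refine ⟨some x, fun y => ⟨?_, ?_⟩⟩
      · intro h
        cases h
        exact ⟨hx, hxa⟩
      · rintro ⟨hy, hya⟩
        have h1 := hst (F e).1
        rcases hx with hx | hx <;> rcases hy with hy | hy
        · exact hx.symm.trans hy
        · have h2 := h1.1 x hx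
          have h3 := h1.2 y hy
          rw [hxa] at h2
          rw [hya] at h3
          exact absurd h3 (Y.noLoop _ _ h2)
        · have h2 := h1.2 x hx
          have h3 := h1.1 y hy
          rw [hxa] at h2
          rw [hya] at h3
          exact absurd h2 (Y.noLoop _ _ h3)
        · exact hx.symm.trans hy
    · exact ⟨none, fun x => ⟨fun h' => (nomatch h'), fun hx => absurd ⟨x, hx⟩ h⟩⟩
  choose K hK using hK
  let φ : Option Y'.E → X.E := fun e => e.elim c (fun e => l (F e).1)
  have hadj : ∀ (e : Option Y'.E) (x : X.V), (cutLiftGraph X Y' c K).Adj e x ↔ X.Adj (φ e) x := by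
    intro e x
    rcases e with _ | e
    · exact Iff.rfl
    · constructor
      · rintro (h | h)
        · obtain ⟨a, ha, ha'⟩ := Option.bind_eq_some_iff.1 h
          exact ((hK _ _ _).1 ha').1
        · obtain ⟨a, ha, ha'⟩ := Option.bind_eq_some_iff.1 h
          exact ((hK _ _ _).1 ha').1
      · intro h
        obtain ⟨a, ha, ha'⟩ := hm.ends_lift _ _ _ _ (hF e) (Hom.adj_map d (hl (F e).1) h)
        have h1 : K e a = some x := (hK _ _ _).2 ⟨h, ha'.symm⟩
        rcases ha with ha | ha
        · exact Or.inl (Option.bind_eq_some_iff.2 ⟨a, ha, h1⟩)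
        · exact Or.inr (Option.bind_eq_some_iff.2 ⟨a, ha, h1⟩)
  have hs₀ : X.s (l e₀) = none := by
    rcases h : X.s (l e₀) with _ | x
    · rfl
    · rw [(hst e₀).1 x h] at hs
      cases hs
  have hφD : ∀ e, φ (some e) ≠ l e₀ → e ∉ D := by
    intro e h he
    obtain ⟨p, hp⟩ := hD e he
    rw [hF] at hp
    exact h (congrArg l (congrArg Prod.fst (Sum.inl_injective hp)))
  have hφinj : ∀ e e', φ e ≠ l e₀ → φ e = φ e' → e = e' := by
    intro e e' h1 h2
    rcases e with _ | e <;> rcases e' with _ | e'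
    · rfl
    · exact absurd h2.symm (hlc _)
    · exact absurd h2 (hlc _)
    · have h3 : (F e).1 = (F e').1 := hli _ _ h2
      have he := hφD e h1
      have he' := hφD e' (h2 ▸ h1)
      have h4 : m'.edge e = Sum.inl ((F e).1, []) := by rw [hF, ← (hF' e he).1]
      have h5 : m'.edge e' = Sum.inl ((F e).1, []) := by rw [hF, h3, ← (hF' e' he').1]
      exact congrArg some ((hm.edge_lift _ (hF' e he).2).unique ⟨he, h4⟩ ⟨he', h5⟩)
  -- The new graph maps to `X` injectively except on the edges over `l e₀`. These have no end but
  -- the target of `l e₀`, hence degree at most one in the incidence graph, and lie on no cycle.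
  have hacyc : (cutLiftGraph X Y' c K).incidence.IsAcyclic := by
    refine SimpleGraph.IsAcyclic.of_hom_injOn X.acyclic
      ⟨Sum.map φ id, ?_⟩ {x | ∀ e, x = Sum.inl e → φ e ≠ l e₀} ?_ ?_
    · intro x y hxy
      simp only [PartialGraph.incidence, SimpleGraph.fromRel_adj] at hxy ⊢
      obtain ⟨hne, ⟨e, v, rfl, rfl, h⟩ | ⟨e, v, rfl, rfl, h⟩⟩ := hxy
      · exact ⟨Sum.inl_ne_inr, Or.inl ⟨_, _, rfl, rfl, (hadj e v).1 h⟩⟩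
      · exact ⟨Sum.inr_ne_inl, Or.inr ⟨_, _, rfl, rfl, (hadj e v).1 h⟩⟩
    · rintro (e | x) h1 (e' | x') h2 h3
      · exact congrArg Sum.inl (hφinj e e' (h1 e rfl) (Sum.inl_injective h3))
      · cases h3
      · cases h3
      · exact congrArg Sum.inr (Sum.inr_injective h3)
    · intro x hx
      simp only [Set.mem_ofPred_eq, not_forall, not_not] at hx
      obtain ⟨e, rfl, he⟩ := hx
      have key : ∀ y ∈ (cutLiftGraph X Y' c K).incidence.neighborSet (Sum.inl e),
          ∃ z, y = Sum.inr z ∧ X.t (l e₀) = some z := by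
        intro y hy
        rw [SimpleGraph.mem_neighborSet] at hy
        simp only [PartialGraph.incidence, SimpleGraph.fromRel_adj] at hy
        obtain ⟨hne, ⟨e', z, h1, rfl, h⟩ | ⟨e', z, rfl, h1, h⟩⟩ := hy
        · cases Sum.inl_injective h1
          have h2 := (hadj e z).1 h
          rw [he] at h2
          rcases h2 with h2 | h2
          · rw [hs₀] at h2; cases h2
          · exact ⟨z, rfl, h2⟩
        · cases h1
      intro y hy z hz
      obtain ⟨a, rfl, ha⟩ := key y hy
      obtain ⟨b, rfl, hb⟩ := key z hz
      rw [ha] at hb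
      rw [Option.some.inj hb]
  let X' : Hypersequent := cutLift X Y' c K (by
    intro e a b x h1 h2 h3 h4
    have h5 := ((hK _ _ _).1 h3).2
    have h6 := ((hK _ _ _).1 h4).2
    obtain rfl := hgi a b (h5.symm.trans h6)
    exact Y'.noLoop _ _ h1 h2) hacyc
  have hadj' : ∀ (e : X'.E) (x : X'.V), X'.Adj e x ↔ X.Adj (φ e) x := hadj
  -- The additional edge `none` is the cut edge: `m` sends it to `c`, while `d'` will collapse it.
  -- The other edges are those of `Y'`, with the same occurrences as under `m'`.
  let medge : X'.E → (X.E × List Bool) ⊕ X.V := fun e =>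
    Option.elim e (Sum.inl (c, [])) (fun e => Sum.inl (l (F e).1, (F e).2))
  have hmedge : ∀ e f p, medge e = Sum.inl (f, p) → f = φ e := by
    rintro (_ | e) f p h
    · cases h; rfl
    · cases h; rfl
  let m : X' ⟶ X :=
    { vert := fun x => x
      edge := medge
      cont := by
        apply continuous_pointMap
        · intro e f p h x hx
          rw [hmedge _ _ _ h]
          exact (hadj' e x).1 hx
        · rintro (_ | e) w h
          · cases h
          · cases h
      occ := by
        rintro (_ | e) f p h
        · cases h
          exact Or.inl ⟨by rw [Formula.sub_nil]; rfl, fun _ h => h, fun _ h => h⟩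
        · cases h
          have key : ∀ (a : Y'.V) (x : X.V), K e a = some x →
              (Y.s (F e).1 = some (m'.vert a) → X.s (l (F e).1) = some x) ∧
              (Y.t (F e).1 = some (m'.vert a) → X.t (l (F e).1) = some x) := by
            intro a x h1
            obtain ⟨h2, h3⟩ := (hK _ _ _).1 h1
            constructor
            · intro h4
              rcases h2 with h2 | h2
              · exact h2
              · have h5 := (hst (F e).1).2 x h2
                rw [h3] at h5
                exact absurd h5 (Y.noLoop _ _ h4)
            · intro h4
              rcases h2 with h2 | h2
              · have h5 := (hst (F e).1).1 x h2
                rw [h3] at h5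
                exact absurd h4 (Y.noLoop _ _ h5)
              · exact h2
          rcases m'.occ e (F e).1 (F e).2 (hF e) with ⟨h1, h2, h3⟩ | ⟨h1, h2, h3⟩
          · refine Or.inl ⟨by rw [hlabel]; exact h1, fun x hx => ?_, fun x hx => ?_⟩
            · obtain ⟨a, ha, ha'⟩ := Option.bind_eq_some_iff.1 hx
              exact (key a x ha').1 (h2 a ha)
            · obtain ⟨a, ha, ha'⟩ := Option.bind_eq_some_iff.1 hx
              exact (key a x ha').2 (h3 a ha)
          · refine Or.inr ⟨by rw [hlabel]; exact h1, fun x hx => ?_, fun x hx => ?_⟩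
            · obtain ⟨a, ha, ha'⟩ := Option.bind_eq_some_iff.1 hx
              exact (key a x ha').2 (h2 a ha)
            · obtain ⟨a, ha, ha'⟩ := Option.bind_eq_some_iff.1 hx
              exact (key a x ha').1 (h3 a ha) }
  have hKg : ∀ e a x, K e a = some x → g (d.vert x) = a := by
    intro e a x h
    apply hgi
    rw [hg]
    exact ((hK _ _ _).1 h).2
  let dedge : X'.E → (Y'.E × List Bool) ⊕ Y'.V := fun e =>
    Option.elim e (Sum.inr (g v)) (fun e => Sum.inl (e, []))
  let d' : X' ⟶ Y' :=
    { vert := fun x => g (d.vert x)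
      edge := dedge
      cont := by
        apply continuous_pointMap
        · rintro (_ | e) f p h x hx
          · cases h
          · cases h
            rcases hx with hx | hx
            · obtain ⟨a, ha, ha'⟩ := Option.bind_eq_some_iff.1 hx
              rw [hKg _ _ _ ha']
              exact Or.inl ha
            · obtain ⟨a, ha, ha'⟩ := Option.bind_eq_some_iff.1 hx
              rw [hKg _ _ _ ha']
              exact Or.inr ha
        · rintro (_ | e) w h x hx
          · cases h
            rw [Hom.vert_of_collapsed d hcv (show X.Adj c x from hx)]
          · cases h
      occ := by
        rintro (_ | e) f p h
        · cases h
        · cases h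
          refine Or.inl ⟨by rw [Formula.sub_nil]; rfl, fun x hx => ?_, fun x hx => ?_⟩
          · obtain ⟨a, ha, ha'⟩ := Option.bind_eq_some_iff.1 hx
            rw [hKg _ _ _ ha']
            exact ha
          · obtain ⟨a, ha, ha'⟩ := Option.bind_eq_some_iff.1 hx
            rw [hKg _ _ _ ha']
            exact ha }
  have hmn : m.edge none = Sum.inl (c, []) := rfl
  have hms : ∀ e, m.edge (some e) = Sum.inl (l (F e).1, (F e).2) := fun e => rfl
  have hdn : d'.edge none = Sum.inr (g v) := rfl
  have hds : ∀ e, d'.edge (some e) = Sum.inl (e, []) := fun e => rfl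
  refine ⟨X', m, d', some, l e₀, ?_, ?_, hl e₀, ?_, ?_⟩
  · refine ⟨none, v₁, v₂, g v, hc₁, hc₂, hdn, fun x => ?_, ?_, ?_, ?_, ?_⟩
    · refine Iff.trans ?_ (hv x)
      constructor
      · intro h
        have := congrArg m'.vert h
        exact (hg _).symm.trans (this.trans (hg v))
      · intro h
        exact congrArg g h
    · rintro (_ | e) he
      · exact absurd rfl he
      · exact ⟨e, id, hds e⟩
    · intro e _
      refine ⟨some e, ⟨fun h => (nomatch (h : some e = none)), hds e⟩, ?_⟩
      rintro (_ | e') ⟨h1, h2⟩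
      · exact absurd rfl h1
      · rw [hds] at h2
        cases h2
        rfl
    · intro y hy
      have hy' : m'.vert y ∉ ({v} : Set Y.V) := by
        intro h
        refine hy (hgi _ _ ?_)
        rw [hg]
        exact h
      obtain ⟨x, hx, hx'⟩ := hio.vert_lift (m'.vert y) hy'
      refine ⟨x, hgi _ _ ((hg _).trans hx), fun z hz => hx' z ?_⟩
      have h1 : g (d.vert z) = y := hz
      rw [← h1, hg]
    · rintro (_ | e) e' p y h1 h2
      · rw [hdn] at h1; cases h1
      · rw [hds] at h1
        cases h1
        obtain ⟨x, hx, hx'⟩ := hcm.ends_lift (hl (F e).1) (Hom.adj_map m' (hF e) h2)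
        exact ⟨x, (hadj' _ x).2 hx, hgi _ _ ((hg _).trans hx')⟩
  · apply Hom.ext
    · funext x
      exact hg (d.vert x)
    · funext e
      rcases e with _ | e
      · rw [comp_edge_inr hdn, comp_edge_inl_inr hmn hcv, hg]
      · rw [comp_edge_inl (hds e) (hF e), comp_edge_inl (hms e) (hl _)]
        simp
  · refine ⟨?_, ?_, ?_, ?_⟩
    · rintro (_ | e) he
      · exact ⟨c, fun h => hlc _ h.symm, hmn⟩
      · have heD : e ∉ D := fun h => he ⟨e, h, rfl⟩
        refine ⟨l (F e).1, fun h => (hF' e heD).2 (hli _ _ h), ?_⟩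
        rw [hms, (hF' e heD).1]
    · intro f hf
      by_cases hfc : f = c
      · subst hfc
        refine ⟨none, ⟨fun ⟨_, _, h⟩ => (nomatch (h : some _ = none)), hmn⟩, ?_⟩
        rintro (_ | e) ⟨h1, h2⟩
        · rfl
        · rw [hms] at h2
          exact absurd (congrArg Prod.fst (Sum.inl_injective h2)) (hlc _)
      · obtain ⟨f', hf'⟩ := hnoDc f hfc
        obtain ⟨rfl, -⟩ := hl' _ _ _ hf'
        have hf0 : f' ∉ ({e₀} : Set Y.E) := fun h => hf (congrArg l h)
        obtain ⟨e, ⟨h1, h2⟩, h3⟩ := hm.edge_lift f' hf0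
        have h4 : F e = (f', []) := Sum.inl_injective ((hF e).symm.trans h2)
        refine ⟨some e, ⟨?_, by rw [hms, h4]⟩, ?_⟩
        · rintro ⟨e', h5, h6⟩
          cases h6
          exact h1 h5
        · rintro (_ | e') ⟨h5, h6⟩
          · rw [hmn] at h6
            exact absurd (congrArg Prod.fst (Sum.inl_injective h6)).symm hfc
          · rw [hms] at h6
            have h7 := Sum.inl_injective h6
            have h8 : (F e').1 = f' := hli _ _ (congrArg Prod.fst h7)
            have h9 : (F e').2 = [] := congrArg Prod.snd h7
            refine congrArg some (h3 e' ⟨fun h => h5 ⟨e', h, rfl⟩, ?_⟩)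
            rw [hF, ← h8, ← h9]
    · intro y _
      exact ⟨y, rfl, fun z hz => hz⟩
    · intro e f p y h1 h2
      refine ⟨y, (hadj' e y).2 ?_, rfl⟩
      rw [← hmedge e f p h1]
      exact h2
  · intro e p h
    rw [hms]
    have h1 := Sum.inl_injective ((hF e).symm.trans h)
    rw [h1]

/-- Passivity makes the broken edge source-free, so that a tensor splits no vertex and a one removes
none. The three non-cut moves then only replace an edge, which can be done just as well before the
collapse. -/
theorem IsPassiveMove.exists_lift_of_isCutMove {X Y Y' : Hypersequent} {d : X ⟶ Y} {m' : Y' ⟶ Y}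
    (hd : IsCutMove d) (hm : IsPassiveMove m') :
    ∃ (X' : Hypersequent) (m : X' ⟶ X) (d' : X' ⟶ Y'), IsPassiveMove m ∧ IsCutMove d' ∧
      d' ≫ m' = m ≫ d := by
  have hdb := isCutMove_iff.1 hd
  have hlab : ∀ {f₀ : X.E} {e₀ : Y.E}, d.edge f₀ = Sum.inl (e₀, []) → X.label f₀ = Y.label e₀ := by
    intro f₀ e₀ h
    rcases d.occ _ _ _ h with ⟨h1, -⟩ | ⟨h1, -⟩
    · rw [Formula.sub_nil] at h1
      exact (Option.some.inj h1).symm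
    · rw [Formula.sub_nil] at h1
      exact absurd (Option.some.inj h1 ▸ Y.label_pos e₀) (Formula.not_isPos_dual (X.label_pos _))
  have hsrc : ∀ {f₀ : X.E} {e₀ : Y.E}, d.edge f₀ = Sum.inl (e₀, []) → Y.s e₀ = none →
      X.s f₀ = none := by
    intro f₀ e₀ h h0
    rcases h1 : X.s f₀ with _ | x
    · rfl
    · rcases d.occ _ _ _ h with ⟨-, h2, -⟩ | ⟨h2, -⟩
      · rw [h2 x h1] at h0
        cases h0
      · rw [Formula.sub_nil] at h2
        exact absurd (Option.some.inj h2 ▸ Y.label_pos e₀) (Formula.not_isPos_dual (X.label_pos _))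
  have hset : ∀ {Z : Hypersequent} {e : Z.E}, Z.s e = none → {v | Z.s e = some v} = ∅ := by
    intro Z e h
    ext v
    simp [h]
  -- a basic move other than a cut which breaks a source-free edge is passive
  have hpas : ∀ {X' : Hypersequent} {m : X' ⟶ X} {D : Set X'.E} {f₀ : X.E},
      IsBasicMove m → IsoOutside m D {f₀} ∅ → X.s f₀ = none →
      (∀ e ∈ D, ∃ p, p ≠ [] ∧ m.edge e = Sum.inl (f₀, p)) → IsPassiveMove m := by
    intro X' m D f₀ hb hio hs hD
    have hne : ∀ e, m.edge e ≠ Sum.inl (f₀, []) := by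
      intro e he
      by_cases h : e ∈ D
      · obtain ⟨p, hp, h1⟩ := hD e h
        rw [he] at h1
        cases h1
        exact hp rfl
      · obtain ⟨e', h1, h2⟩ := hio.edge_map e h
        rw [he] at h2
        cases h2
        exact h1 rfl
    have hmv : IsMove m := properRestrictions_of hb fun h => by
      obtain ⟨e, he⟩ := edge_of_isIso m f₀
      exact hne e he
    have hcol : ∀ e v, m.edge e ≠ Sum.inr v := by
      intro e v he
      by_cases h : e ∈ D
      · obtain ⟨p, hp, h1⟩ := hD e h
        rw [he] at h1
        cases h1
      · obtain ⟨e', h1, h2⟩ := hio.edge_map e h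
        rw [he] at h2
        cases h2
    refine ⟨hmv, fun v hv => ?_⟩
    rcases hv with ⟨-, e, he⟩ | ⟨-, e, he, hev⟩
    · exact hcol e v he
    · by_cases h : e ∈ ({f₀} : Set X.E)
      · cases h
        rw [hs] at hev
        cases hev
      · obtain ⟨e', ⟨-, h1⟩, -⟩ := hio.edge_lift e h
        exact he e' h1
  rcases isBasicMove_of_isMove hm.1 with h | h | h | h
  · exact absurd (isCutMove_iff.2 h) hm.not_isCutMove
  · obtain ⟨e₁, e₂, e₀, A, B, h1, h2, h3, -, h4⟩ := h
    have hs := hm.source_eq_none (e₀ := e₀) (by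
      intro e he
      by_cases h : e ∈ ({e₁, e₂} : Set Y'.E)
      · rcases h with rfl | rfl
        · rw [h2] at he; cases he
        · rw [h3] at he; cases he
      · obtain ⟨e', h5, h6⟩ := h4.edge_map e h
        rw [he] at h6
        cases h6
        exact h5 rfl)
    rw [hset hs] at h4
    obtain ⟨X', m, d', E, f₀, k1, k2, k3, k4, k5⟩ := exists_lift_of_isBasicCut hdb h4 hs (by
      rintro e (rfl | rfl)
      · exact ⟨_, h2⟩
      · exact ⟨_, h3⟩)
    have hs' := hsrc k3 hs
    refine ⟨X', m, d', hpas (Or.inr (Or.inl ?_)) k4 hs' ?_, isCutMove_iff.2 k1, k2⟩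
    · refine ⟨E e₁, E e₂, f₀, A, B, by rw [hlab k3, h1], k5 _ _ h2, k5 _ _ h3, ?_, ?_⟩
      · intro v hv
        rw [hs'] at hv
        cases hv
      · rwa [hset hs', ← Set.image_pair]
    · rintro _ ⟨e, rfl | rfl, rfl⟩
      · exact ⟨_, by simp, k5 _ _ h2⟩
      · exact ⟨_, by simp, k5 _ _ h3⟩
  · obtain ⟨e₁, e₀, A, B, b, h1, h2, h4⟩ := h
    have hs := hm.source_eq_none (e₀ := e₀) (by
      intro e he
      by_cases h : e ∈ ({e₁} : Set Y'.E)
      · rcases h with rfl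
        rw [h2] at he; cases he
      · obtain ⟨e', h5, h6⟩ := h4.edge_map e h
        rw [he] at h6
        cases h6
        exact h5 rfl)
    obtain ⟨X', m, d', E, f₀, k1, k2, k3, k4, k5⟩ := exists_lift_of_isBasicCut hdb h4 hs (by
      rintro e rfl
      exact ⟨_, h2⟩)
    have hs' := hsrc k3 hs
    refine ⟨X', m, d', hpas (Or.inr (Or.inr (Or.inl ?_))) k4 hs' ?_, isCutMove_iff.2 k1, k2⟩
    · refine ⟨E e₁, f₀, A, B, b, by rw [hlab k3, h1], k5 _ _ h2, ?_⟩
      rwa [Set.image_singleton] at k4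
    · rintro _ ⟨e, rfl, rfl⟩
      exact ⟨_, by simp, k5 _ _ h2⟩
  · obtain ⟨e₀, h1, -, h4⟩ := h
    have hs := hm.source_eq_none (e₀ := e₀) (by
      intro e he
      obtain ⟨e', h5, h6⟩ := h4.edge_map e id
      rw [he] at h6
      cases h6
      exact h5 rfl)
    rw [hset hs] at h4
    obtain ⟨X', m, d', E, f₀, k1, k2, k3, k4, k5⟩ := exists_lift_of_isBasicCut hdb h4 hs (by
      rintro e he
      exact he.elim)
    have hs' := hsrc k3 hs
    refine ⟨X', m, d', hpas (Or.inr (Or.inr (Or.inr ?_))) k4 hs' ?_, isCutMove_iff.2 k1, k2⟩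
    · refine ⟨f₀, by rw [hlab k3, h1], ?_, ?_⟩
      · intro v hv
        rw [hs'] at hv
        cases hv
      · rw [hset hs']
        rwa [Set.image_empty] at k4
    · rintro _ ⟨e, he, rfl⟩
      exact he.elim

/-- Passive moves lift along cut only topological plays. -/
theorem IsCutOnly.exists_lift {X Y : Hypersequent} {d : X ⟶ Y} (hd : IsCutOnly d) :
    ∀ {Y' : Hypersequent} {m' : Y' ⟶ Y}, IsPassiveMove m' →
    ∃ (X' : Hypersequent) (m : X' ⟶ X) (d' : X' ⟶ Y'), IsPassiveMove m ∧ IsCutOnly d' ∧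
      d' ≫ m' = m ≫ d := by
  induction hd with
  | iso f hf =>
    intro Y' m' hm
    have h1 : IsPullback (𝟙 Y') (m' ≫ inv f) m' f := IsPullback.of_horiz_isIso ⟨by simp⟩
    refine ⟨Y', m' ≫ inv f, 𝟙 Y', hm.restrict h1 (IsEmb.of_isIso f) ?_,
      IsCutOnly.iso _ inferInstance, by simp⟩
    exact hm.1.comp_iso (inv f)
  | cut n c hn hc ih =>
    intro Y' m' hm
    obtain ⟨Z, m₁, c', h1, h2, h3⟩ := ih hm
    obtain ⟨X', m, n', h4, h5, h6⟩ := h1.exists_lift_of_isCutMove hn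
    refine ⟨X', m, n' ≫ c', h4, IsCutOnly.cut _ _ h5 h2, ?_⟩
    rw [Category.assoc, h3, ← Category.assoc, h6, Category.assoc]

/-! ### What threads see -/

theorem Sees.isEmb {U X Y : Hypersequent} {t : Play U X} {p : Play U Y} {i : X ⟶ Y}
    (h : Sees t p i) : IsEmb i := by
  induction h with
  | nil => exact IsEmb.id_mem _
  | move m' m i hm' hm hi hpb h ih => exact hi
  | moveRight m i hm hi hpb h ih => exact hi
  | embRight k i hk hi w h ih => exact hi
  | embLeft k hk h ih => exact IsEmb.comp_mem _ _ hk ih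

/-- Embeddings made by the thread commute with an embedding made by the play, so the latter can be
taken as the last step. -/
theorem Sees.snoc_emb_iff {U X Y Z : Hypersequent} {t : Play U X} {p : Play U Y} {k : Z ⟶ Y}
    {hk : IsEmb k} {i : X ⟶ Z} :
    Sees t (p.snoc (GMove.emb k hk)) i ↔ IsEmb i ∧ Sees t p (i ≫ k) := by
  constructor
  · intro h
    refine ⟨h.isEmb, ?_⟩
    generalize hP : p.snoc (GMove.emb k hk) = P at h
    induction h with
    | nil => cases hP
    | move m' m i hm' hm hi hpb h ih => cases hP
    | moveRight m i hm hi hpb h ih => cases hP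
    | embRight k i hk hi w h ih =>
      cases hP
      rw [w]
      exact h
    | embLeft g hg h ih =>
      subst hP
      rw [Category.assoc]
      exact Sees.embLeft g hg (ih rfl)
  · rintro ⟨hi, h⟩
    exact Sees.embRight k i hk hi rfl h

/-- Induction on what is seen by threads of a play that ends with a move. -/
theorem Sees.snoc_move_rec {U Y Z : Hypersequent} {p : Play U Y} {m : Z ⟶ Y} {hm : IsMove m}
    {C : ∀ {X : Hypersequent}, Play U X → (X ⟶ Z) → Prop}
    (move : ∀ {X X' : Hypersequent} {t : Play U X} {j : X ⟶ Y} (m' : X' ⟶ X) (i : X' ⟶ Z)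
      (hm' : IsMove m'), IsEmb i → IsPullback i m' m j → Sees t p j →
      C (t.snoc (GMove.move m' hm')) i)
    (moveRight : ∀ {X : Hypersequent} {t : Play U X} {j : X ⟶ Y} (i : X ⟶ Z),
      IsEmb i → IsPullback i (𝟙 X) m j → Sees t p j → C t i)
    (embLeft : ∀ {X X' : Hypersequent} {t : Play U X} {i : X ⟶ Z} (g : X' ⟶ X) (hg : IsEmb g),
      C t i → C (t.snoc (GMove.emb g hg)) (g ≫ i))
    {X : Hypersequent} {t : Play U X} {i : X ⟶ Z} (h : Sees t (p.snoc (GMove.move m hm)) i) :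
    C t i := by
  generalize hP : p.snoc (GMove.move m hm) = P at h
  induction h with
  | nil => cases hP
  | move m' m i hm' hm hi hpb h ih =>
    cases hP
    exact move m' i hm' hi hpb h
  | moveRight m i hm hi hpb h ih =>
    cases hP
    exact moveRight i hi hpb h
  | embRight k i hk hi w h ih => cases hP
  | embLeft g hg h ih =>
    subst hP
    exact embLeft g hg (ih move moveRight embLeft rfl)

/-- Whatever a thread sees of `p`, it sees of `p'`. -/
def SeesLe {U Y : Hypersequent} (p p' : Play U Y) : Prop :=
  ∀ ⦃X : Hypersequent⦄ (t : Play U X) (i : X ⟶ Y), Sees t p i → Sees t p' i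

theorem SeesLe.refl {U Y : Hypersequent} (p : Play U Y) : SeesLe p p := fun _ _ _ h => h

theorem SeesLe.trans {U Y : Hypersequent} {p p' p'' : Play U Y} (h : SeesLe p p')
    (h' : SeesLe p' p'') : SeesLe p p'' := fun _ t i hs => h' t i (h t i hs)

theorem SeesLe.snoc {U Y Z : Hypersequent} {p p' : Play U Y} (h : SeesLe p p') (f : GMove Z Y) :
    SeesLe (p.snoc f) (p'.snoc f) := by
  intro X t i hs
  cases f with
  | move m hm =>
    refine Sees.snoc_move_rec (C := fun t i => Sees t (p'.snoc (GMove.move m hm)) i) ?_ ?_ ?_ hs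
    · intro X X' t j m' i hm' hi hpb hs
      exact Sees.move m' m i hm' hm hi hpb (h _ _ hs)
    · intro X t j i hi hpb hs
      exact Sees.moveRight m i hm hi hpb (h _ _ hs)
    · intro X X' t i g hg hs
      exact Sees.embLeft g hg hs
  | emb k hk =>
    rw [Sees.snoc_emb_iff] at hs ⊢
    exact ⟨hs.1, h _ _ hs.2⟩

/-- The beginning of a cable can thus be modified without inspecting its continuation. -/
theorem SeesLe.append {U Y Z : Hypersequent} {p p' : Play U Y} (h : SeesLe p p') (b : Play Y Z) :
    SeesLe (p.append b) (p'.append b) := by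
  induction b with
  | nil => exact h
  | snoc b f ih => exact ih.snoc f

theorem SeesLe.threadsOf {U Y : Hypersequent} {p p' : Play U Y} (h : SeesLe p p')
    (X : Hypersequent) : threadsOf p X ⊆ threadsOf p' X := fun t ⟨ht, i, hi⟩ => ⟨ht, i, h t i hi⟩

theorem seesLe_emb_comp {U Y Z W : Hypersequent} (p : Play U Y) {k : Z ⟶ Y} {k' : W ⟶ Z}
    (hk : IsEmb k) (hk' : IsEmb k') (hkk : IsEmb (k' ≫ k)) :
    SeesLe (p.snoc (GMove.emb (k' ≫ k) hkk))
      ((p.snoc (GMove.emb k hk)).snoc (GMove.emb k' hk')) := by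
  intro X t i hs
  rw [Sees.snoc_emb_iff] at hs
  rw [Sees.snoc_emb_iff, Sees.snoc_emb_iff, Category.assoc]
  exact ⟨hs.1, IsEmb.comp_mem _ _ hs.1 hk', hs.2⟩

theorem seesLe_comp_emb {U Y Z W : Hypersequent} (p : Play U Y) {k : Z ⟶ Y} {k' : W ⟶ Z}
    (hk : IsEmb k) (hk' : IsEmb k') (hkk : IsEmb (k' ≫ k)) :
    SeesLe ((p.snoc (GMove.emb k hk)).snoc (GMove.emb k' hk'))
      (p.snoc (GMove.emb (k' ≫ k) hkk)) := by
  intro X t i hs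
  rw [Sees.snoc_emb_iff, Sees.snoc_emb_iff, Category.assoc] at hs
  rw [Sees.snoc_emb_iff]
  exact ⟨hs.1, hs.2.2⟩

theorem seesLe_emb_id {U Y : Hypersequent} (p : Play U Y) (h : IsEmb (𝟙 Y)) :
    SeesLe (p.snoc (GMove.emb (𝟙 Y) h)) p := by
  intro X t i hs
  rw [Sees.snoc_emb_iff, Category.comp_id] at hs
  exact hs.2

/-- No thread living in the image of `k` notices the move, which restricts to an identity there;
this is the step in which only the play moves. -/
theorem seesLe_emb_move {U Y Z W : Hypersequent} (p : Play U Y) {m : Z ⟶ Y} (hm : IsMove m)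
    {k : W ⟶ Z} (hk : IsEmb k) (hkm : IsEmb (k ≫ m)) (hpb : IsPullback k (𝟙 W) m (k ≫ m)) :
    SeesLe (p.snoc (GMove.emb (k ≫ m) hkm))
      ((p.snoc (GMove.move m hm)).snoc (GMove.emb k hk)) := by
  intro X t i hs
  rw [Sees.snoc_emb_iff] at hs
  rw [Sees.snoc_emb_iff]
  refine ⟨hs.1, Sees.moveRight m (i ≫ k) hm (IsEmb.comp_mem _ _ hs.1 hk) ?_ hs.2⟩
  exact (IsPullback.of_vert_isIso ⟨by simp⟩ : IsPullback i (𝟙 X) (𝟙 W) i).paste_horiz hpb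

theorem seesLe_iso_comp_move {U Y Z W : Hypersequent} (p : Play U Y) {m : Z ⟶ Y} (hm : IsMove m)
    {k : W ⟶ Z} [IsIso k] (hk : IsEmb k) (hkm : IsMove (k ≫ m)) :
    SeesLe (p.snoc (GMove.move (k ≫ m) hkm))
      ((p.snoc (GMove.move m hm)).snoc (GMove.emb k hk)) := by
  intro X t i hs
  rw [Sees.snoc_emb_iff]
  refine ⟨hs.isEmb, ?_⟩
  have key : ∀ {X X' : Hypersequent} {i : X' ⟶ W} {m' : X' ⟶ X} {j : X ⟶ Y},
      IsPullback i m' (k ≫ m) j → IsPullback (i ≫ k) m' m j := by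
    intro X X' i m' j h
    have h1 : IsPullback k (k ≫ m) m (𝟙 Y) := IsPullback.of_horiz_isIso ⟨by simp⟩
    simpa using h.paste_horiz h1
  refine Sees.snoc_move_rec (C := fun t i => Sees t (p.snoc (GMove.move m hm)) (i ≫ k))
    ?_ ?_ ?_ hs
  · intro X X' t j m' i hm' hi hpb hs
    exact Sees.move m' m _ hm' hm (IsEmb.comp_mem _ _ hi hk) (key hpb) hs
  · intro X t j i hi hpb hs
    exact Sees.moveRight m _ hm (IsEmb.comp_mem _ _ hi hk) (key hpb) hs
  · intro X X' t i g hg hs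
    rw [Category.assoc]
    exact Sees.embLeft g hg hs

theorem seesLe_move_comp_iso {U Y Z W : Hypersequent} (p : Play U Y) {m : W ⟶ Z} (hm : IsMove m)
    {k : Z ⟶ Y} [IsIso k] (hk : IsEmb k) (hkm : IsMove (m ≫ k)) :
    SeesLe (p.snoc (GMove.move (m ≫ k) hkm))
      ((p.snoc (GMove.emb k hk)).snoc (GMove.move m hm)) := by
  intro X t i hs
  have key : ∀ {X X' : Hypersequent} {i : X' ⟶ W} {m' : X' ⟶ X} {j : X ⟶ Y},
      IsPullback i m' (m ≫ k) j → IsPullback i m' m (j ≫ inv k) := by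
    intro X X' i m' j h
    have h1 : IsPullback (𝟙 W) (m ≫ k) m (inv k) := IsPullback.of_horiz_isIso ⟨by simp⟩
    simpa using h.paste_horiz h1
  have key' : ∀ {X : Hypersequent} {t : Play U X} {j : X ⟶ Y}, Sees t p j →
      Sees t (p.snoc (GMove.emb k hk)) (j ≫ inv k) := by
    intro X t j hs
    rw [Sees.snoc_emb_iff]
    exact ⟨IsEmb.comp_mem _ _ hs.isEmb (IsEmb.of_isIso _), by simpa using hs⟩
  refine Sees.snoc_move_rec
    (C := fun t i => Sees t ((p.snoc (GMove.emb k hk)).snoc (GMove.move m hm)) i) ?_ ?_ ?_ hs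
  · intro X X' t j m' i hm' hi hpb hs
    exact Sees.move m' m _ hm' hm hi (key hpb) (key' hs)
  · intro X t j i hi hpb hs
    exact Sees.moveRight m _ hm hi (key hpb) (key' hs)
  · intro X X' t i g hg hs
    exact Sees.embLeft g hg hs

/-- Every move pulls back to an identity on the empty hypersequent, which also factors through every
embedding. -/
theorem Sees.append_of_isEmpty {U X Y : Hypersequent} (hE : IsEmpty X.E) (hV : IsEmpty X.V)
    {t : Play U X} {p : Play U Y} {j : X ⟶ Y} (h : Sees t p j) {Z : Hypersequent} (b : Play Y Z) :
    ∃ i, Sees t (p.append b) i := by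
  induction b with
  | nil => exact ⟨j, h⟩
  | @snoc V W b f ih =>
    obtain ⟨i, hi⟩ := ih
    obtain ⟨i', hi'⟩ := exists_emb_of_isEmpty hE hV W
    refine ⟨i', ?_⟩
    cases f with
    | move m hm =>
      refine Sees.moveRight m i' hm hi' ?_ hi
      refine hi.isEmb.isPullback_of hi' (hom_ext_of_isEmpty hE hV _ _) ?_
      rintro y ⟨x, -⟩
      rcases x with e | v
      · exact hE.elim e
      · exact hV.elim v
    | emb k hk => exact Sees.embRight k i' hk hi' (hom_ext_of_isEmpty hE hV _ _) hi

/-- A thread of the prefix need not be a thread of the whole play. Its restriction to the empty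
hypersequent is, and `P` is prefix-closed. -/
theorem threadsOf_of_append {U Y Z : Hypersequent} {P : PlaySet U} (hP : IsStrategy P)
    {p : Play U Y} {b : Play Y Z} (h : ∀ X, threadsOf (p.append b) X ⊆ P X) (X : Hypersequent) :
    threadsOf p X ⊆ P X := by
  rintro t ⟨ht, i, hi⟩
  obtain ⟨A, a, ha, hE, hV⟩ := exists_empty_emb X
  obtain ⟨i', hi'⟩ := (hi.embLeft a ha).append_of_isEmpty hE hV b
  exact hP.prefix_closed t (embPlay a ha) (h A ⟨ht, i', hi'⟩)

theorem threadsOf_snoc_emb {U Y Z : Hypersequent} {p : Play U Y} (k : Z ⟶ Y)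
    (hk : IsEmb k) (X : Hypersequent) :
    threadsOf (p.snoc (GMove.emb k hk)) X ⊆ threadsOf p X := by
  rintro t ⟨ht, i, hi⟩
  exact ⟨ht, _, (Sees.snoc_emb_iff.1 hi).2⟩

/-- What is new in such a thread is a restriction of the passive move, again passive and with an
atomic codomain because the play is a thread, possibly followed by embeddings. All these are
mandatory. -/
theorem threadsOf_snoc_passive {U Y Z : Hypersequent} {P : PlaySet U} (hP : IsStrategy P)
    {p : Play U Y} (h : ∀ X, threadsOf p X ⊆ P X) {m : Z ⟶ Y} (hm : IsMove m)
    (hp : IsPassiveMove m) (X : Hypersequent) :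
    threadsOf (p.snoc (GMove.move m hm)) X ⊆ P X := by
  rintro t ⟨ht, i, hi⟩
  revert ht
  refine Sees.snoc_move_rec (C := fun {X} t _ => t.IsThread → t ∈ P X) ?_ ?_ ?_ hi
  · intro X X' t j m' i hm' hi hpb hs ht
    exact hP.mandatory t _ ⟨ht.2, hp.restrict hpb hs.isEmb hm'⟩ (h _ ⟨ht.1, _, hs⟩)
  · intro X t j i hi hpb hs ht
    exact h _ ⟨ht, _, hs⟩
  · intro X X' t i g hg hs ht
    exact hP.mandatory t (GMove.emb g hg) trivial (hs ht)

/-! ### Descent of cables -/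

/-- `Elim p q d`: the play `p` is a cable that descends to `q`, with `d` on top. -/
inductive Elim {U : Hypersequent} :
    ∀ {X Y : Hypersequent}, Play U X → Play U Y → (X ⟶ Y) → Prop
  | nil : Elim Play.nil Play.nil (𝟙 U)
  | move {X Y X' Y' : Hypersequent} {p : Play U X} {q : Play U Y} {d : X ⟶ Y}
      (m : X' ⟶ X) (m' : Y' ⟶ Y) (d' : X' ⟶ Y') (hm : IsMove m) (hm' : IsMove m')
      (hcut : ¬ IsCutMove m') (hd' : IsCutOnly d') (w : d' ≫ m' = m ≫ d) (ha : Y.IsAtomic)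
      (h : Elim p q d) :
      Elim (p.snoc (GMove.move m hm)) (q.snoc (GMove.move m' hm')) d'
  | emb {X Y X' Y' : Hypersequent} {p : Play U X} {q : Play U Y} {d : X ⟶ Y}
      (k : X' ⟶ X) (k' : Y' ⟶ Y) (d' : X' ⟶ Y') (hk : IsEmb k) (hk' : IsEmb k')
      (hd' : IsCutOnly d') (w : d' ≫ k' = k ≫ d) (h : Elim p q d) :
      Elim (p.snoc (GMove.emb k hk)) (q.snoc (GMove.emb k' hk')) d'
  | moveId {X Y X' : Hypersequent} {p : Play U X} {q : Play U Y} {d : X ⟶ Y}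
      (m : X' ⟶ X) (d' : X' ⟶ Y) (hm : IsMove m) (hd' : IsCutOnly d') (w : d' = m ≫ d)
      (ha : Y.IsAtomic) (h : Elim p q d) :
      Elim (p.snoc (GMove.move m hm)) q d'

theorem Elim.isCutOnly {U X Y : Hypersequent} {p : Play U X} {q : Play U Y} {d : X ⟶ Y}
    (h : Elim p q d) : IsCutOnly d := by
  cases h with
  | nil => exact IsCutOnly.iso _ inferInstance
  | move _ _ _ _ _ _ hd' => exact hd'
  | emb _ _ _ _ _ hd' => exact hd'
  | moveId _ _ _ hd' => exact hd'

theorem Elim.geom_eq {U X Y : Hypersequent} {p : Play U X} {q : Play U Y} {d : X ⟶ Y}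
    (h : Elim p q d) : p.geom = d ≫ q.geom := by
  induction h with
  | nil => simp [Play.geom]
  | move m m' d' hm hm' hcut hd' w ha h ih =>
    simp only [Play.geom, GMove.hom, ih]
    rw [← Category.assoc, ← w, Category.assoc]
  | emb k k' d' hk hk' hd' w h ih =>
    simp only [Play.geom, GMove.hom, ih]
    rw [← Category.assoc, ← w, Category.assoc]
  | moveId m d' hm hd' w ha h ih =>
    simp only [Play.geom, GMove.hom, ih, w, Category.assoc]

theorem Elim.geom_ne_inr {U X Y : Hypersequent} {p : Play U X} {q : Play U Y} {d : X ⟶ Y}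
    (h : Elim p q d) : ∀ e v, q.geom.edge e ≠ Sum.inr v := by
  have aux : ∀ {A B C : Hypersequent} (f : A ⟶ B) (g : B ⟶ C), (∀ e v, f.edge e ≠ Sum.inr v) →
      (∀ e v, g.edge e ≠ Sum.inr v) → ∀ e v, (f ≫ g).edge e ≠ Sum.inr v := by
    intro A B C f g hf hg e v hev
    rcases h1 : f.edge e with ⟨e', p⟩ | w
    · rcases h2 : g.edge e' with ⟨e', p⟩ | w
      · rw [comp_edge_inl h1 h2] at hev
        cases hev
      · exact hg _ _ h2
    · exact hf _ _ h1
  induction h with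
  | nil => exact fun _ _ => (IsEmb.id_mem U).edge_ne_inr
  | move m m' d' hm hm' hcut hd' w ha h ih => exact aux _ _ (hm'.edge_ne_inr hcut) ih
  | emb k k' d' hk hk' hd' w h ih => exact aux _ _ (fun _ _ => hk'.edge_ne_inr) ih
  | moveId m d' hm hd' w ha h ih => exact ih

/-- The morphism under `p` is `d` followed by the morphism under `q`, and the latter collapses
nothing. -/
theorem Elim.isDoomed_iff {U X Y : Hypersequent} {p : Play U X} {q : Play U Y} {d : X ⟶ Y}
    (h : Elim p q d) (e : X.E) : IsDoomed (𝟙 U) p e ↔ ∃ v, d.edge e = Sum.inr v := by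
  rw [IsDoomed, Category.comp_id, h.geom_eq]
  rcases h1 : d.edge e with ⟨e', r⟩ | w
  · rcases h2 : q.geom.edge e' with ⟨e'', s⟩ | w
    · rw [comp_edge_inl h1 h2]
      simp
    · exact absurd h2 (h.geom_ne_inr _ _)
  · rw [comp_edge_inr h1]
    simp

/-- This exchanges the condition on cables, which concerns the upper play, for the atomicity of the
lower stage that is built into `Elim`. -/
theorem Elim.isCAtomic_iff {U X Y : Hypersequent} {p : Play U X} {q : Play U Y} {d : X ⟶ Y}
    (h : Elim p q d) : IsCAtomic (𝟙 U) p ↔ Y.IsAtomic := by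
  rw [h.isCutOnly.isAtomic_iff, IsCAtomic]
  simp only [h.isDoomed_iff]

theorem IsCable.of_snoc {U V X Y : Hypersequent} {c : U ⟶ V} {p : Play U X} {f : GMove Y X}
    (h : IsCable c (p.snoc f)) : IsCable c p :=
  ⟨fun W r q hp => h.1 W r (q.snoc f) (by rw [hp]; rfl),
    fun A B r m hm q hp => h.2 A B r m hm (q.snoc f) (by rw [hp]; rfl)⟩

theorem Elim.of_descends {U X Y : Hypersequent} {p : Play U X} {q : Play U Y} {d : X ⟶ Y}
    (h : Descends (𝟙 U) p q d) (hp : IsCable (𝟙 U) p) : Elim p q d := by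
  induction h with
  | nil => exact Elim.nil
  | move m m' d' hm hm' hcut hd' w h ih =>
    have h1 := ih hp.of_snoc
    exact Elim.move m m' d' hm hm' hcut hd' w
      (h1.isCAtomic_iff.1 (hp.2 _ _ _ m hm Play.nil rfl)) h1
  | emb k k' d' hk hk' hd' w h ih => exact Elim.emb k k' d' hk hk' hd' w (ih hp.of_snoc)
  | moveId m d' hm hd' w h ih =>
    have h1 := ih hp.of_snoc
    exact Elim.moveId m d' hm hd' w (h1.isCAtomic_iff.1 (hp.2 _ _ _ m hm Play.nil rfl)) h1

theorem Elim.descends {U X Y : Hypersequent} {p : Play U X} {q : Play U Y} {d : X ⟶ Y}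
    (h : Elim p q d) : Descends (𝟙 U) p q d := by
  induction h with
  | nil => exact Descends.nil (IsCutOnly.iso _ inferInstance)
  | move m m' d' hm hm' hcut hd' w ha h ih => exact Descends.move m m' d' hm hm' hcut hd' w ih
  | emb k k' d' hk hk' hd' w h ih => exact Descends.emb k k' d' hk hk' hd' w ih
  | moveId m d' hm hd' w ha h ih => exact Descends.moveId m d' hm hd' w ih

/-- Compatibility comes for free: doomed edges are collapsed by the cut only `d`, so they have two
ends. -/
theorem Elim.isCable {U X Y : Hypersequent} {p : Play U X} {q : Play U Y} {d : X ⟶ Y}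
    (h : Elim p q d) : IsCable (𝟙 U) p := by
  have hend : ∀ {X Y : Hypersequent} {p : Play U X} {q : Play U Y} {d : X ⟶ Y}, Elim p q d →
      ∀ e, IsDoomed (𝟙 U) p e → X.TwoEnded e := by
    intro X Y p q d h e he
    obtain ⟨v, hv⟩ := (h.isDoomed_iff e).1 he
    exact h.isCutOnly.twoEnded hv
  have hcompat : ∀ {X X' : Hypersequent} {p : Play U X} {f : GMove X' X}, IsCompatible (𝟙 U) p →
      (∀ e, IsDoomed (𝟙 U) (p.snoc f) e → X'.TwoEnded e) → IsCompatible (𝟙 U) (p.snoc f) := by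
    intro X X' p f h1 h2 W r q hq
    cases q with
    | nil =>
      cases hq
      exact h2
    | snoc q g =>
      cases hq
      exact h1 W r q rfl
  have hmove : ∀ {X X' Y : Hypersequent} {p : Play U X} {q : Play U Y} {d : X ⟶ Y} (m : X' ⟶ X)
      (hm : IsMove m), Elim p q d → Y.IsAtomic → IsCable (𝟙 U) p →
      ∀ (A B : Hypersequent) (r : Play U B) (n : A ⟶ B) (hn : IsMove n) (s : Play A X'),
      p.snoc (GMove.move m hm) = (r.snoc (GMove.move n hn)).append s → IsCAtomic (𝟙 U) r := by
    intro X X' Y p q d m hm h ha hp A B r n hn s hs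
    cases s with
    | nil =>
      cases hs
      exact h.isCAtomic_iff.2 ha
    | snoc s g =>
      cases hs
      exact hp.2 _ _ r n hn s rfl
  induction h with
  | nil =>
    refine ⟨fun W r q hq => ?_, fun A B r m hm q hq => ?_⟩
    · cases q with
      | nil =>
        cases hq
        exact hend Elim.nil
      | snoc q g => cases hq
    · cases q with
      | nil => cases hq
      | snoc q g => cases hq
  | move m m' d' hm hm' hcut hd' w ha h ih =>
    exact ⟨hcompat ih.1 (hend (Elim.move m m' d' hm hm' hcut hd' w ha h)), hmove m hm h ha ih⟩
  | emb k k' d' hk hk' hd' w h ih =>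
    refine ⟨hcompat ih.1 (hend (Elim.emb k k' d' hk hk' hd' w h)), ?_⟩
    intro A B r n hn s hs
    cases s with
    | nil => cases hs
    | snoc s g =>
      cases hs
      exact ih.2 _ _ r n hn s rfl
  | moveId m d' hm hd' w ha h ih =>
    exact ⟨hcompat ih.1 (hend (Elim.moveId m d' hm hd' w ha h)), hmove m hm h ha ih⟩

/-- The plays to which the cables with threads in `P` descend. -/
def elimSet {U : Hypersequent} (P : PlaySet U) : PlaySet U :=
  fun Y => {q : Play U Y | ∃ (X : Hypersequent) (p : Play U X) (d : X ⟶ Y), Elim p q d ∧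
    ∀ Z, threadsOf p Z ⊆ P Z}

theorem descent_cables_eq {U : Hypersequent} (P : PlaySet U) :
    descent (𝟙 U) (cables (𝟙 U) P) = elimSet P := by
  funext Y
  ext q
  constructor
  · rintro ⟨X, p, d, ⟨hp, ht⟩, h⟩
    exact ⟨X, p, d, Elim.of_descends h hp, ht⟩
  · rintro ⟨X, p, d, h, ht⟩
    exact ⟨X, p, d, ⟨h.isCable, ht⟩, h.descends⟩

/-- Decomposition of a descent above a decomposition of the lower play. -/
theorem Elim.exists_of_append {U X Y : Hypersequent} {p : Play U X} {q : Play U Y} {d : X ⟶ Y}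
    (h : Elim p q d) : ∀ {Y₀ : Hypersequent} (q₀ : Play U Y₀) (q₁ : Play Y₀ Y),
    q = q₀.append q₁ → ∃ (X₀ : Hypersequent) (p₀ : Play U X₀) (p₁ : Play X₀ X) (d₀ : X₀ ⟶ Y₀),
      p = p₀.append p₁ ∧ Elim p₀ q₀ d₀ ∧ ∀ {U' : Hypersequent} (p' : Play U' X₀)
        (q' : Play U' Y₀), Elim p' q' d₀ → Elim (p'.append p₁) (q'.append q₁) d := by
  induction h with
  | nil =>
    intro Y₀ q₀ q₁ hq
    cases q₁ with
    | nil =>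
      cases hq
      exact ⟨_, _, Play.nil, _, rfl, Elim.nil, fun p' q' h => h⟩
    | snoc q₁ g => cases hq
  | move m m' d' hm hm' hcut hd' w ha h ih =>
    intro Y₀ q₀ q₁ hq
    cases q₁ with
    | nil =>
      cases hq
      exact ⟨_, _, Play.nil, _, rfl, Elim.move m m' d' hm hm' hcut hd' w ha h, fun p' q' h => h⟩
    | snoc q₁ g =>
      cases hq
      obtain ⟨X₀, p₀, p₁, d₀, rfl, h2, h3⟩ := ih q₀ q₁ rfl
      exact ⟨X₀, p₀, p₁.snoc (GMove.move m hm), d₀, rfl, h2, fun p' q' h' =>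
        Elim.move m m' d' hm hm' hcut hd' w ha (h3 p' q' h')⟩
  | emb k k' d' hk hk' hd' w h ih =>
    intro Y₀ q₀ q₁ hq
    cases q₁ with
    | nil =>
      cases hq
      exact ⟨_, _, Play.nil, _, rfl, Elim.emb k k' d' hk hk' hd' w h, fun p' q' h => h⟩
    | snoc q₁ g =>
      cases hq
      obtain ⟨X₀, p₀, p₁, d₀, rfl, h2, h3⟩ := ih q₀ q₁ rfl
      exact ⟨X₀, p₀, p₁.snoc (GMove.emb k hk), d₀, rfl, h2, fun p' q' h' =>
        Elim.emb k k' d' hk hk' hd' w (h3 p' q' h')⟩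
  | moveId m d' hm hd' w ha h ih =>
    intro Y₀ q₀ q₁ hq
    obtain ⟨X₀, p₀, p₁, d₀, rfl, h2, h3⟩ := ih q₀ q₁ hq
    exact ⟨X₀, p₀, p₁.snoc (GMove.move m hm), d₀, rfl, h2, fun p' q' h' =>
      Elim.moveId m d' hm hd' w ha (h3 p' q' h')⟩

/-- The continuation of the cable depends only on the morphism on top of its beginning. It can be
kept when the beginning is replaced under the same `d`, and no new thread appears. -/
theorem elimSet_append_of {U Y Z : Hypersequent} {P : PlaySet U} {q q' : Play U Y} {q₁ : Play Y Z}
    (H : ∀ {X : Hypersequent} {p : Play U X} {d : X ⟶ Y}, Elim p q d →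
      ∃ p' : Play U X, Elim p' q' d ∧ SeesLe p' p)
    (h : q.append q₁ ∈ elimSet P Z) : q'.append q₁ ∈ elimSet P Z := by
  obtain ⟨X, p, d, hp, ht⟩ := h
  obtain ⟨X₀, p₀, p₁, d₀, rfl, h2, h3⟩ := hp.exists_of_append q q₁ rfl
  obtain ⟨p', h4, h5⟩ := H h2
  exact ⟨X, p'.append p₁, d, h3 _ _ h4, fun Z => ((h5.append p₁).threadsOf Z).trans (ht Z)⟩

/-- Induction on the moves that disappear at the end of a descent to a play that ends with an
embedding. -/
theorem Elim.snoc_emb_rec {U Y Y' : Hypersequent} {q : Play U Y} {k' : Y' ⟶ Y} {hk' : IsEmb k'}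
    {C : ∀ {X : Hypersequent}, Play U X → (X ⟶ Y') → Prop}
    (emb : ∀ {X X' : Hypersequent} {p : Play U X} {d : X ⟶ Y} (k : X' ⟶ X) (d' : X' ⟶ Y')
      (hk : IsEmb k), IsCutOnly d' → d' ≫ k' = k ≫ d → Elim p q d →
      C (p.snoc (GMove.emb k hk)) d')
    (moveId : ∀ {X X' : Hypersequent} {p : Play U X} {d : X ⟶ Y'} (m : X' ⟶ X) (hm : IsMove m),
      IsCutOnly (m ≫ d) → Y'.IsAtomic → Elim p (q.snoc (GMove.emb k' hk')) d → C p d →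
      C (p.snoc (GMove.move m hm)) (m ≫ d))
    {X : Hypersequent} {p : Play U X} {d : X ⟶ Y'} (h : Elim p (q.snoc (GMove.emb k' hk')) d) :
    C p d := by
  generalize hQ : q.snoc (GMove.emb k' hk') = Q at h
  induction h with
  | nil => cases hQ
  | move m m' d' hm hm' hcut hd' w ha h ih => cases hQ
  | emb k k' d' hk hk' hd' w h ih =>
    cases hQ
    exact emb k d' hk hd' w h
  | moveId m d' hm hd' w ha h ih =>
    subst hQ
    subst w
    exact moveId m hm hd' ha h (ih emb moveId rfl)

/-- Induction on the moves that disappear at the end of a descent to a play that ends with a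
move. -/
theorem Elim.snoc_move_rec {U Y Y' : Hypersequent} {q : Play U Y} {m' : Y' ⟶ Y} {hm' : IsMove m'}
    {C : ∀ {X : Hypersequent}, Play U X → (X ⟶ Y') → Prop}
    (move : ∀ {X X' : Hypersequent} {p : Play U X} {d : X ⟶ Y} (m : X' ⟶ X) (d' : X' ⟶ Y')
      (hm : IsMove m), ¬ IsCutMove m' → IsCutOnly d' → d' ≫ m' = m ≫ d → Y.IsAtomic →
      Elim p q d → C (p.snoc (GMove.move m hm)) d')
    (moveId : ∀ {X X' : Hypersequent} {p : Play U X} {d : X ⟶ Y'} (m : X' ⟶ X) (hm : IsMove m),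
      IsCutOnly (m ≫ d) → Y'.IsAtomic → Elim p (q.snoc (GMove.move m' hm')) d → C p d →
      C (p.snoc (GMove.move m hm)) (m ≫ d))
    {X : Hypersequent} {p : Play U X} {d : X ⟶ Y'} (h : Elim p (q.snoc (GMove.move m' hm')) d) :
    C p d := by
  generalize hQ : q.snoc (GMove.move m' hm') = Q at h
  induction h with
  | nil => cases hQ
  | move m m' d' hm hm' hcut hd' w ha h ih =>
    cases hQ
    exact move m d' hm hcut hd' w ha h
  | emb k k' d' hk hk' hd' w h ih => cases hQ
  | moveId m d' hm hd' w ha h ih =>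
    subst hQ
    subst w
    exact moveId m hm hd' ha h (ih move moveId rfl)

/-! ### Transformations of descents -/

/-- The cable is left untouched: only the lower stage is renamed, including under the moves that
disappear after the embedding. -/
theorem Elim.emb_iso {U X Y₀ Y Y' : Hypersequent} {p : Play U X} {q : Play U Y₀} {e : Y ⟶ Y₀}
    {he : IsEmb e} {d : X ⟶ Y} (h : Elim p (q.snoc (GMove.emb e he)) d) (i : Y' ⟶ Y) [IsIso i]
    (hie : IsEmb (i ≫ e)) : Elim p (q.snoc (GMove.emb (i ≫ e) hie)) (d ≫ inv i) := by
  refine Elim.snoc_emb_rec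
    (C := fun {X} p d => Elim p (q.snoc (GMove.emb (i ≫ e) hie)) (d ≫ inv i)) ?_ ?_ h
  · intro X X' p d k d' hk hd' w h
    exact Elim.emb k _ _ hk _ (hd'.comp_iso _) (by simpa using w) h
  · intro X X' p d m hm hd ha h ih
    exact Elim.moveId m _ hm (hd.comp_iso _) (by simp) (isAtomic_of_iso i ha) ih

theorem Elim.move_iso {U X Y₀ Y Y' : Hypersequent} {p : Play U X} {q : Play U Y₀} {m : Y ⟶ Y₀}
    {hm : IsMove m} {d : X ⟶ Y} (h : Elim p (q.snoc (GMove.move m hm)) d) (i : Y' ⟶ Y) [IsIso i]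
    (him : IsMove (i ≫ m)) : Elim p (q.snoc (GMove.move (i ≫ m) him)) (d ≫ inv i) := by
  refine Elim.snoc_move_rec
    (C := fun {X} p d => Elim p (q.snoc (GMove.move (i ≫ m) him)) (d ≫ inv i)) ?_ ?_ h
  · intro X X' p d k d' hk hc hd' w ha h
    refine Elim.move k _ _ hk _ (fun h => hc ?_) (hd'.comp_iso _) (by simpa using w) ha h
    simpa [IsCutMove] using h.iso_comp (inv i)
  · intro X X' p d m hm hd ha h ih
    exact Elim.moveId m _ hm (hd.comp_iso _) (by simp) (isAtomic_of_iso i ha) ih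

/-- An embedding without vertices absorbs the moves which disappear below it. -/
theorem absorb_move {T X X' Y : Hypersequent} {m : X' ⟶ X} {d : X ⟶ Y} {k : T ⟶ X'}
    (hT : IsEmpty T.V) (hk : IsEmb k) (hmd : IsCutOnly (m ≫ d))
    (he : ∀ e, ∃ e', (k ≫ m ≫ d).edge e = Sum.inl (e', [])) :
    IsEmb (k ≫ m) ∧ IsPullback k (𝟙 T) m (k ≫ m) := by
  -- There are no vertices in `T`. On edges, empty paths and injectivity are read off after
  -- composing with `d`, since `m ≫ d` is injective on persistent edges.
  have hkm : IsEmb (k ≫ m) := by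
    refine isEmb_of (fun e => ?_) (fun e₁ e₂ f h₁ h₂ => ?_) (fun v => hT.elim v)
      (fun v => hT.elim v)
    · obtain ⟨e', h⟩ := he e
      rw [← Category.assoc] at h
      obtain ⟨f, hf, -⟩ := exists_of_comp_edge_nil h
      exact ⟨f, hf⟩
    · obtain ⟨e', h⟩ := he e₁
      rw [← Category.assoc] at h
      obtain ⟨f', hf, hd⟩ := exists_of_comp_edge_nil h
      rw [h₁] at hf
      cases hf
      have h3 := comp_edge_inl h₁ hd
      have h4 := comp_edge_inl h₂ hd
      rw [Category.assoc] at h3 h4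
      obtain ⟨g₁, h5, h6⟩ := exists_of_comp_edge_nil h3
      obtain ⟨g₂, h7, h8⟩ := exists_of_comp_edge_nil h4
      obtain rfl := hmd.edge_unique h6 h8
      exact hk.edge_inj h5 h7
  refine ⟨hkm, hkm.isPullback_of hk (by simp) ?_⟩
  rintro y ⟨x, hx⟩
  rcases x with e | v
  · obtain ⟨e', h⟩ := he e
    obtain ⟨g₀, h1, h2⟩ := exists_of_comp_edge_nil h
    obtain ⟨f, h3, h4⟩ := exists_of_comp_edge_nil h2
    rw [toFun_inl (comp_edge_inl h1 h3)] at hx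
    -- An edge of `X'` over the image of `T` has the same image under `m ≫ d` as an edge in the
    -- range of `k`, hence equals it.
    obtain ⟨g, r, rfl, hg⟩ := edge_of_toFun_eq_inl hx.symm
    obtain rfl := hmd.edge_unique (comp_edge_inl hg h4) h2
    exact hk.inl_mem_range.2 ⟨e, h1⟩
  · exact hT.elim v

theorem IsCutOnly.edge_of_isEmpty {X Y : Hypersequent} {d : X ⟶ Y} (hd : IsCutOnly d)
    (hX : IsEmpty X.V) (e : X.E) : ∃ e', d.edge e = Sum.inl (e', []) := by
  rcases h : d.edge e with ⟨e', p⟩ | v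
  · obtain rfl := hd.edge_nil h
    exact ⟨e', rfl⟩
  · obtain ⟨x, -⟩ := exists_adj_of_twoEnded (hd.twoEnded h)
    exact hX.elim x

/-- The two embeddings of the cable may be separated by moves that disappear below. The induction
removes these moves or pushes them after the composite embedding, starting from the last one. -/
theorem Elim.exists_comp_emb_aux {U X₁ Y₀ Y₁ : Hypersequent} {p : Play U X₁} {q : Play U Y₀}
    {e₁ : Y₁ ⟶ Y₀} {he₁ : IsEmb e₁} {d₁ : X₁ ⟶ Y₁}
    (h : Elim p (q.snoc (GMove.emb e₁ he₁)) d₁) :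
    ∀ {X₂ Y₂ : Hypersequent} (k : X₂ ⟶ X₁) (e₂ : Y₂ ⟶ Y₁) (d₂ : X₂ ⟶ Y₂) (hk : IsEmb k)
      (he : IsEmb (e₂ ≫ e₁)), IsEmb e₂ → IsCutOnly d₂ → d₂ ≫ e₂ = k ≫ d₁ →
      ∃ p' : Play U X₂, Elim p' (q.snoc (GMove.emb (e₂ ≫ e₁) he)) d₂ ∧
        SeesLe p' (p.snoc (GMove.emb k hk)) := by
  refine Elim.snoc_emb_rec (C := fun {X₁} p d₁ =>
    ∀ {X₂ Y₂ : Hypersequent} (k : X₂ ⟶ X₁) (e₂ : Y₂ ⟶ Y₁) (d₂ : X₂ ⟶ Y₂) (hk : IsEmb k)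
      (he : IsEmb (e₂ ≫ e₁)), IsEmb e₂ → IsCutOnly d₂ → d₂ ≫ e₂ = k ≫ d₁ →
      ∃ p' : Play U X₂, Elim p' (q.snoc (GMove.emb (e₂ ≫ e₁) he)) d₂ ∧
        SeesLe p' (p.snoc (GMove.emb k hk))) ?_ ?_ h
  · intro X X' p d k₁ d' hk₁ hd' w h X₂ Y₂ k e₂ d₂ hk he he₂ hd₂ w₂
    have hkk := IsEmb.comp_mem _ _ hk hk₁
    refine ⟨p.snoc (GMove.emb (k ≫ k₁) hkk), Elim.emb _ _ _ hkk he hd₂ ?_ h,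
      seesLe_emb_comp p hk₁ hk hkk⟩
    rw [← Category.assoc, w₂, Category.assoc, w, Category.assoc]
  · intro X X' p d m hm hmd ha h ih X₂ Y₂ k e₂ d₂ hk he he₂ hd₂ w₂
    -- The move happens over the atomic `Y₁`. If `e₂` is an isomorphism, so is `k`, and `k ≫ m` can
    -- be played after the composite embedding; otherwise `Y₂` and `X₂` have no vertices and `k`
    -- absorbs `m`.
    rcases he₂.isIso_or_isEmpty ha with hi | hV
    · have hki : IsIso k := hd₂.isIso_of_square hmd hk w₂
      have hkm : IsMove (k ≫ m) := hm.iso_comp k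
      have h1 : d₂ = (k ≫ m) ≫ d ≫ inv e₂ := by
        rw [← cancel_mono e₂, w₂]
        simp
      exact ⟨p.snoc (GMove.move (k ≫ m) hkm),
        Elim.moveId _ _ hkm hd₂ h1 (isAtomic_of_iso e₂ ha) (h.emb_iso e₂ he),
        seesLe_iso_comp_move p hm hk hkm⟩
    · have hX₂ : IsEmpty X₂.V := ⟨fun v => hV.elim (d₂.vert v)⟩
      obtain ⟨hkm, hpb⟩ := absorb_move hX₂ hk hmd (by
        intro e
        rw [← w₂]
        obtain ⟨e', h1⟩ := hd₂.edge_of_isEmpty hX₂ e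
        obtain ⟨e'', h2⟩ := he₂.2 e'
        exact ⟨e'', comp_edge_inl h1 h2⟩)
      obtain ⟨p', h1, h2⟩ := ih (k ≫ m) e₂ d₂ hkm he he₂ hd₂ (by rw [w₂, Category.assoc])
      exact ⟨p', h1, h2.trans (seesLe_emb_move p hm hk hkm hpb)⟩

/-- Composition of embeddings in the lower play. -/
theorem Elim.exists_comp_emb {U X Y₀ Y₁ Y₂ : Hypersequent} {p : Play U X} {q : Play U Y₀}
    {e₁ : Y₁ ⟶ Y₀} {he₁ : IsEmb e₁} {e₂ : Y₂ ⟶ Y₁} {he₂ : IsEmb e₂} {d : X ⟶ Y₂}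
    (he : IsEmb (e₂ ≫ e₁))
    (h : Elim p ((q.snoc (GMove.emb e₁ he₁)).snoc (GMove.emb e₂ he₂)) d) :
    ∃ p' : Play U X, Elim p' (q.snoc (GMove.emb (e₂ ≫ e₁) he)) d ∧ SeesLe p' p := by
  refine Elim.snoc_emb_rec (C := fun {X} p d =>
    ∃ p' : Play U X, Elim p' (q.snoc (GMove.emb (e₂ ≫ e₁) he)) d ∧ SeesLe p' p) ?_ ?_ h
  · intro X X' p d k d' hk hd' w h
    exact h.exists_comp_emb_aux k e₂ d' hk he he₂ hd' w
  · intro X X' p d m hm hd ha h ⟨p', h1, h2⟩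
    exact ⟨p'.snoc (GMove.move m hm), Elim.moveId m _ hm hd rfl ha h1, h2.snoc _⟩

/-- Decomposition of embeddings in the lower play. -/
theorem Elim.exists_decomp_emb {U X Y₀ Y₁ Y₂ : Hypersequent} {p : Play U X} {q : Play U Y₀}
    {e₁ : Y₁ ⟶ Y₀} (he₁ : IsEmb e₁) {e₂ : Y₂ ⟶ Y₁} (he₂ : IsEmb e₂) {d : X ⟶ Y₂}
    {he : IsEmb (e₂ ≫ e₁)} (h : Elim p (q.snoc (GMove.emb (e₂ ≫ e₁) he)) d) :
    ∃ p' : Play U X, Elim p' ((q.snoc (GMove.emb e₁ he₁)).snoc (GMove.emb e₂ he₂)) d ∧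
      SeesLe p' p := by
  refine Elim.snoc_emb_rec (C := fun {X} p d =>
    ∃ p' : Play U X, Elim p' ((q.snoc (GMove.emb e₁ he₁)).snoc (GMove.emb e₂ he₂)) d ∧
      SeesLe p' p) ?_ ?_ h
  · intro X X' p d k d' hk hd' w h
    -- The intermediate stage of the cable is the part of `X` over `Y₁`, through which `k` factors.
    obtain ⟨Z, K, d₁, hK, hpb, -⟩ := he₁.exists_pullback d
    let K' : X' ⟶ Z := hpb.lift k (d' ≫ e₂) (by rw [← w, Category.assoc])
    have h1 : K' ≫ K = k := hpb.lift_fst _ _ _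
    have h2 : K' ≫ d₁ = d' ≫ e₂ := hpb.lift_snd _ _ _
    have hK' : IsEmb K' := hK.of_comp (by rw [h1]; exact hk)
    have hd₁ : IsCutOnly d₁ := h.isCutOnly.restrict hpb he₁
    refine ⟨(p.snoc (GMove.emb K hK)).snoc (GMove.emb K' hK'),
      Elim.emb _ _ _ hK' he₂ hd' h2.symm (Elim.emb _ _ _ hK he₁ hd₁ hpb.w.symm h), ?_⟩
    clear_value K'
    subst h1
    exact seesLe_comp_emb p hK hK' hk
  · intro X X' p d m hm hd ha h ⟨p', h1, h2⟩
    exact ⟨p'.snoc (GMove.move m hm), Elim.moveId m _ hm hd rfl ha h1, h2.snoc _⟩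

/-- Insertion of isomorphisms around a move in the lower play. -/
theorem Elim.exists_insert_iso {U X Y Y' Z Z' : Hypersequent} {p : Play U X} {q : Play U Y}
    {m' : Z' ⟶ Y'} (hm' : IsMove m') {j : Z ⟶ Z'} (hj : IsEmb j) {i : Y' ⟶ Y} (hi : IsEmb i)
    [IsIso j] [IsIso i] {m : Z ⟶ Y} {hm : IsMove m} (hmm : m = j ≫ m' ≫ i) {d : X ⟶ Z}
    (h : Elim p (q.snoc (GMove.move m hm)) d) :
    ∃ p' : Play U X, Elim p' (((q.snoc (GMove.emb i hi)).snoc (GMove.move m' hm')).snoc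
      (GMove.emb j hj)) d ∧ SeesLe p' p := by
  refine Elim.snoc_move_rec (C := fun {X} p d => ∃ p' : Play U X,
    Elim p' (((q.snoc (GMove.emb i hi)).snoc (GMove.move m' hm')).snoc
      (GMove.emb j hj)) d ∧ SeesLe p' p) ?_ ?_ h
  · intro X X' p d k d' hk hc hd' w ha h₀
    subst hmm
    -- The cable plays identities over the isomorphisms, which are accounted for in the tops `d ≫
    -- inv i` and `d' ≫ j`.
    refine ⟨((p.snoc (GMove.emb (𝟙 X) (IsEmb.id_mem _))).snoc (GMove.move k hk)).snoc
      (GMove.emb (𝟙 X') (IsEmb.id_mem _)), ?_, ?_⟩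
    · refine Elim.emb _ _ d' _ hj hd' (by simp) ?_ (d := d' ≫ j)
      refine Elim.move _ _ _ hk hm' (fun h => hc ?_) (hd'.comp_iso j) ?_ (isAtomic_of_iso i ha) ?_
        (d := d ≫ inv i)
      · rw [← Category.assoc]
        exact (properRestrictions.iso_comp h j).comp_iso i
      · rw [← cancel_mono i]
        simpa using w
      · exact Elim.emb _ _ _ _ hi (h₀.isCutOnly.comp_iso _) (by simp) h₀
    · exact (seesLe_emb_id _ _).trans ((seesLe_emb_id p _).snoc _)
  · intro X X' p d m hm hd ha h ⟨p', h1, h2⟩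
    exact ⟨p'.snoc (GMove.move m hm), Elim.moveId m _ hm hd rfl ha h1, h2.snoc _⟩

/-- Removal of a final isomorphism in the lower play. -/
theorem Elim.exists_remove_iso {U X Y Y' : Hypersequent} {p : Play U X} {q : Play U Y}
    {i : Y' ⟶ Y} {hi : IsEmb i} [IsIso i] {d : X ⟶ Y'}
    (h : Elim p (q.snoc (GMove.emb i hi)) d) :
    ∃ (X₀ : Hypersequent) (p' : Play U X₀) (k : X ⟶ X₀) (_ : IsIso k),
      Elim p' q (inv k ≫ d ≫ i) ∧ SeesLe (p'.snoc (GMove.emb k (IsEmb.of_isIso k))) p := by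
  refine Elim.snoc_emb_rec (C := fun {X} p d =>
    ∃ (X₀ : Hypersequent) (p' : Play U X₀) (k : X ⟶ X₀) (_ : IsIso k),
      Elim p' q (inv k ≫ d ≫ i) ∧ SeesLe (p'.snoc (GMove.emb k (IsEmb.of_isIso k))) p) ?_ ?_ h
  · intro X X' p d k d' hk hd' w h
    have hki : IsIso k := hd'.isIso_of_square h.isCutOnly hk w
    refine ⟨X, p, k, hki, ?_, SeesLe.refl _⟩
    rw [w, IsIso.inv_hom_id_assoc]
    exact h
  · intro X X' p d m hm hd ha h ⟨X₀, p', k, hk, h1, h2⟩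
    have hmk : IsMove (m ≫ k) := hm.comp_iso k
    -- The disappearing move swallows the isomorphism `k` that preceded it, so that an identity
    -- remains.
    refine ⟨X', p'.snoc (GMove.move (m ≫ k) hmk), 𝟙 X', inferInstance, ?_, ?_⟩
    · refine Elim.moveId _ _ hmk ?_ ?_ (isAtomic_of_iso (inv i) ha) h1
      · simpa using hd.comp_iso i
      · simp
    · exact (seesLe_emb_id _ _).trans
        ((seesLe_move_comp_iso p' hm (IsEmb.of_isIso k) hmk).trans (h2.snoc _))

theorem Elim.exists_move_comp_iso {U X Y Y' Z : Hypersequent} {p : Play U X} {q : Play U Y}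
    {i : Y' ⟶ Y} {hi : IsEmb i} [IsIso i] {m : Z ⟶ Y'} {hm : IsMove m} (hmi : IsMove (m ≫ i))
    {d : X ⟶ Z} (h : Elim p ((q.snoc (GMove.emb i hi)).snoc (GMove.move m hm)) d) :
    ∃ p' : Play U X, Elim p' (q.snoc (GMove.move (m ≫ i) hmi)) d ∧ SeesLe p' p := by
  refine Elim.snoc_move_rec (C := fun {X} p d =>
    ∃ p' : Play U X, Elim p' (q.snoc (GMove.move (m ≫ i) hmi)) d ∧ SeesLe p' p) ?_ ?_ h
  · intro X X' p d n d' hn hc hd' w ha h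
    obtain ⟨X₀, p', k, hk, h1, h2⟩ := h.exists_remove_iso
    have hnk : IsMove (n ≫ k) := hn.comp_iso k
    refine ⟨p'.snoc (GMove.move (n ≫ k) hnk), ?_, ?_⟩
    · refine Elim.move _ _ d' hnk hmi (fun h => hc ?_) hd' ?_ (isAtomic_of_iso (inv i) ha) h1
      · simpa [IsCutMove] using properRestrictions.comp_iso h (inv i)
      · rw [← Category.assoc, w]
        simp
    · exact (seesLe_move_comp_iso p' hn (IsEmb.of_isIso k) hnk).trans (h2.snoc _)
  · intro X X' p d m hm hd ha h ⟨p', h1, h2⟩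
    exact ⟨p'.snoc (GMove.move m hm), Elim.moveId m _ hm hd rfl ha h1, h2.snoc _⟩

theorem Elim.exists_iso_comp_move {U X Y Z Z' : Hypersequent} {p : Play U X} {q : Play U Y}
    {m : Z ⟶ Y} {hm : IsMove m} {j : Z' ⟶ Z} {hj : IsEmb j} [IsIso j] (hjm : IsMove (j ≫ m))
    {d : X ⟶ Z'} (h : Elim p ((q.snoc (GMove.move m hm)).snoc (GMove.emb j hj)) d) :
    ∃ p' : Play U X, Elim p' (q.snoc (GMove.move (j ≫ m) hjm)) d ∧ SeesLe p' p := by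
  refine Elim.snoc_emb_rec (C := fun {X} p d =>
    ∃ p' : Play U X, Elim p' (q.snoc (GMove.move (j ≫ m) hjm)) d ∧ SeesLe p' p) ?_ ?_ h
  · intro X X' p d k d' hk hd' w h
    have hki : IsIso k := hd'.isIso_of_square h.isCutOnly hk w
    revert k d'
    refine Elim.snoc_move_rec (C := fun {X} p d =>
      ∀ (k : X' ⟶ X) (d' : X' ⟶ Z') (hk : IsEmb k), IsCutOnly d' → d' ≫ j = k ≫ d → IsIso k →
      ∃ p' : Play U X', Elim p' (q.snoc (GMove.move (j ≫ m) hjm)) d' ∧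
        SeesLe p' (p.snoc (GMove.emb k hk))) ?_ ?_ h
    · intro X X₁ p d n d₁ hn hc hd₁ w₁ ha h k d' hk hd' w hki
      have hkn : IsMove (k ≫ n) := hn.iso_comp k
      refine ⟨p.snoc (GMove.move (k ≫ n) hkn),
        Elim.move _ _ d' hkn hjm (fun h => hc ?_) hd' ?_ ha h, seesLe_iso_comp_move p hn hk hkn⟩
      · simpa [IsCutMove] using properRestrictions.iso_comp h (inv j)
      · rw [← Category.assoc, w, Category.assoc, w₁, Category.assoc]
    · intro X X₁ p d n hn hd₁ ha h _ k d' hk hd' w hki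
      have hkn : IsMove (k ≫ n) := hn.iso_comp k
      refine ⟨p.snoc (GMove.move (k ≫ n) hkn),
        Elim.moveId _ d' hkn hd' ?_ (isAtomic_of_iso j ha) (h.move_iso j hjm),
        seesLe_iso_comp_move p hn hk hkn⟩
      rw [← cancel_mono j, w]
      simp
  · intro X X' p d m hm hd ha h ⟨p', h1, h2⟩
    exact ⟨p'.snoc (GMove.move m hm), Elim.moveId m _ hm hd rfl ha h1, h2.snoc _⟩

/-! ### Cut elimination preserves strategies -/

/-- Successive embeddings of a lower play can be merged by merging those of the cable, so the
descent is already closed. -/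
theorem cutElim_eq_elimSet {U : Hypersequent} (P : PlaySet U) : cutElim U P = elimSet P := by
  funext Y
  ext q
  change Closure (descent (𝟙 U) (cables (𝟙 U) P)) q ↔ _
  rw [descent_cables_eq]
  constructor
  · intro h
    induction h with
    | base p hp => exact hp
    | step t h h' hh hh' t' hc ih => exact elimSet_append_of (Elim.exists_comp_emb _) ih
  · exact Closure.base q

theorem Elim.isThread {U X Y : Hypersequent} {p : Play U X} {q : Play U Y} {d : X ⟶ Y}
    (h : Elim p q d) : q.IsThread := by
  induction h with
  | nil => trivial
  | move m m' d' hm hm' hcut hd' w ha h ih => exact ⟨ih, ha⟩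
  | emb k k' d' hk hk' hd' w h ih => exact ih
  | moveId m d' hm hd' w ha h ih => exact ih

theorem Elim.isCutFree {U X Y : Hypersequent} {p : Play U X} {q : Play U Y} {d : X ⟶ Y}
    (h : Elim p q d) : q.IsCutFree := by
  induction h with
  | nil => trivial
  | move m m' d' hm hm' hcut hd' w ha h ih => exact ⟨ih, hcut⟩
  | emb k k' d' hk hk' hd' w h ih => exact ih
  | moveId m d' hm hd' w ha h ih => exact ih

theorem elimSet_comp {U X Y Z W : Hypersequent} {P : PlaySet U} (t : Play U Y) (h : Z ⟶ Y)
    (h' : X ⟶ Z) (hh : IsEmb h) (hh' : IsEmb h') (hhh : IsEmb (h' ≫ h)) (t' : Play X W) :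
    ((t.snoc (GMove.emb h hh)).snoc (GMove.emb h' hh')).append t' ∈ elimSet P W ↔
      (t.snoc (GMove.emb (h' ≫ h) hhh)).append t' ∈ elimSet P W :=
  ⟨elimSet_append_of (Elim.exists_comp_emb _), elimSet_append_of (Elim.exists_decomp_emb _ _)⟩

theorem isStrategy_elimSet {U : Hypersequent} {P : PlaySet U} (hP : IsStrategy P) :
    IsStrategy (elimSet P) where
  isThread q hq := by
    obtain ⟨X, p, d, h, -⟩ := hq
    exact h.isThread
  prefix_closed q q' hq := by
    obtain ⟨X, p, d, h, ht⟩ := hq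
    obtain ⟨X₀, p₀, p₁, d₀, rfl, h2, -⟩ := h.exists_of_append q q' rfl
    exact ⟨X₀, p₀, d₀, h2, threadsOf_of_append hP ht⟩
  mandatory q f hf hq := by
    obtain ⟨X, p, d, h, ht⟩ := hq
    cases f with
    | move m hm =>
      obtain ⟨ha, hp⟩ := hf
      -- The cable answers a passive move by its lift along the top `d`; the threads added are all
      -- mandatory in `P`.
      obtain ⟨X', n, d', h1, h2, h3⟩ := h.isCutOnly.exists_lift hp
      exact ⟨X', p.snoc (GMove.move n h1.1), d',
        Elim.move n m d' h1.1 hm hp.not_isCutMove h2 h3 ha h,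
        threadsOf_snoc_passive hP ht h1.1 h1⟩
    | emb k hk =>
      obtain ⟨X', i, d', hi, hpb, -⟩ := hk.exists_pullback d
      exact ⟨X', p.snoc (GMove.emb i hi), d',
        Elim.emb i k d' hi hk (h.isCutOnly.restrict hpb hk) hpb.w.symm h,
        fun Z => (threadsOf_snoc_emb i hi Z).trans (ht Z)⟩
  iso t m m' j i hj hi t' _ _ hji hii hk hm := by
    cases m with
    | move m h =>
      cases m' with
      | move m' h' =>
        simp only [GMove.hom] at hm
        constructor
        · exact elimSet_append_of (Elim.exists_insert_iso h' hj hi hm)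
        · subst hm
          have h1 : IsMove (j ≫ m') := h'.iso_comp j
          intro h2
          -- The move absorbs first the isomorphism played after it, then the one played before it.
          have h3 := elimSet_append_of (Elim.exists_iso_comp_move h1) h2
          have h4 : IsMove ((j ≫ m') ≫ i) := h1.comp_iso i
          have h5 := elimSet_append_of (Elim.exists_move_comp_iso h4) h3
          simp only [Category.assoc] at h5
          exact h5
      | emb h h' => exact hk.elim
    | emb m h =>
      cases m' with
      | move m' h' => exact hk.elim
      | emb m' h' =>
        simp only [GMove.hom] at hm
        subst hm
        have h1 : IsEmb (m' ≫ i) := IsEmb.comp_mem _ _ h' hi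
        have h2 := elimSet_comp (P := P) t i m' hi h' h1
          ((Play.nil.snoc (GMove.emb j hj)).append t')
        simp only [← Play.append_assoc] at h2
        exact (elimSet_comp t _ _ h1 hj h t').symm.trans h2.symm
  comp t h h' hh hh' t' _ _ := elimSet_comp t h h' hh hh' _ t'

/-! ### Plays made of embeddings -/

/-- The play consists of embeddings. -/
def Play.IsEmbs {U : Hypersequent} : ∀ {X : Hypersequent}, Play U X → Prop
  | _, nil => True
  | _, snoc _ (GMove.move _ _) => False
  | _, snoc t (GMove.emb _ _) => IsEmbs t

theorem Play.IsEmbs.isEmb_geom {U X : Hypersequent} {t : Play U X} (h : t.IsEmbs) :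
    IsEmb t.geom := by
  induction t with
  | nil => exact IsEmb.id_mem U
  | snoc t f ih =>
    cases f with
    | move m hm => exact h.elim
    | emb k hk => exact IsEmb.comp_mem _ _ hk (ih h)

theorem Play.IsEmbs.isThread {U X : Hypersequent} {t : Play U X} (h : t.IsEmbs) :
    t.IsThread := by
  induction t with
  | nil => trivial
  | snoc t f ih =>
    cases f with
    | move m hm => exact h.elim
    | emb k hk => exact ih h

theorem Play.isEmbs_append {U X Y : Hypersequent} (t : Play U X) (t' : Play X Y) :
    (t.append t').IsEmbs ↔ t.IsEmbs ∧ t'.IsEmbs := by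
  induction t' with
  | nil => simp [Play.append, Play.IsEmbs]
  | snoc r f ih => cases f <;> simp [Play.append, Play.IsEmbs, ih]

theorem Play.geom_append {U X Y : Hypersequent} (t : Play U X) (t' : Play X Y) :
    (t.append t').geom = t'.geom ≫ t.geom := by
  induction t' with
  | nil => simp [Play.append, Play.geom]
  | snoc r f ih => simp [Play.append, Play.geom, ih]

theorem geom_embPlay {V U : Hypersequent} (h : V ⟶ U) (hh : IsEmb h) :
    (embPlay h hh).geom = h := by
  simp [embPlay, Play.geom, GMove.hom]

theorem IsStrategy.comp_iff {U : Hypersequent} {P : PlaySet U} (hP : IsStrategy P)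
    {X Y Z W : Hypersequent} (t : Play U Y) {h : Z ⟶ Y} {h' : X ⟶ Z} (hh : IsEmb h)
    (hh' : IsEmb h') (hhh : IsEmb (h' ≫ h)) (t' : Play X W) :
    (((t.snoc (GMove.emb h hh)).snoc (GMove.emb h' hh')).append t' ∈ P W ↔
      (t.snoc (GMove.emb (h' ≫ h) hhh)).append t' ∈ P W) := by
  by_cases ht : t.IsThread ∧ t'.IsThread
  · exact hP.comp t h h' hh hh' t' ht.1 ht.2
  · exact ⟨fun h => absurd ((Play.isThread_append _ _).1 (hP.isThread _ h)) ht,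
      fun h => absurd ((Play.isThread_append _ _).1 (hP.isThread _ h)) ht⟩

/-- For a strategy a run of embeddings counts only through its composite; the empty run is handled
by stability under isomorphism. -/
theorem IsStrategy.embs_append_iff {U : Hypersequent} {P : PlaySet U} (hP : IsStrategy P)
    {X W : Hypersequent} {e : Play U X} (he : e.IsEmbs) (t : Play X W) :
    e.append t ∈ P W ↔ (embPlay e.geom he.isEmb_geom).append t ∈ P W := by
  induction e with
  | nil =>
    rw [Play.nil_append]
    exact (hP.id_append t).symm
  | snoc e f ih =>
    cases f with
    | move m hm => exact he.elim
    | emb k hk =>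
      have h1 := ih he ((embPlay k hk).append t)
      rw [← Play.append_assoc, ← Play.append_assoc] at h1
      exact h1.trans (hP.comp_iff Play.nil _ hk _ t)

theorem IsStrategy.embs_mem {U : Hypersequent} {P : PlaySet U} (hP : IsStrategy P)
    (h : Play.nil ∈ P U) {X : Hypersequent} {e : Play U X} (he : e.IsEmbs) : e ∈ P X := by
  induction e with
  | nil => exact h
  | snoc e f ih =>
    cases f with
    | move m hm => exact he.elim
    | emb k hk => exact hP.mandatory e (GMove.emb k hk) trivial (ih he)

/-! ### Naturality of cut elimination -/

theorem Sees.of_nil {U X : Hypersequent} {t : Play U X} {j : X ⟶ U}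
    (h : Sees t Play.nil j) : t.IsEmbs ∧ t.geom = j := by
  induction t with
  | nil =>
    cases h
    exact ⟨trivial, rfl⟩
  | snoc t f ih =>
    cases h with
    | embLeft k hk h =>
      obtain ⟨h1, h2⟩ := ih h
      exact ⟨h1, by rw [← h2]; rfl⟩

theorem Sees.embPlay_append {U V X Y : Hypersequent} {h : V ⟶ U} (hh : IsEmb h) {t : Play V X}
    {p : Play V Y} {i : X ⟶ Y} (hs : Sees t p i) :
    Sees ((embPlay h hh).append t) ((embPlay h hh).append p) i := by
  induction hs with
  | nil => exact Sees.embRight h _ hh (IsEmb.id_mem _) (by simp) (Sees.embLeft h hh Sees.nil)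
  | move m' m i hm' hm hi hpb h ih => exact Sees.move m' m i hm' hm hi hpb ih
  | moveRight m i hm hi hpb h ih => exact Sees.moveRight m i hm hi hpb ih
  | embRight k i hk hi w h ih => exact Sees.embRight k i hk hi w ih
  | embLeft k hk h ih => exact Sees.embLeft k hk ih

/-- The threads which see a play that begins with an embedding. -/
theorem Sees.of_embPlay_append {U V Y : Hypersequent} {h : V ⟶ U} {hh : IsEmb h}
    {p : Play V Y} : ∀ {X : Hypersequent} {t : Play U X} {i : X ⟶ Y},
    Sees t ((embPlay h hh).append p) i → ∃ (W : Hypersequent) (e : Play U W) (g : W ⟶ V)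
      (hg : IsEmb g) (t' : Play W X), e.IsEmbs ∧ t = e.append t' ∧ e.geom = g ≫ h ∧
        Sees ((embPlay g hg).append t') p i := by
  induction p with
  | nil =>
    intro X t i hs
    obtain ⟨hi, hs⟩ := Sees.snoc_emb_iff.1 hs
    obtain ⟨h1, h2⟩ := hs.of_nil
    refine ⟨X, t, i, hi, Play.nil, h1, rfl, h2, ?_⟩
    have h3 := Sees.embLeft i hi (Sees.nil (U := V))
    rw [Category.comp_id] at h3
    exact h3
  | @snoc Y Y' p f ih =>
    intro X t i hs
    cases f with
    | emb k hk =>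
      obtain ⟨hi, hs⟩ := Sees.snoc_emb_iff.1 hs
      obtain ⟨W, e, g, hg, t', h1, h2, h3, h4⟩ := ih hs
      exact ⟨W, e, g, hg, t', h1, h2, h3, Sees.snoc_emb_iff.2 ⟨hi, h4⟩⟩
    | move m hm =>
      refine Sees.snoc_move_rec (C := fun {X} t i => ∃ (W : Hypersequent) (e : Play U W)
        (g : W ⟶ V) (hg : IsEmb g) (t' : Play W X), e.IsEmbs ∧ t = e.append t' ∧
        e.geom = g ≫ h ∧
        Sees ((embPlay g hg).append t') (p.snoc (GMove.move m hm)) i) ?_ ?_ ?_ hs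
      · intro X X' t j m' i hm' hi hpb hs
        obtain ⟨W, e, g, hg, t', h1, rfl, h3, h4⟩ := ih hs
        exact ⟨W, e, g, hg, t'.snoc (GMove.move m' hm'), h1, rfl, h3,
          Sees.move m' m i hm' hm hi hpb h4⟩
      · intro X t j i hi hpb hs
        obtain ⟨W, e, g, hg, t', h1, rfl, h3, h4⟩ := ih hs
        exact ⟨W, e, g, hg, t', h1, rfl, h3, Sees.moveRight m i hm hi hpb h4⟩
      · rintro X X' t i k hk ⟨W, e, g, hg, t', h1, rfl, h3, h4⟩
        exact ⟨W, e, g, hg, t'.snoc (GMove.emb k hk), h1, rfl, h3, Sees.embLeft k hk h4⟩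

theorem Elim.append {U V : Hypersequent} {a b : Play U V} (hab : Elim a b (𝟙 V))
    {X Y : Hypersequent} {p : Play V X} {q : Play V Y} {d : X ⟶ Y} (h : Elim p q d) :
    Elim (a.append p) (b.append q) d := by
  induction h with
  | nil => exact hab
  | move m m' d' hm hm' hcut hd' w ha h ih => exact Elim.move m m' d' hm hm' hcut hd' w ha ih
  | emb k k' d' hk hk' hd' w h ih => exact Elim.emb k k' d' hk hk' hd' w ih
  | moveId m d' hm hd' w ha h ih => exact Elim.moveId m d' hm hd' w ha ih

/-- The cable on `V` is prefixed by `h`. A thread of the result starts with embeddings that compose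
to some `g ≫ h`, and continues as a thread of the original cable does after `g`, so it is in `P` up
to composition of embeddings. -/
theorem embPlay_append_mem_elimSet {U V : Hypersequent} {P : PlaySet U} (hP : IsStrategy P)
    (h : V ⟶ U) (hh : IsEmb h) {Y : Hypersequent} {q : Play V Y}
    (hq : q ∈ elimSet (P.restrict (embPlay h hh)) Y) :
    (embPlay h hh).append q ∈ elimSet P Y := by
  obtain ⟨X, p, d, hp, ht⟩ := hq
  have h1 : Elim (embPlay h hh) (embPlay h hh) (𝟙 V) :=
    Elim.emb h h (𝟙 V) hh hh (IsCutOnly.iso _ inferInstance) (by simp) Elim.nil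
  refine ⟨X, (embPlay h hh).append p, d, h1.append hp, ?_⟩
  rintro Z t ⟨htt, i, hi⟩
  obtain ⟨W, e, g, hg, t', h2, rfl, h3, h4⟩ := hi.of_embPlay_append
  have h5 : (embPlay g hg).append t' ∈ threadsOf p Z :=
    ⟨(Play.isThread_append _ _).2 ⟨trivial, ((Play.isThread_append _ _).1 htt).2⟩, i, h4⟩
  have h6 : (embPlay h hh).append ((embPlay g hg).append t') ∈ P Z := ht Z h5
  rw [← Play.append_assoc] at h6
  have h7 := (hP.comp_iff Play.nil hh hg (IsEmb.comp_mem _ _ hg hh) t').1 h6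
  rw [hP.embs_append_iff h2]
  simp only [h3]
  exact h7

/-- What the cable plays over the empty play consists of disappearing moves, possible only if `U` is
atomic. As `h` is not an isomorphism, `V` then has no vertices and `k` absorbs these moves one by
one. When none is left, `k` is `d' ≫ h` with `d'` an isomorphism. -/
theorem Elim.exists_restrict_aux {U V X : Hypersequent} {h : V ⟶ U} (hh : IsEmb h)
    (hni : ¬ IsIso h) {a : Play U X} : ∀ {d : X ⟶ U}, Elim a Play.nil d →
    ∀ {X' : Hypersequent} (k : X' ⟶ X) (d' : X' ⟶ V) (hk : IsEmb k), IsCutOnly d' →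
      d' ≫ h = k ≫ d → ∃ p : Play V X', Elim p (embPlay (𝟙 V) (IsEmb.id_mem V)) d' ∧
        SeesLe ((embPlay h hh).append p) (a.snoc (GMove.emb k hk)) := by
  induction a with
  | nil =>
    intro d hd X' k d' hk hd' w
    cases hd
    rw [Category.comp_id] at w
    subst w
    have h1 : IsEmb d' := hh.of_comp hk
    have := hd'.isIso_of_isEmb h1
    refine ⟨embPlay d' h1, Elim.emb d' (𝟙 V) d' h1 _ hd' rfl Elim.nil, ?_⟩
    exact seesLe_comp_emb Play.nil hh h1 hk
  | snoc a f ih =>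
    intro d hd X' k d' hk hd' w
    cases hd with
    | moveId m _ hm hmd w₁ ha hd =>
      subst w₁
      have hV := (hh.isIso_or_isEmpty ha).resolve_left hni
      have hX' : IsEmpty X'.V := ⟨fun v => hV.elim (d'.vert v)⟩
      obtain ⟨hkm, hpb⟩ := absorb_move hX' hk hmd (by
        intro e
        rw [← w]
        obtain ⟨e', h1⟩ := hd'.edge_of_isEmpty hX' e
        obtain ⟨e'', h2⟩ := hh.2 e'
        exact ⟨e'', comp_edge_inl h1 h2⟩)
      obtain ⟨p, h1, h2⟩ := ih hd (k ≫ m) d' hkm hd' (by rw [w, Category.assoc])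
      exact ⟨p, h1, h2.trans (seesLe_emb_move a hm hk hkm hpb)⟩

theorem Elim.exists_restrict {U V X : Hypersequent} {h : V ⟶ U} (hh : IsEmb h)
    (hni : ¬ IsIso h) {p : Play U X} {d : X ⟶ V} (hp : Elim p (embPlay h hh) d) :
    ∃ p' : Play V X, Elim p' (embPlay (𝟙 V) (IsEmb.id_mem V)) d ∧
      SeesLe ((embPlay h hh).append p') p := by
  refine Elim.snoc_emb_rec (C := fun {X} p d =>
    ∃ p' : Play V X, Elim p' (embPlay (𝟙 V) (IsEmb.id_mem V)) d ∧
      SeesLe ((embPlay h hh).append p') p) ?_ ?_ hp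
  · intro X X' p d k d' hk hd' w hp
    exact Elim.exists_restrict_aux hh hni hp k d' hk hd' w
  · intro X X' p d m hm hd ha hp ⟨p', h1, h2⟩
    exact ⟨p'.snoc (GMove.move m hm), Elim.moveId m _ hm hd rfl ha h1, h2.snoc _⟩

theorem elimSet_mono {U : Hypersequent} {P Q : PlaySet U} (h : ∀ X, P X ⊆ Q X)
    (Y : Hypersequent) : elimSet P Y ⊆ elimSet Q Y :=
  fun _ ⟨X, p, d, hp, ht⟩ => ⟨X, p, d, hp, fun Z => (ht Z).trans (h Z)⟩

/-- When `h` is an isomorphism onto an atomic `U`, the moves made before it need not be absorbable,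
hence the separate treatment through the inverse of `h`. -/
theorem mem_elimSet_of_embPlay_append {U V : Hypersequent} {P : PlaySet U} (hP : IsStrategy P)
    (h : V ⟶ U) (hh : IsEmb h) {Y : Hypersequent} {q : Play V Y}
    (hq : (embPlay h hh).append q ∈ elimSet P Y) :
    q ∈ elimSet (P.restrict (embPlay h hh)) Y := by
  have hP' : IsStrategy (P.restrict (embPlay h hh)) := hP.restrict _ trivial
  have hE := isStrategy_elimSet hP'
  -- Both cases produce the play `q` preceded by an identity embedding.
  rw [← hE.id_append]
  by_cases hi : IsIso h
  -- Restricting `P` to `V` and back gives `P` again, so the converse inclusion follows from the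
  -- direct one applied to `inv h`.
  · have h1 : IsEmb (inv h) := IsEmb.of_isIso _
    have h2 : ∀ X, P X ⊆ (P.restrict (embPlay h hh)).restrict (embPlay (inv h) h1) X := by
      intro X t ht
      change (embPlay h hh).append ((embPlay (inv h) h1).append t) ∈ P X
      rw [← Play.append_assoc]
      refine (hP.comp_iff Play.nil hh h1 (IsEmb.comp_mem _ _ h1 hh) t).2 ?_
      simp only [IsIso.inv_hom_id]
      exact (hP.id_append t).2 ht
    have h3 := embPlay_append_mem_elimSet hP' (inv h) h1 (elimSet_mono h2 Y hq)
    rw [← Play.append_assoc] at h3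
    have h4 := (hE.comp_iff Play.nil h1 hh (IsEmb.comp_mem _ _ hh h1) q).1 h3
    simp only [IsIso.hom_inv_id] at h4
    exact h4
  · obtain ⟨X, p, d, hp, ht⟩ := hq
    obtain ⟨X₀, p₀, p₁, d₀, rfl, h2, h3⟩ := hp.exists_of_append _ q rfl
    obtain ⟨p', h4, h5⟩ := h2.exists_restrict hh hi
    refine ⟨X, p'.append p₁, d, h3 _ _ h4, ?_⟩
    rintro Z t ⟨htt, i, hti⟩
    refine ht Z ⟨(Play.isThread_append _ _).2 ⟨trivial, htt⟩, i, h5.append p₁ _ _ ?_⟩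
    rw [Play.append_assoc]
    exact hti.embPlay_append hh

/-- Cut elimination of a strategy. -/
def cutElimStrategy {U : Hypersequent} (P : Strategy U) : Strategy U where
  plays := cutElim U P.plays
  isStrategy := by
    rw [cutElim_eq_elimSet]
    exact isStrategy_elimSet P.isStrategy

theorem isCutFree_cutElimStrategy {U : Hypersequent} (P : Strategy U) :
    (cutElimStrategy P).IsCutFree := by
  intro X q hq
  change q ∈ cutElim U P.plays X at hq
  rw [cutElim_eq_elimSet] at hq
  obtain ⟨X, p, d, h, -⟩ := hq
  exact h.isCutFree

theorem cutElimStrategy_restrict {U V : Hypersequent} (P : Strategy U) (h : V ⟶ U)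
    (hh : IsEmb h) : cutElimStrategy (P.restrict h hh) = (cutElimStrategy P).restrict h hh := by
  ext X q
  change q ∈ cutElim V (P.plays.restrict (embPlay h hh)) X ↔
    (embPlay h hh).append q ∈ cutElim U P.plays X
  rw [cutElim_eq_elimSet, cutElim_eq_elimSet]
  exact ⟨embPlay_append_mem_elimSet P.isStrategy h hh,
    mem_elimSet_of_embPlay_append P.isStrategy h hh⟩

/-! ### Gluing strategies -/

theorem Play.append_eq_append {U V V' W : Hypersequent} {a : Play U V} {b : Play V W}
    {c : Play U V'} {d : Play V' W} (h : a.append b = c.append d) :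
    (∃ z : Play V' V, a = c.append z ∧ z.append b = d) ∨
      ∃ z : Play V V', c = a.append z ∧ b = z.append d := by
  induction b with
  | nil => exact Or.inl ⟨d, h, rfl⟩
  | snoc b f ih =>
    cases d with
    | nil => exact Or.inr ⟨b.snoc f, h.symm, rfl⟩
    | snoc d g =>
      simp only [append, snoc.injEq] at h
      obtain ⟨rfl, h1, h2⟩ := h
      cases h2
      rcases ih (eq_of_heq h1) with ⟨z, rfl, rfl⟩ | ⟨z, rfl, rfl⟩
      · exact Or.inl ⟨z, rfl, rfl⟩
      · exact Or.inr ⟨z, rfl, rfl⟩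

theorem Play.IsEmbs.isCutFree {U X : Hypersequent} {t : Play U X} (h : t.IsEmbs) :
    t.IsCutFree := by
  induction t with
  | nil => trivial
  | snoc t f ih =>
    cases f with
    | move m hm => exact h.elim
    | emb k hk => exact ih h

/-- The codomain of the first move, if any, is atomic. This is what makes strategies local. -/
theorem Play.IsThread.isEmbs_or_exists {U X : Hypersequent} {t : Play U X} (h : t.IsThread) :
    t.IsEmbs ∨ ∃ (V : Hypersequent) (e : Play U V) (s : Play V X),
      e.IsEmbs ∧ V.IsAtomic ∧ t = e.append s := by
  induction t with
  | nil => exact Or.inl trivial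
  | snoc t f ih =>
    cases f with
    | move m hm =>
      rcases ih h.1 with h1 | ⟨V, e, s, h1, h2, rfl⟩
      · exact Or.inr ⟨_, t, Play.nil.snoc (GMove.move m hm), h1, h.2, rfl⟩
      · exact Or.inr ⟨V, e, s.snoc (GMove.move m hm), h1, h2, rfl⟩
    | emb k hk =>
      rcases ih h with h1 | ⟨V, e, s, h1, h2, rfl⟩
      · exact Or.inl h1
      · exact Or.inr ⟨V, e, s.snoc (GMove.emb k hk), h1, h2, rfl⟩

/-- A compatible family of strategies on a sieve of embeddings to `U` that contains the embeddings
of atomic hypersequents. -/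
structure StrategyFamily (U : Hypersequent) where
  mem : ∀ {V : Hypersequent}, (V ⟶ U) → Prop
  strat : ∀ {V : Hypersequent} (f : V ⟶ U), mem f → Strategy V
  isEmb : ∀ {V : Hypersequent} {f : V ⟶ U}, mem f → IsEmb f
  comp_mem : ∀ {V W : Hypersequent} {f : V ⟶ U} {k : W ⟶ V}, IsEmb k → mem f → mem (k ≫ f)
  strat_comp : ∀ {V W : Hypersequent} {f : V ⟶ U} {k : W ⟶ V} (hk : IsEmb k) (hf : mem f),
    strat (k ≫ f) (comp_mem hk hf) = (strat f hf).restrict k hk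
  mem_of_isAtomic : ∀ {V : Hypersequent} {f : V ⟶ U}, IsEmb f → V.IsAtomic → mem f
  exists_mem : ∃ (V : Hypersequent) (f : V ⟶ U), mem f

namespace StrategyFamily

variable {U : Hypersequent} (x : StrategyFamily U)

/-- The strategies of the family are nonempty. -/
def Nonempty : Prop := ∀ {V : Hypersequent} (f : V ⟶ U) (hf : x.mem f),
  Play.nil ∈ (x.strat f hf).plays V

/-- The glued set of plays. -/
def glue : PlaySet U := fun X => {p : Play U X | x.Nonempty ∧ (p.IsEmbs ∨
  ∃ (V : Hypersequent) (e : Play U V) (s : Play V X) (he : x.mem e.geom), e.IsEmbs ∧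
    p = e.append s ∧ s ∈ (x.strat e.geom he).plays X)}

variable {x}

/-- Compatibility of the family, for a run of embeddings. The composite is kept as an equation
because it arises in different forms. -/
theorem append_mem_strat_iff {V W X : Hypersequent} {f : V ⟶ U} (hf : x.mem f) {z : Play V W}
    (hz : z.IsEmbs) {g : W ⟶ U} (hg : x.mem g) (h : g = z.geom ≫ f) (s : Play W X) :
    z.append s ∈ (x.strat f hf).plays X ↔ s ∈ (x.strat g hg).plays X := by
  subst h
  rw [x.strat_comp hz.isEmb_geom hf]
  exact (x.strat f hf).isStrategy.embs_append_iff hz s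

/-- The empty hypersequent embeds into both `V` and any other member `W`, with the same composite to
`U`. Nonemptiness goes down by extension along embeddings and up by prefix-closure. -/
theorem nonempty_of_mem {V : Hypersequent} {f : V ⟶ U} (hf : x.mem f)
    (h : Play.nil ∈ (x.strat f hf).plays V) : x.Nonempty := by
  intro W g hg
  obtain ⟨Z, k, hk, hE, hV⟩ := exists_empty_emb V
  obtain ⟨k', hk'⟩ := exists_emb_of_isEmpty hE hV W
  have h1 : embPlay k hk ∈ (x.strat f hf).plays Z :=
    (x.strat f hf).isStrategy.mandatory Play.nil (GMove.emb k hk) trivial h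
  have h2 : k ≫ f = k' ≫ g := hom_ext_of_isEmpty hE hV _ _
  have h3 := (append_mem_strat_iff hf (z := embPlay k hk) trivial (x.comp_mem hk hf)
    (by rw [geom_embPlay]) Play.nil).1 h1
  have h4 := (append_mem_strat_iff hg (z := embPlay k' hk') trivial (x.comp_mem hk hf)
    (by rw [geom_embPlay, h2]) Play.nil).2 h3
  exact (x.strat g hg).isStrategy.prefix_closed Play.nil (embPlay k' hk') h4

/-- Two ways of cutting a play after initial embeddings are comparable, and they differ by a run of
embeddings, so compatibility makes membership independent of the cut. -/
theorem mem_glue_iff {V X : Hypersequent} {e : Play U V} (he : e.IsEmbs) (hm : x.mem e.geom)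
    (s : Play V X) : e.append s ∈ x.glue X ↔ s ∈ (x.strat e.geom hm).plays X := by
  constructor
  · rintro ⟨hn, h | ⟨W, e', s', hm', he', h, hs'⟩⟩
    · exact (x.strat e.geom hm).isStrategy.embs_mem (hn _ _) ((Play.isEmbs_append _ _).1 h).2
    · rcases Play.append_eq_append h with ⟨z, rfl, rfl⟩ | ⟨z, rfl, rfl⟩
      · have hz := ((Play.isEmbs_append _ _).1 he).2
        exact (append_mem_strat_iff hm' hz hm (Play.geom_append _ _) s).1 hs'
      · have hz := ((Play.isEmbs_append _ _).1 he').2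
        exact (append_mem_strat_iff hm hz hm' (Play.geom_append _ _) s').2 hs'
  · intro hs
    refine ⟨nonempty_of_mem hm ?_, Or.inr ⟨V, e, s, hm, he, rfl, hs⟩⟩
    exact (x.strat e.geom hm).isStrategy.prefix_closed Play.nil s (by rwa [Play.nil_append])

theorem isThread_of_mem_glue {X : Hypersequent} {p : Play U X} (h : p ∈ x.glue X) :
    p.IsThread := by
  rcases h with ⟨-, h | ⟨V, e, s, hm, he, rfl, hs⟩⟩
  · exact h.isThread
  · exact (Play.isThread_append _ _).2 ⟨he.isThread, (x.strat _ hm).isStrategy.isThread _ hs⟩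

/-- Here `e.geom` need not be in the sieve. Extending `e` up to the first atomic codomain brings it
there, and the member used then depends only on the composite. -/
theorem embs_append_mem_glue_congr {V X : Hypersequent} {e e' : Play U V} (he : e.IsEmbs)
    (he' : e'.IsEmbs) (h : e.geom = e'.geom) {s : Play V X} (hs : s.IsThread) :
    e.append s ∈ x.glue X ↔ e'.append s ∈ x.glue X := by
  rcases hs.isEmbs_or_exists with h1 | ⟨W, z, s, hz, hW, rfl⟩
  · exact ⟨fun h2 => ⟨h2.1, Or.inl ((Play.isEmbs_append _ _).2 ⟨he', h1⟩)⟩,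
      fun h2 => ⟨h2.1, Or.inl ((Play.isEmbs_append _ _).2 ⟨he, h1⟩)⟩⟩
  · have h1 : (e.append z).IsEmbs := (Play.isEmbs_append _ _).2 ⟨he, hz⟩
    have h2 : (e'.append z).IsEmbs := (Play.isEmbs_append _ _).2 ⟨he', hz⟩
    have h3 : (e.append z).geom = (e'.append z).geom := by
      rw [Play.geom_append, Play.geom_append, h]
    rw [← Play.append_assoc, ← Play.append_assoc,
      mem_glue_iff h1 (x.mem_of_isAtomic h1.isEmb_geom hW),
      mem_glue_iff h2 (x.mem_of_isAtomic h2.isEmb_geom hW)]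
    simp only [h3]

theorem isStrategy_glue : IsStrategy x.glue where
  isThread p hp := isThread_of_mem_glue hp
  prefix_closed := by
    rintro V X t t' ⟨hn, h | ⟨W, e, s, hm, he, h, hs⟩⟩
    · exact ⟨hn, Or.inl ((Play.isEmbs_append _ _).1 h).1⟩
    · rcases Play.append_eq_append h with ⟨z, rfl, rfl⟩ | ⟨z, rfl, rfl⟩
      · exact ⟨hn, Or.inr ⟨W, e, z, hm, he, rfl,
          (x.strat _ hm).isStrategy.prefix_closed z t' hs⟩⟩
      · exact ⟨hn, Or.inl ((Play.isEmbs_append _ _).1 he).1⟩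
  mandatory := by
    rintro V W t f hf ⟨hn, h | ⟨Z, e, s, hm, he, rfl, hs⟩⟩
    · cases f with
      | emb k hk => exact ⟨hn, Or.inl h⟩
      | move m hm =>
        have h1 := x.mem_of_isAtomic h.isEmb_geom hf.1
        exact ⟨hn, Or.inr ⟨V, t, Play.nil.snoc (GMove.move m hm), h1, h, rfl,
          (x.strat _ h1).isStrategy.mandatory Play.nil _ hf (hn _ _)⟩⟩
    · exact ⟨hn, Or.inr ⟨Z, e, s.snoc f, hm, he, rfl,
        (x.strat _ hm).isStrategy.mandatory s f hf hs⟩⟩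
  iso := by
    intro X Y X' Y' Z t m m' j i hj hi t' ht ht' hji hii hk hm
    have key : ∀ {V : Hypersequent} (e : Play U V) (s : Play V Y), e.IsEmbs → V.IsAtomic →
        s.IsThread → ((((e.append s).snoc m).append t' ∈ x.glue Z ↔
          ((((e.append s).snoc (GMove.emb i hi)).snoc m').snoc (GMove.emb j hj)).append t' ∈
            x.glue Z)) := by
      intro V e s he hV hs
      have h1 := x.mem_of_isAtomic he.isEmb_geom hV
      have h2 := (x.strat _ h1).isStrategy.iso s m m' j i hj hi t' hs ht' hji hii hk hm
      rw [← mem_glue_iff he h1, ← mem_glue_iff he h1, ← Play.append_assoc,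
        ← Play.append_assoc] at h2
      exact h2
    rcases ht.isEmbs_or_exists with h | ⟨V, e, s, he, hV, rfl⟩
    · cases m with
      | emb k hk1 =>
        cases m' with
        | move m' hm' => exact hk.elim
        | emb k' hk' =>
          refine embs_append_mem_glue_congr (e := t.snoc (GMove.emb k hk1))
            (e' := ((t.snoc (GMove.emb i hi)).snoc (GMove.emb k' hk')).snoc (GMove.emb j hj))
            h h ?_ ht'
          simp only [GMove.hom] at hm
          simp [Play.geom, GMove.hom, hm]
      | move m hm1 =>
        cases m' with
        | emb k' hk' => exact hk.elim
        | move m' hm' =>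
          -- Over a hypersequent that is not atomic, neither play is a thread and both sides are
          -- false.
          by_cases hY : Y.IsAtomic
          · exact key t Play.nil h hY trivial
          · constructor
            · intro hp
              have := ((Play.isThread_append _ _).1 (isThread_of_mem_glue hp)).1
              exact absurd this.2 hY
            · intro hp
              have := ((Play.isThread_append _ _).1 (isThread_of_mem_glue hp)).1
              exact absurd (isAtomic_of_iso (inv i) this.2) hY
    · exact key e s he hV ((Play.isThread_append _ _).1 ht).2
  comp := by
    intro X Y Z W t h h' hh hh' t' ht ht'
    rcases ht.isEmbs_or_exists with h1 | ⟨V, e, s, he, hV, rfl⟩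
    · refine embs_append_mem_glue_congr (e := (t.snoc (GMove.emb h hh)).snoc (GMove.emb h' hh'))
        (e' := t.snoc (GMove.emb _ (IsEmb.comp_mem _ _ hh' hh))) h1 h1 ?_ ht'
      simp [Play.geom, GMove.hom]
    · have h1 := x.mem_of_isAtomic he.isEmb_geom hV
      have h2 := (x.strat _ h1).isStrategy.comp s h h' hh hh' t'
        ((Play.isThread_append _ _).1 ht).2 ht'
      rw [← mem_glue_iff he h1, ← mem_glue_iff he h1, ← Play.append_assoc,
        ← Play.append_assoc] at h2
      exact h2

/-- The glued strategy. -/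
def glued (x : StrategyFamily U) : Strategy U := ⟨x.glue, isStrategy_glue⟩

theorem glued_restrict {V : Hypersequent} {f : V ⟶ U} (hf : x.mem f) :
    x.glued.restrict f (x.isEmb hf) = x.strat f hf := by
  ext X s
  have hg : (embPlay f (x.isEmb hf)).geom = f := geom_embPlay _ _
  have hm : x.mem (embPlay f (x.isEmb hf)).geom := by rwa [hg]
  refine (mem_glue_iff (x := x) (e := embPlay f (x.isEmb hf)) trivial hm s).trans ?_
  simp only [hg]

theorem eq_of_restrict {P Q : Strategy U} (h : ∀ {V : Hypersequent} {f : V ⟶ U} (hf : x.mem f),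
    P.restrict f (x.isEmb hf) = Q.restrict f (x.isEmb hf)) : P = Q := by
  have key : ∀ {P Q : Strategy U}, (∀ {V : Hypersequent} {f : V ⟶ U} (hf : x.mem f),
      P.restrict f (x.isEmb hf) = Q.restrict f (x.isEmb hf)) →
      ∀ X (p : Play U X), p ∈ P.plays X → p ∈ Q.plays X := by
    intro P Q h X p hp
    have hPe : ∀ {V : Hypersequent} {e : Play U V} (he : e.IsEmbs) (hm : x.mem e.geom)
        {X : Hypersequent} (s : Play V X), e.append s ∈ P.plays X ↔ e.append s ∈ Q.plays X := by
      intro V e he hm X s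
      rw [P.isStrategy.embs_append_iff he, Q.isStrategy.embs_append_iff he]
      have h1 := congrArg (fun S : Strategy V => s ∈ S.plays X) (h hm)
      exact Iff.of_eq h1
    rcases (P.isStrategy.isThread p hp).isEmbs_or_exists with h1 | ⟨V, e, s, he, hV, rfl⟩
    · refine Q.isStrategy.embs_mem ?_ h1
      -- For a play made of embeddings only nonemptiness has to be transferred, and any member of
      -- the sieve can witness it.
      obtain ⟨V, f, hf⟩ := x.exists_mem
      have h2 : embPlay f (x.isEmb hf) ∈ P.plays V :=
        P.isStrategy.embs_mem (P.isStrategy.prefix_closed Play.nil p (by rwa [Play.nil_append]))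
          (e := embPlay f (x.isEmb hf)) trivial
      have h3 := (hPe (e := embPlay f (x.isEmb hf)) trivial
        (by rwa [geom_embPlay]) Play.nil).1 h2
      exact Q.isStrategy.prefix_closed Play.nil (embPlay f (x.isEmb hf)) h3
    · exact (hPe he (x.mem_of_isAtomic he.isEmb_geom hV) s).1 hp
  ext X p
  exact ⟨key h X p, key (fun hf => (h hf).symm) X p⟩

theorem isCutFree_glued (h : ∀ {V : Hypersequent} {f : V ⟶ U} (hf : x.mem f),
    (x.strat f hf).IsCutFree) : x.glued.IsCutFree := by
  rintro X p ⟨-, h1 | ⟨V, e, s, hm, he, rfl, hs⟩⟩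
  · exact h1.isCutFree
  · exact (Play.isCutFree_append _ _).2 ⟨he.isCutFree, h hm _ _ hs⟩

end StrategyFamily

/-! ### The sheaf condition and the main theorem -/

/-- Some embedding of the sieve reaches the vertex, or the edge if there is no vertex, and is then
an isomorphism. For an empty `U` any embedding will do, and its existence is the nonemptiness
condition on covering sieves. -/
theorem id_mem_of_isAtomic {U : EmbCat} {R : Sieve U} (hR : R ∈ embTopology U)
    (hU : U.obj.IsAtomic) : R (𝟙 U) := by
  have key : ∀ {V : EmbCat} (f : V ⟶ U), R f → IsIso f.hom → R (𝟙 U) := by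
    intro V f hf hi
    have h1 : (⟨inv f.hom, IsEmb.of_isIso _⟩ : U ⟶ V) ≫ f = 𝟙 U := by
      apply WideSubcategory.hom_ext
      change inv f.hom ≫ f.hom = 𝟙 _
      simp
    rw [← h1]
    exact R.downward_closed hf _
  obtain ⟨⟨V, f, hf⟩, hR⟩ := hR
  rcases hU with ⟨hE, hV⟩ | ⟨hV, e, he⟩ | ⟨v, hv, he⟩
  · exact key f hf (f.property.isIso_of (fun e => hE.elim e) (fun v => hV.elim v))
  · obtain ⟨V, f, hf, hx⟩ := hR (Sum.inl e)
    obtain ⟨e₁, he₁⟩ := f.property.inl_mem_range.1 hx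
    refine key f hf (f.property.isIso_of (fun e' => ⟨e₁, [], ?_⟩) (fun v => hV.elim v))
    rw [he e', he₁]
  · obtain ⟨V, f, hf, hx⟩ := hR (Sum.inr v)
    obtain ⟨w, -⟩ := f.property.inr_mem_range.1 hx
    exact key f hf (f.property.surjective_of_isAtomic (Or.inr (Or.inr ⟨v, hv, he⟩)) w)

/-- A compatible family of elements of the presheaf of strategies on a covering sieve. -/
def StrategyFamily.ofSieve {U : EmbCat} {R : Sieve U} (hR : R ∈ embTopology U)
    (x : ∀ {V : EmbCat} (f : V ⟶ U), R f → Strategy V.obj)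
    (hx : ∀ {V W : EmbCat} (f : V ⟶ U) (k : W ⟶ V) (hf : R f),
      x (k ≫ f) (R.downward_closed hf k) = (x f hf).restrict k.hom k.property) :
    StrategyFamily U.obj where
  mem {V} f := ∃ h : IsEmb f, R (⟨f, h⟩ : (⟨V⟩ : EmbCat) ⟶ U)
  strat {V} f hf := x (⟨f, hf.1⟩ : (⟨V⟩ : EmbCat) ⟶ U) hf.2
  isEmb hf := hf.1
  comp_mem {V W f k} hk hf := ⟨IsEmb.comp_mem _ _ hk hf.1,
    R.downward_closed hf.2 (⟨k, hk⟩ : (⟨W⟩ : EmbCat) ⟶ ⟨V⟩)⟩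
  strat_comp {V W f k} hk hf := hx (⟨f, hf.1⟩ : (⟨V⟩ : EmbCat) ⟶ U)
    (⟨k, hk⟩ : (⟨W⟩ : EmbCat) ⟶ ⟨V⟩) hf.2
  mem_of_isAtomic {V f} hf hV := by
    refine ⟨hf, ?_⟩
    have h1 := id_mem_of_isAtomic (embTopology.pullback_stable
      (⟨f, hf⟩ : (⟨V⟩ : EmbCat) ⟶ U) hR) hV
    rwa [Sieve.pullback_apply, Category.id_comp] at h1
  exists_mem := let ⟨⟨V, f, hf⟩, _⟩ := hR; ⟨V.obj, f.hom, f.property, hf⟩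

theorem isSheaf_stratPresheaf : Presheaf.IsSheaf embTopology stratPresheaf := by
  rw [isSheaf_iff_isSheaf_of_type]
  intro U R hR x hx
  have hx' := (Presieve.compatible_iff_sieveCompatible x).1 hx
  let y := StrategyFamily.ofSieve hR (fun f hf => x f hf) (fun f k hf => hx' f k hf)
  refine ⟨y.glued, fun V f hf => ?_, fun P hP => ?_⟩
  · exact y.glued_restrict ⟨f.property, hf⟩
  · refine StrategyFamily.eq_of_restrict (x := y) fun {V f} hf => ?_
    exact (hP _ hf.2).trans (StrategyFamily.glued_restrict (x := y) hf).symm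

/-- Cut freeness is local: a glued play is a run of embeddings, possibly followed by a play of some
member of the family. -/
theorem isSheaf_cutFreePresheaf : Presheaf.IsSheaf embTopology cutFreePresheaf := by
  rw [isSheaf_iff_isSheaf_of_type]
  intro U R hR x hx
  have hx' := (Presieve.compatible_iff_sieveCompatible x).1 hx
  let y := StrategyFamily.ofSieve hR (fun f hf => (x f hf).1)
    (fun f k hf => congrArg Subtype.val (hx' f k hf))
  refine ⟨⟨y.glued, StrategyFamily.isCutFree_glued fun {V f} hf => (x _ hf.2).2⟩,
    fun V f hf => Subtype.ext ?_, fun P hP => Subtype.ext ?_⟩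
  · exact y.glued_restrict ⟨f.property, hf⟩
  · refine StrategyFamily.eq_of_restrict (x := y) fun {V f} hf => ?_
    exact (congrArg Subtype.val (hP _ hf.2)).trans
      (StrategyFamily.glued_restrict (x := y) hf).symm

/-- Cut elimination as a morphism of presheaves. -/
def cutElimNatTrans : stratPresheaf ⟶ cutFreePresheaf where
  app U := TypeCat.ofHom fun P => ⟨cutElimStrategy P, isCutFree_cutElimStrategy P⟩
  naturality U V h := by
    apply ConcreteCategory.hom_ext
    intro P
    exact Subtype.ext (cutElimStrategy_restrict P h.unop.hom h.unop.property)

end MALLGame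

theorem mainTheorem5 :
    ∃ (hS : Presheaf.IsSheaf MALLGame.embTopology MALLGame.stratPresheaf)
      (hC : Presheaf.IsSheaf MALLGame.embTopology MALLGame.cutFreePresheaf)
      (φ : (⟨MALLGame.stratPresheaf, hS⟩ : Sheaf MALLGame.embTopology (Type 1)) ⟶
        ⟨MALLGame.cutFreePresheaf, hC⟩),
      ∀ (U : MALLGame.Hypersequent) (P : MALLGame.Strategy U),
        (φ.hom.app (Opposite.op ⟨U⟩) P).1.plays = MALLGame.cutElim U P.plays := by
  exact ⟨MALLGame.isSheaf_stratPresheaf, MALLGame.isSheaf_cutFreePresheaf,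
    ⟨MALLGame.cutElimNatTrans⟩, fun _ _ => rfl⟩
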